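/- Let $\mathbb{K}\in\{\mathbb{R},\mathbb{C}\}$, $d\ge 1$, and let $E\neq\{0\}$ be a locally complete locally convex Hausdorff space over $\mathbb{K}$, i.e. for every closed bounded absolutely convex set $D\subset E$ the space $E_D=\bigcup_{n\in\mathbb{N}}nD$ with the gauge of $D$ as norm is a Banach space. Let $\mathcal{S}(\mathbb{R}^d,E)$ be the space of all $f\in\mathcal{C}^\infty(\mathbb{R}^d,E)$ (continuous partial derivatives of all orders, derivatives being limits of difference quotients in $E$) such that \[ |f|_{m,p}:=\sup_{x\in\mathbb{R}^d,\,\beta\in\mathbb{N}_0^d,\,|\beta|\le m}p\bigl(\partial^\beta f(x)\bigr)(1+|x|^2)^{m/2}<\infty \] for all $m\in\mathbb{N}_0$ and all continuous seminorms $p$ on $E$, with the topology given by these seminorms. Let $s(\mathbb{N}_0^d,E)$ be the space of all families $(x_n)_{n\in\mathbb{N}_0^d}$ in $E$ with $\sup_{n}p(x_n)(1+|n|^2)^{j/2}<\infty$ ($|n|$ the Euclidean norm) for all $j\in\mathbb{N}_0$ and all continuous seminorms $p$, with the topology given by these seminorms. Put $\mathcal{S}(\mathbb{R}^d):=\mathcal{S}(\mathbb{R}^d,\mathbb{K})$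 and $s(\mathbb{N}_0^d):=s(\mathbb{N}_0^d,\mathbb{K})$. For $n\in\mathbb{N}_0^d$ let $h_n(x)=\prod_{k=1}^d h_{n_k}(x_k)$ be the Hermite function, where $h_j(t)=(2^j j!\sqrt{\pi})^{-1/2}H_j(t)e^{-t^2/2}$ and $H_0=1$, $H_{j+1}(t)=2tH_j(t)-H_j'(t)$. A function $g\colon\mathbb{R}^d\to E$ is Pettis-integrable if $e'\circ g$ is Lebesgue-integrable for all $e'\in E'$ and there is $e\in E$ with $e'(e)=\int e'(g(x))\,dx$ for all $e'\in E'$; then $\int g(x)\,dx:=e$. For locally convex Hausdorff spaces $F,E$ let $F\varepsilon E:=L_e(F'_\kappa,E)$ be the space of continuous linear maps from $F'$, with the topology of uniform convergence on absolutely convex compact subsets of $F$, to $E$, equipped with the topology of uniform convergence on equicontinuous subsets of $F'$. For continuous linear $T\colon F_1\to F_2$ let $T\varepsilon\operatorname{id}_E\colon F_1\varepsilon E\to F_2\varepsilon E$, $u\mapsto u\circ T^t$, where $T^t(y)=y\circ T$. For a space $\mathcal{F}$ of $\mathbb{K}$-valued functions with continuous point evaluations $\delta_x$ write $S_{\mathcal{F}}(u)(x):=u(\delta_x)$,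 $u\in\mathcal{F}\varepsilon E$. A Schauder decomposition of a locally convex Hausdorff space $F$ is a sequence $(P_k)$ of continuous linear maps $F\to F$ with $P_kP_j=P_{\min(k,j)}$ for all $k,j$, $P_k\ne P_j$ for $k\neq j$, and $P_kf\to f$ for all $f\in F$. Then for every $f\in\mathcal{S}(\mathbb{R}^d,E)$ and $n\in\mathbb{N}_0^d$ the function $fh_n$ is Pettis-integrable on $\mathbb{R}^d$, and with $\widehat{f}(n):=\int_{\mathbb{R}^d}f(x)h_n(x)\,dx$ the following holds. a) Each map $Q_n\colon f\mapsto\widehat{f}(n)h_n$ is a continuous linear operator on $\mathcal{S}(\mathbb{R}^d,E)$, the sequence $\bigl(\sum_{n\in\mathbb{N}_0^d,\,|n|\le k}Q_n\bigr)_{k\in\mathbb{N}_0}$ is a Schauder decomposition of $\mathcal{S}(\mathbb{R}^d,E)$ (both when $|n|$ is the Euclidean norm and when $|n|=n_1+\dots+n_d$), and \[ f=\sum_{n\in\mathbb{N}_0^d}\widehat{f}(n)h_n,\qquad f\in\mathcal{S}(\mathbb{R}^d,E), \] with unconditional convergence in $\mathcal{S}(\mathbb{R}^d,E)$. b) The map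 $\mathscr{F}^E\colon\mathcal{S}(\mathbb{R}^d,E)\to s(\mathbb{N}_0^d,E)$, $f\mapsto(\widehat{f}(n))_{n\in\mathbb{N}_0^d}$, is a well-defined topological isomorphism, as is its scalar version $\mathscr{F}^{\mathbb{K}}\colon\mathcal{S}(\mathbb{R}^d)\to s(\mathbb{N}_0^d)$; the maps $S_{\mathcal{S}(\mathbb{R}^d)}\colon\mathcal{S}(\mathbb{R}^d)\varepsilon E\to\mathcal{S}(\mathbb{R}^d,E)$ and $S_{s(\mathbb{N}_0^d)}\colon s(\mathbb{N}_0^d)\varepsilon E\to s(\mathbb{N}_0^d,E)$ are well-defined topological isomorphisms, and \[ \mathscr{F}^E=S_{s(\mathbb{N}_0^d)}\circ(\mathscr{F}^{\mathbb{K}}\varepsilon\operatorname{id}_E)\circ S_{\mathcal{S}(\mathbb{R}^d)}^{-1}. \] -/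

import Mathlib

open Filter Topology MeasureTheory Bornology Polynomial
open scoped ComplexOrder Pointwise Nat

/-! ### Locally complete spaces -/

section LocallyComplete

variable (𝕂 : Type*) [RCLike 𝕂] {E : Type*} [AddCommGroup E] [Module 𝕂 E] [TopologicalSpace E]

/-- A disk is a (non-empty) bounded absolutely convex set. -/
structure IsDisk (D : Set E) : Prop where
  nonempty : D.Nonempty
  absConvex : AbsConvex 𝕂 D
  bounded : IsVonNBounded 𝕂 D

/-- The set `E_D = ⋃ n, n D` underlying the space spanned by a disk `D`. -/
def diskSpan (D : Set E) : Set E := ⋃ n : ℕ, (n : 𝕂) • D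

variable (E) in
/-- `E` is locally complete if for every closed disk `D` the space `E_D`, normed by the gauge
functional of `D`, is complete. -/
def LocallyComplete [Module ℝ E] : Prop :=
  ∀ D : Set E, IsDisk 𝕂 D → IsClosed D →
    ∀ u : ℕ → E, (∀ n, u n ∈ diskSpan 𝕂 D) →
      (∀ ε : ℝ, 0 < ε → ∃ N, ∀ m ≥ N, ∀ n ≥ N, gauge D (u m - u n) < ε) →
      ∃ x ∈ diskSpan 𝕂 D, ∀ ε : ℝ, 0 < ε → ∃ N, ∀ n ≥ N, gauge D (u n - x) < ε

end LocallyComplete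

/-! ### The Pettis integral -/

section Pettis

variable (𝕂 : Type*) [RCLike 𝕂] {E : Type*} [AddCommGroup E] [Module 𝕂 E] [TopologicalSpace E]
  {X : Type*} [MeasurableSpace X]

/-- `f` is weakly integrable and has an integral in `E` representing the integrals of all
`e' ∘ f`. -/
def PettisIntegrable (f : X → E) (μ : Measure X) : Prop :=
  (∀ e' : E →L[𝕂] 𝕂, Integrable (fun x => e' (f x)) μ) ∧
    ∃ e : E, ∀ e' : E →L[𝕂] 𝕂, e' e = ∫ x, e' (f x) ∂μ

open Classical in
/-- The Pettis integral (with value `0` if `f` is not Pettis integrable). -/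
noncomputable def pettisIntegral (f : X → E) (μ : Measure X) : E :=
  if h : PettisIntegrable 𝕂 f μ then h.2.choose else 0

end Pettis

/-! ### The `ε`-product -/

section EpsProduct

variable (𝕂 : Type*) [RCLike 𝕂]

/-- `F'_κ`: the dual of `F` with the topology of uniform convergence on the absolutely convex
compact subsets of `F`. -/
abbrev KappaDual (F : Type*) [AddCommGroup F] [Module 𝕂 F] [TopologicalSpace F] : Type _ :=
  UniformConvergenceCLM (RingHom.id 𝕂) (E := F) 𝕂 {K : Set F | AbsConvex 𝕂 K ∧ IsCompact K}

/-- `F ε E = L_e(F'_κ, E)`: the continuous linear maps from `F'_κ` to `E` with the topology of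
uniform convergence on the equicontinuous subsets of `F'`. -/
abbrev EpsProduct (F : Type*) [AddCommGroup F] [Module 𝕂 F] [TopologicalSpace F]
    (E : Type*) [AddCommGroup E] [Module 𝕂 E] [TopologicalSpace E] : Type _ :=
  UniformConvergenceCLM (RingHom.id 𝕂) (E := KappaDual 𝕂 F) E
    {H : Set (KappaDual 𝕂 F) | Equicontinuous fun (y : H) (x : F) => y.1 x}

variable {𝕂}

/-- The dual map `T^t : F₂' → F₁'`, `y ↦ y ∘ T`, as a continuous linear map `F₂'_κ → F₁'_κ`. -/
noncomputable def kappaTranspose {F₁ F₂ : Type*}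
    [AddCommGroup F₁] [Module 𝕂 F₁] [TopologicalSpace F₁]
    [AddCommGroup F₂] [Module 𝕂 F₂] [TopologicalSpace F₂]
    (T : F₁ →L[𝕂] F₂) : KappaDual 𝕂 F₂ →L[𝕂] KappaDual 𝕂 F₁ :=
  T.precompUniformConvergenceCLM 𝕂 _ _ (by
    rintro K ⟨hK, hc⟩
    refine ⟨⟨?_, ?_⟩, hc.image T.continuous⟩
    · intro a ha
      rintro _ ⟨_, ⟨x, hx, rfl⟩, rfl⟩
      exact ⟨a • x, hK.1 a ha ⟨x, hx, rfl⟩, by simp⟩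
    · exact hK.2.linear_image T.toLinearMap)

theorem kappaTranspose_apply {F₁ F₂ : Type*}
    [AddCommGroup F₁] [Module 𝕂 F₁] [TopologicalSpace F₁]
    [AddCommGroup F₂] [Module 𝕂 F₂] [TopologicalSpace F₂]
    (T : F₁ →L[𝕂] F₂) (y : KappaDual 𝕂 F₂) (x : F₁) : kappaTranspose T y x = y (T x) := rfl

/-- The `ε`-product `T₁ ε T₂ : F₁ ε F₂ → E₁ ε E₂`, `u ↦ T₂ ∘ u ∘ T₁^t`, of two operators
`Tᵢ : Fᵢ → Eᵢ`. -/
noncomputable def epsMap {F₁ F₂ E₁ E₂ : Type*}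
    [AddCommGroup F₁] [Module 𝕂 F₁] [TopologicalSpace F₁]
    [AddCommGroup F₂] [Module 𝕂 F₂] [TopologicalSpace F₂]
    [IsTopologicalAddGroup F₂] [ContinuousSMul 𝕂 F₂]
    [AddCommGroup E₁] [Module 𝕂 E₁] [TopologicalSpace E₁]
    [AddCommGroup E₂] [Module 𝕂 E₂] [TopologicalSpace E₂]
    [IsTopologicalAddGroup E₂] [ContinuousSMul 𝕂 E₂]
    (T₁ : F₁ →L[𝕂] E₁) (T₂ : F₂ →L[𝕂] E₂) : EpsProduct 𝕂 F₁ F₂ →L[𝕂] EpsProduct 𝕂 E₁ E₂ :=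
  (T₂.postcompUniformConvergenceCLM _).comp
    ((kappaTranspose T₁).precompUniformConvergenceCLM F₂ _ _ (by
      intro H hH x₀ U hU
      have h := hH (T₁ x₀) U hU
      filter_upwards [T₁.continuous.tendsto x₀ h] with x hx
      rintro ⟨_, y, hy, rfl⟩
      exact hx ⟨y, hy⟩))

theorem epsMap_apply {F₁ F₂ E₁ E₂ : Type*}
    [AddCommGroup F₁] [Module 𝕂 F₁] [TopologicalSpace F₁]
    [AddCommGroup F₂] [Module 𝕂 F₂] [TopologicalSpace F₂]
    [IsTopologicalAddGroup F₂] [ContinuousSMul 𝕂 F₂]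
    [AddCommGroup E₁] [Module 𝕂 E₁] [TopologicalSpace E₁]
    [AddCommGroup E₂] [Module 𝕂 E₂] [TopologicalSpace E₂]
    [IsTopologicalAddGroup E₂] [ContinuousSMul 𝕂 E₂]
    (T₁ : F₁ →L[𝕂] E₁) (T₂ : F₂ →L[𝕂] E₂) (u : EpsProduct 𝕂 F₁ F₂) (y : KappaDual 𝕂 E₁) :
    epsMap T₁ T₂ u y = T₂ (u (kappaTranspose T₁ y)) := rfl

end EpsProduct

/-! ### Schauder decompositions -/

/-- A Schauder decomposition of `F`: a sequence of continuous projections `P k` with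
`P k P j = P (min k j)`, `P k ≠ P j` for `k ≠ j`, and `P k f → f` for all `f`. -/
structure IsSchauderDecomposition {𝕂 F : Type*} [RCLike 𝕂] [AddCommGroup F] [Module 𝕂 F]
    [TopologicalSpace F] (P : ℕ → F →L[𝕂] F) : Prop where
  comp_eq : ∀ k j, (P k).comp (P j) = P (min k j)
  ne : ∀ k j, k ≠ j → P k ≠ P j
  tendsto : ∀ f, Tendsto (fun k => P k f) atTop (𝓝 f)

/-! ### Partial derivatives of vector-valued functions -/

section Smooth

variable {d : ℕ} {E : Type*} [AddCommGroup E] [Module ℝ E] [TopologicalSpace E]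

/-- The difference quotient of `f` at `x` in the direction of the `i`-th unit vector. -/
noncomputable def diffQuot (i : Fin d) (f : EuclideanSpace ℝ (Fin d) → E)
    (x : EuclideanSpace ℝ (Fin d)) (h : ℝ) : E :=
  h⁻¹ • (f (x + h • EuclideanSpace.single i (1 : ℝ)) - f x)

/-- `e` is the `i`-th partial derivative of `f` at `x`. -/
def HasPartialDerivAt (i : Fin d) (f : EuclideanSpace ℝ (Fin d) → E) (e : E)
    (x : EuclideanSpace ℝ (Fin d)) : Prop :=
  Tendsto (diffQuot i f x) (𝓝[≠] 0) (𝓝 e)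

/-- The `i`-th partial derivative of `f`, as a function (meaningful where it exists). -/
noncomputable def partialDeriv (i : Fin d) (f : EuclideanSpace ℝ (Fin d) → E) :
    EuclideanSpace ℝ (Fin d) → E :=
  fun x => @limUnder _ _ _ ⟨0⟩ (𝓝[≠] 0) (diffQuot i f x)

/-- `k`-times continuously partially differentiable functions. -/
def IsCk : ℕ → (EuclideanSpace ℝ (Fin d) → E) → Prop
  | 0, f => Continuous f
  | k + 1, f => ∀ i : Fin d, (∀ x, ∃ e, HasPartialDerivAt i f e x) ∧
      Continuous (partialDeriv i f) ∧ IsCk k (partialDeriv i f)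

/-- Infinitely continuously partially differentiable functions. -/
def IsSmooth (f : EuclideanSpace ℝ (Fin d) → E) : Prop := ∀ k, IsCk k f

/-- `∂^β f = ∂_1^{β_1} ⋯ ∂_d^{β_d} f`. -/
noncomputable def iterPartialDeriv (β : Fin d → ℕ) (f : EuclideanSpace ℝ (Fin d) → E) :
    EuclideanSpace ℝ (Fin d) → E :=
  (List.finRange d).foldr (fun i g => (partialDeriv i)^[β i] g) f

theorem HasPartialDerivAt.partialDeriv_eq [T2Space E] {i : Fin d}
    {f : EuclideanSpace ℝ (Fin d) → E} {e : E} {x : EuclideanSpace ℝ (Fin d)}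
    (h : HasPartialDerivAt i f e x) : partialDeriv i f x = e :=
  Tendsto.limUnder_eq h

theorem HasPartialDerivAt.add [ContinuousAdd E] {i : Fin d}
    {f g : EuclideanSpace ℝ (Fin d) → E} {a b : E} {x : EuclideanSpace ℝ (Fin d)}
    (hf : HasPartialDerivAt i f a x) (hg : HasPartialDerivAt i g b x) :
    HasPartialDerivAt i (f + g) (a + b) x := by
  refine (Tendsto.add hf hg).congr fun h => ?_
  simp only [diffQuot, Pi.add_apply, ← smul_add]
  congr 1
  abel

theorem HasPartialDerivAt.const_smul {𝕂 : Type*} [RCLike 𝕂] [Module 𝕂 E] [IsScalarTower ℝ 𝕂 E]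
    [ContinuousConstSMul 𝕂 E] (c : 𝕂) {i : Fin d}
    {f : EuclideanSpace ℝ (Fin d) → E} {a : E} {x : EuclideanSpace ℝ (Fin d)}
    (hf : HasPartialDerivAt i f a x) : HasPartialDerivAt i (c • f) (c • a) x := by
  refine (Tendsto.const_smul hf c).congr fun h => ?_
  simp only [diffQuot, Pi.smul_apply, ← smul_sub]
  rw [smul_comm]

theorem IsSmooth.exists_hasPartialDerivAt {f : EuclideanSpace ℝ (Fin d) → E} (hf : IsSmooth f)
    (i : Fin d) (x : EuclideanSpace ℝ (Fin d)) : ∃ e, HasPartialDerivAt i f e x :=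
  (hf 1 i).1 x

theorem IsSmooth.partialDeriv {f : EuclideanSpace ℝ (Fin d) → E} (hf : IsSmooth f)
    (i : Fin d) : IsSmooth (partialDeriv i f) :=
  fun k => (hf (k + 1) i).2.2

theorem partialDeriv_add [T2Space E] [ContinuousAdd E] {i : Fin d}
    {f g : EuclideanSpace ℝ (Fin d) → E}
    (hf : ∀ x, ∃ e, HasPartialDerivAt i f e x) (hg : ∀ x, ∃ e, HasPartialDerivAt i g e x) :
    partialDeriv i (f + g) = partialDeriv i f + partialDeriv i g := by
  funext x
  obtain ⟨a, ha⟩ := hf x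
  obtain ⟨b, hb⟩ := hg x
  rw [(ha.add hb).partialDeriv_eq, Pi.add_apply, ha.partialDeriv_eq, hb.partialDeriv_eq]

theorem partialDeriv_smul {𝕂 : Type*} [RCLike 𝕂] [Module 𝕂 E] [IsScalarTower ℝ 𝕂 E]
    [ContinuousConstSMul 𝕂 E] [T2Space E] (c : 𝕂) {i : Fin d}
    {f : EuclideanSpace ℝ (Fin d) → E} (hf : ∀ x, ∃ e, HasPartialDerivAt i f e x) :
    partialDeriv i (c • f) = c • partialDeriv i f := by
  funext x
  obtain ⟨a, ha⟩ := hf x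
  rw [(ha.const_smul c).partialDeriv_eq, Pi.smul_apply, ha.partialDeriv_eq]

theorem IsCk.add [T2Space E] [ContinuousAdd E] {k : ℕ} {f g : EuclideanSpace ℝ (Fin d) → E}
    (hf : IsCk k f) (hg : IsCk k g) : IsCk k (f + g) := by
  induction k generalizing f g with
  | zero => exact Continuous.add hf hg
  | succ k ih =>
    intro i
    obtain ⟨f₁, f₂, f₃⟩ := hf i
    obtain ⟨g₁, g₂, g₃⟩ := hg i
    rw [partialDeriv_add f₁ g₁]
    refine ⟨fun x => ?_, f₂.add g₂, ih f₃ g₃⟩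
    obtain ⟨a, ha⟩ := f₁ x
    obtain ⟨b, hb⟩ := g₁ x
    exact ⟨a + b, ha.add hb⟩

theorem IsCk.const_smul {𝕂 : Type*} [RCLike 𝕂] [Module 𝕂 E] [IsScalarTower ℝ 𝕂 E]
    [ContinuousConstSMul 𝕂 E] [T2Space E] (c : 𝕂) {k : ℕ} {f : EuclideanSpace ℝ (Fin d) → E}
    (hf : IsCk k f) : IsCk k (c • f) := by
  induction k generalizing f with
  | zero => exact Continuous.const_smul hf c
  | succ k ih =>
    intro i
    obtain ⟨f₁, f₂, f₃⟩ := hf i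
    rw [partialDeriv_smul c f₁]
    refine ⟨fun x => ?_, f₂.const_smul c, ih f₃⟩
    obtain ⟨a, ha⟩ := f₁ x
    exact ⟨c • a, ha.const_smul c⟩


theorem hasPartialDerivAt_zero (i : Fin d) (x : EuclideanSpace ℝ (Fin d)) :
    HasPartialDerivAt i (0 : EuclideanSpace ℝ (Fin d) → E) 0 x :=
  tendsto_const_nhds.congr fun h => by simp [diffQuot]

theorem partialDeriv_zero [T2Space E] (i : Fin d) :
    partialDeriv i (0 : EuclideanSpace ℝ (Fin d) → E) = 0 :=
  funext fun x => (hasPartialDerivAt_zero i x).partialDeriv_eq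

theorem isCk_zero [T2Space E] (k : ℕ) : IsCk k (0 : EuclideanSpace ℝ (Fin d) → E) := by
  induction k with
  | zero => exact continuous_const
  | succ k ih =>
    intro i
    rw [partialDeriv_zero]
    exact ⟨fun x => ⟨0, hasPartialDerivAt_zero i x⟩, continuous_const, ih⟩

variable (𝕂 : Type*) [RCLike 𝕂] [Module 𝕂 E] [IsScalarTower ℝ 𝕂 E]

variable (d E) in
/-- The space `C^∞(ℝ^d, E)`. -/
def smoothSubmodule [T2Space E] [ContinuousAdd E] [ContinuousConstSMul 𝕂 E] :
    Submodule 𝕂 (EuclideanSpace ℝ (Fin d) → E) where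
  carrier := {f | IsSmooth f}
  add_mem' hf hg k := (hf k).add (hg k)
  zero_mem' k := isCk_zero k
  smul_mem' c _ hf k := (hf k).const_smul c

variable [T2Space E] [ContinuousAdd E] [ContinuousConstSMul 𝕂 E]

/-- The partial derivative as a linear operator on `C^∞(ℝ^d, E)`. -/
noncomputable def partialDerivₗ (i : Fin d) : smoothSubmodule d E 𝕂 →ₗ[𝕂] smoothSubmodule d E 𝕂 where
  toFun f := ⟨partialDeriv i f.1, IsSmooth.partialDeriv f.2 i⟩
  map_add' f g := Subtype.ext <|
    partialDeriv_add (IsSmooth.exists_hasPartialDerivAt f.2 i)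
      (IsSmooth.exists_hasPartialDerivAt g.2 i)
  map_smul' c f := Subtype.ext <|
    partialDeriv_smul c (IsSmooth.exists_hasPartialDerivAt f.2 i)

/-- `∂^β` as a linear operator on `C^∞(ℝ^d, E)`. -/
noncomputable def iterPartialDerivₗ (β : Fin d → ℕ) :
    smoothSubmodule d E 𝕂 →ₗ[𝕂] smoothSubmodule d E 𝕂 :=
  (List.finRange d).foldr (fun i g => ((partialDerivₗ 𝕂 i) ^ β i) ∘ₗ g) LinearMap.id

theorem iterPartialDerivₗ_coe (β : Fin d → ℕ) (f : smoothSubmodule d E 𝕂) :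
    (iterPartialDerivₗ 𝕂 β f : EuclideanSpace ℝ (Fin d) → E) = iterPartialDeriv β f.1 := by
  have hp : ∀ (i : Fin d) (n : ℕ) (g : smoothSubmodule d E 𝕂),
      (((partialDerivₗ 𝕂 i) ^ n) g : EuclideanSpace ℝ (Fin d) → E)
        = (partialDeriv i)^[n] g.1 := by
    intro i n
    induction n with
    | zero => intro g; rfl
    | succ n ih =>
      intro g
      rw [pow_succ, Module.End.mul_apply, ih, Function.iterate_succ_apply]
      rfl
  unfold iterPartialDerivₗ iterPartialDeriv
  induction List.finRange d with
  | nil => rfl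
  | cons i l ih =>
    rw [List.foldr_cons, List.foldr_cons, LinearMap.comp_apply, hp, ih]

end Smooth

/-! ### Weighted sup-seminorms -/

/-- The seminorm `v ↦ sup_i p (T v i) w_i`. -/
noncomputable def weightedSupSeminorm {𝕂 E V I : Type*} [RCLike 𝕂] [AddCommGroup E] [Module 𝕂 E]
    [AddCommGroup V] [Module 𝕂 V] (T : V →ₗ[𝕂] (I → E)) (w : I → ℝ) (hw : ∀ i, 0 ≤ w i)
    (p : Seminorm 𝕂 E) (hb : ∀ v, BddAbove (Set.range fun i => p (T v i) * w i)) :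
    Seminorm 𝕂 V :=
  Seminorm.ofSMulLE (fun v => ⨆ i, p (T v i) * w i)
    (by simp)
    (fun v v' => by
      refine Real.iSup_le (fun i => ?_) (add_nonneg
        (Real.iSup_nonneg fun i => mul_nonneg (apply_nonneg p _) (hw i))
        (Real.iSup_nonneg fun i => mul_nonneg (apply_nonneg p _) (hw i)))
      calc p (T (v + v') i) * w i ≤ (p (T v i) + p (T v' i)) * w i := by
            rw [map_add, Pi.add_apply]
            exact mul_le_mul_of_nonneg_right (map_add_le_add p _ _) (hw i)
        _ = p (T v i) * w i + p (T v' i) * w i := add_mul _ _ _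
        _ ≤ _ := add_le_add (le_ciSup (hb v) i) (le_ciSup (hb v') i))
    (fun c v => by
      refine Real.iSup_le (fun i => ?_) (mul_nonneg (norm_nonneg c)
        (Real.iSup_nonneg fun i => mul_nonneg (apply_nonneg p _) (hw i)))
      rw [map_smul, Pi.smul_apply, map_smul_eq_mul, mul_assoc]
      exact mul_le_mul_of_nonneg_left (le_ciSup (hb v) i) (norm_nonneg c))

/-! ### The Schwartz space -/

section Schwartz

variable (𝕂 : Type*) [RCLike 𝕂] (d : ℕ) (E : Type*) [AddCommGroup E] [Module 𝕂 E] [Module ℝ E]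
  [IsScalarTower ℝ 𝕂 E] [TopologicalSpace E] [IsTopologicalAddGroup E] [ContinuousSMul 𝕂 E]
  [T2Space E]

/-- The continuous seminorms of `E`, a directed fundamental system of seminorms if `E` is locally
convex. -/
abbrev ContSeminorm (𝕂 : Type*) [RCLike 𝕂] (E : Type*) [AddCommGroup E] [Module 𝕂 E]
    [TopologicalSpace E] : Type _ := {p : Seminorm 𝕂 E // Continuous p}

instance (𝕂 : Type*) [RCLike 𝕂] (E : Type*) [AddCommGroup E] [Module 𝕂 E]
    [TopologicalSpace E] : Nonempty (ContSeminorm 𝕂 E) :=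
  ⟨⟨0, continuous_const⟩⟩

/-- The pairs `(β, x)` with `|β| ≤ m`. -/
abbrev SchwartzIndex (d m : ℕ) : Type :=
  {β : Fin d → ℕ // ∑ i, β i ≤ m} × EuclideanSpace ℝ (Fin d)

/-- The weight `(1 + |x|²)^{m/2}`. -/
noncomputable def schwartzWeight (m : ℕ) (q : SchwartzIndex d m) : ℝ :=
  (1 + ‖q.2‖ ^ 2) ^ ((m : ℝ) / 2)

/-- The `E`-valued Schwartz functions: smooth functions `f` with
`sup_{x, |β| ≤ m} p (∂^β f x) (1 + |x|²)^{m/2} < ∞` for all `m` and all continuous seminorms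
`p`. -/
def schwartzSubmodule : Submodule 𝕂 (smoothSubmodule d E 𝕂) where
  carrier := {f | ∀ (m : ℕ) (p : ContSeminorm 𝕂 E), BddAbove (Set.range fun q : SchwartzIndex d m =>
    p.1 (iterPartialDeriv q.1.1 f.1 q.2) * schwartzWeight d m q)}
  add_mem' {f g} hf hg m p := by
    obtain ⟨a, ha⟩ := hf m p
    obtain ⟨b, hb⟩ := hg m p
    refine ⟨a + b, ?_⟩
    rintro _ ⟨q, rfl⟩
    have hw : 0 ≤ schwartzWeight d m q := by unfold schwartzWeight; positivity
    have h₁ := ha ⟨q, rfl⟩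
    have h₂ := hb ⟨q, rfl⟩
    simp only [← iterPartialDerivₗ_coe, map_add] at h₁ h₂ ⊢
    have h₃ := mul_le_mul_of_nonneg_right (map_add_le_add p.1
      ((iterPartialDerivₗ 𝕂 q.1.1 f).1 q.2) ((iterPartialDerivₗ 𝕂 q.1.1 g).1 q.2)) hw
    rw [add_mul] at h₃
    exact h₃.trans (add_le_add h₁ h₂)
  zero_mem' m p := by
    refine ⟨0, ?_⟩
    rintro _ ⟨q, rfl⟩
    simp only [← iterPartialDerivₗ_coe, map_zero]
    simp
  smul_mem' c f hf m p := by
    obtain ⟨a, ha⟩ := hf m p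
    refine ⟨‖c‖ * a, ?_⟩
    rintro _ ⟨q, rfl⟩
    have h₁ := ha ⟨q, rfl⟩
    simp only [← iterPartialDerivₗ_coe, map_smul] at h₁ ⊢
    rw [Submodule.coe_smul, Pi.smul_apply, map_smul_eq_mul, mul_assoc]
    exact mul_le_mul_of_nonneg_left h₁ (norm_nonneg c)

/-- The Schwartz space `S(ℝ^d, E)`. -/
def SchwartzSp : Type _ := schwartzSubmodule 𝕂 d E

namespace SchwartzSp

instance : AddCommGroup (SchwartzSp 𝕂 d E) := inferInstanceAs (AddCommGroup (schwartzSubmodule 𝕂 d E))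

instance : Module 𝕂 (SchwartzSp 𝕂 d E) := inferInstanceAs (Module 𝕂 (schwartzSubmodule 𝕂 d E))

instance : FunLike (SchwartzSp 𝕂 d E) (EuclideanSpace ℝ (Fin d)) E where
  coe f := f.1.1
  coe_injective _ _ h := Subtype.ext (Subtype.ext h)

/-- `∂^β` as a linear map from `S(ℝ^d, E)` to functions. -/
noncomputable def derivₗ (m : ℕ) : SchwartzSp 𝕂 d E →ₗ[𝕂] (SchwartzIndex d m → E) where
  toFun f q := iterPartialDeriv q.1.1 f q.2
  map_add' f g := funext fun q => by
    have h := iterPartialDerivₗ_coe 𝕂 q.1.1 (f.1 + g.1)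
    rw [map_add] at h
    exact (congrFun h q.2).symm.trans (by
      rw [Submodule.coe_add, iterPartialDerivₗ_coe, iterPartialDerivₗ_coe]; rfl)
  map_smul' c f := funext fun q => by
    have h := iterPartialDerivₗ_coe 𝕂 q.1.1 (c • f.1)
    rw [map_smul] at h
    exact (congrFun h q.2).symm.trans (by
      rw [Submodule.coe_smul, iterPartialDerivₗ_coe]; rfl)

/-- The seminorms `|f|_{m,p} = sup_{x, |β| ≤ m} p (∂^β f x) (1 + |x|²)^{m/2}`. -/
noncomputable def seminorms : SeminormFamily 𝕂 (SchwartzSp 𝕂 d E) (ℕ × ContSeminorm 𝕂 E) :=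
  fun a => weightedSupSeminorm (derivₗ 𝕂 d E a.1) (schwartzWeight d a.1)
    (fun q => by unfold schwartzWeight; positivity) a.2.1 (fun f => f.2 a.1 a.2)

theorem seminorms_apply (m : ℕ) (p : ContSeminorm 𝕂 E) (f : SchwartzSp 𝕂 d E) :
    seminorms 𝕂 d E (m, p) f = ⨆ q : SchwartzIndex d m,
      p.1 (iterPartialDeriv q.1.1 f q.2) * (1 + ‖q.2‖ ^ 2) ^ ((m : ℝ) / 2) := rfl

noncomputable instance : TopologicalSpace (SchwartzSp 𝕂 d E) :=
  (seminorms 𝕂 d E).moduleFilterBasis.topology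

theorem withSeminorms : WithSeminorms (seminorms 𝕂 d E) := ⟨rfl⟩

instance : IsTopologicalAddGroup (SchwartzSp 𝕂 d E) := (withSeminorms 𝕂 d E).topologicalAddGroup

instance : ContinuousSMul 𝕂 (SchwartzSp 𝕂 d E) := (withSeminorms 𝕂 d E).continuousSMul

/-- The point evaluation `δ_x` as an element of `S(ℝ^d)'`. -/
noncomputable def delta (x : EuclideanSpace ℝ (Fin d)) : KappaDual 𝕂 (SchwartzSp 𝕂 d 𝕂) :=
  UniformConvergenceCLM.ofFun _ _ _
    { toFun := fun f => f x
      map_add' := fun _ _ => rfl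
      map_smul' := fun _ _ => rfl
      cont := by
        refine WithSeminorms.continuous_of_isBounded (withSeminorms 𝕂 d 𝕂) (norm_withSeminorms 𝕂 𝕂)
          ({ toFun := fun f => f x, map_add' := fun _ _ => rfl, map_smul' := fun _ _ => rfl } :
            SchwartzSp 𝕂 d 𝕂 →ₗ[𝕂] 𝕂) fun _ => ⟨{(0, ⟨normSeminorm 𝕂 𝕂, continuous_norm⟩)}, 1, ?_⟩
        intro f
        have h := le_ciSup (f.2 0 ⟨normSeminorm 𝕂 𝕂, continuous_norm⟩) (⟨0, by simp⟩, x)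
        have h₀ : iterPartialDeriv (0 : Fin d → ℕ) (f.1.1) = f.1.1 := by
          unfold iterPartialDeriv
          induction List.finRange d with
          | nil => rfl
          | cons i l ih => rw [List.foldr_cons, ih]; rfl
        rw [h₀] at h
        simp only [schwartzWeight, CharP.cast_eq_zero, zero_div, Real.rpow_zero, mul_one] at h
        simp only [Finset.sup_singleton, one_smul]
        refine le_trans h ?_
        rw [seminorms_apply]
        simp only [CharP.cast_eq_zero, zero_div, Real.rpow_zero, mul_one]
        exact le_rfl }

end SchwartzSp

end Schwartz

/-! ### Rapidly decreasing sequences -/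

/-- The Euclidean norm of a multi-index. -/
noncomputable def euclNorm {d : ℕ} (n : Fin d → ℕ) : ℝ := √(∑ i, (n i : ℝ) ^ 2)

section RapidlyDecreasing

variable (𝕂 : Type*) [RCLike 𝕂] (d : ℕ) (E : Type*) [AddCommGroup E] [Module 𝕂 E]
  [TopologicalSpace E]

/-- The weight `(1 + |n|²)^{j/2}`. -/
noncomputable def rapidWeight (j : ℕ) (n : Fin d → ℕ) : ℝ := (1 + euclNorm n ^ 2) ^ ((j : ℝ) / 2)

/-- The families `x` with `sup_n p (x n) (1 + |n|²)^{j/2} < ∞` for all `j` and all continuous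
seminorms `p`. -/
def rapidSubmodule : Submodule 𝕂 ((Fin d → ℕ) → E) where
  carrier := {x | ∀ (j : ℕ) (p : ContSeminorm 𝕂 E), BddAbove (Set.range fun n =>
    p.1 (x n) * rapidWeight d j n)}
  add_mem' {x y} hx hy j p := by
    obtain ⟨a, ha⟩ := hx j p
    obtain ⟨b, hb⟩ := hy j p
    refine ⟨a + b, ?_⟩
    rintro _ ⟨n, rfl⟩
    have hw : 0 ≤ rapidWeight d j n := by unfold rapidWeight; positivity
    have h := mul_le_mul_of_nonneg_right (map_add_le_add p.1 (x n) (y n)) hw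
    rw [add_mul] at h
    exact h.trans (add_le_add (ha ⟨n, rfl⟩) (hb ⟨n, rfl⟩))
  zero_mem' j p := ⟨0, by rintro _ ⟨n, rfl⟩; simp⟩
  smul_mem' c x hx j p := by
    obtain ⟨a, ha⟩ := hx j p
    refine ⟨‖c‖ * a, ?_⟩
    rintro _ ⟨n, rfl⟩
    simp only [Pi.smul_apply, map_smul_eq_mul, mul_assoc]
    exact mul_le_mul_of_nonneg_left (ha ⟨n, rfl⟩) (norm_nonneg c)

/-- The space `s(ℕ₀^d, E)` of rapidly decreasing `E`-valued sequences. -/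
def RapidSp : Type _ := rapidSubmodule 𝕂 d E

namespace RapidSp

instance : AddCommGroup (RapidSp 𝕂 d E) := inferInstanceAs (AddCommGroup (rapidSubmodule 𝕂 d E))

instance : Module 𝕂 (RapidSp 𝕂 d E) := inferInstanceAs (Module 𝕂 (rapidSubmodule 𝕂 d E))

instance : FunLike (RapidSp 𝕂 d E) (Fin d → ℕ) E where
  coe x := x.1
  coe_injective _ _ h := Subtype.ext h

/-- The seminorms `|x|_{j,p} = sup_n p (x n) (1 + |n|²)^{j/2}`. -/
noncomputable def seminorms : SeminormFamily 𝕂 (RapidSp 𝕂 d E) (ℕ × ContSeminorm 𝕂 E) :=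
  fun a => weightedSupSeminorm (rapidSubmodule 𝕂 d E).subtype (rapidWeight d a.1)
    (fun n => by unfold rapidWeight; positivity) a.2.1 (fun x => x.2 a.1 a.2)

theorem seminorms_apply (j : ℕ) (p : ContSeminorm 𝕂 E) (x : RapidSp 𝕂 d E) :
    seminorms 𝕂 d E (j, p) x =
      ⨆ n : Fin d → ℕ, p.1 (x n) * (1 + euclNorm n ^ 2) ^ ((j : ℝ) / 2) := rfl

noncomputable instance : TopologicalSpace (RapidSp 𝕂 d E) :=
  (seminorms 𝕂 d E).moduleFilterBasis.topology

theorem withSeminorms : WithSeminorms (seminorms 𝕂 d E) := ⟨rfl⟩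

instance : IsTopologicalAddGroup (RapidSp 𝕂 d E) := (withSeminorms 𝕂 d E).topologicalAddGroup

instance : ContinuousSMul 𝕂 (RapidSp 𝕂 d E) := (withSeminorms 𝕂 d E).continuousSMul

/-- The point evaluation `δ_n` as an element of `s(ℕ₀^d)'`. -/
noncomputable def delta (n : Fin d → ℕ) : KappaDual 𝕂 (RapidSp 𝕂 d 𝕂) :=
  UniformConvergenceCLM.ofFun _ _ _
    { toFun := fun x => x n
      map_add' := fun _ _ => rfl
      map_smul' := fun _ _ => rfl
      cont := by
        refine WithSeminorms.continuous_of_isBounded (withSeminorms 𝕂 d 𝕂) (norm_withSeminorms 𝕂 𝕂)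
          ({ toFun := fun x => x n, map_add' := fun _ _ => rfl, map_smul' := fun _ _ => rfl } :
            RapidSp 𝕂 d 𝕂 →ₗ[𝕂] 𝕂) fun _ => ⟨{(0, ⟨normSeminorm 𝕂 𝕂, continuous_norm⟩)}, 1, ?_⟩
        intro x
        have h := le_ciSup (x.2 0 ⟨normSeminorm 𝕂 𝕂, continuous_norm⟩) n
        simp only [rapidWeight, CharP.cast_eq_zero, zero_div, Real.rpow_zero, mul_one] at h
        simp only [Finset.sup_singleton, one_smul]
        refine le_trans h ?_
        rw [seminorms_apply]
        simp only [CharP.cast_eq_zero, zero_div, Real.rpow_zero, mul_one]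
        exact le_rfl }

end RapidSp

end RapidlyDecreasing

/-! ### Hermite functions and Fourier coefficients -/

/-- The Hermite polynomials `H_0 = 1`, `H_{n+1} = 2 x H_n - H_n'`. -/
noncomputable def hermitePoly : ℕ → ℝ[X]
  | 0 => 1
  | n + 1 => 2 * X * hermitePoly n - derivative (hermitePoly n)

/-- `h_n(x) = (2^n n! √π)^{-1/2} H_n(x) e^{-x²/2}` on `ℝ`. -/
noncomputable def hermiteFun₁ (n : ℕ) (x : ℝ) : ℝ :=
  (2 ^ n * n ! * √Real.pi) ^ (-(1 / 2) : ℝ) * (hermitePoly n).eval x * Real.exp (-x ^ 2 / 2)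

/-- The Hermite functions `h_n(x) = ∏ k, h_{n_k}(x_k)` on `ℝ^d`. -/
noncomputable def hermiteFun {d : ℕ} (n : Fin d → ℕ) (x : EuclideanSpace ℝ (Fin d)) : ℝ :=
  ∏ k, hermiteFun₁ (n k) (x k)

/-- The Fourier coefficient `∫ f(x) h_n(x) dx`, a Pettis integral. -/
noncomputable def hermiteCoeff (𝕂 : Type*) [RCLike 𝕂] {d : ℕ} {E : Type*} [AddCommGroup E]
    [Module 𝕂 E] [Module ℝ E] [TopologicalSpace E] (f : EuclideanSpace ℝ (Fin d) → E)
    (n : Fin d → ℕ) : E :=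
  pettisIntegral 𝕂 (fun x => hermiteFun n x • f x) volume

/-- The multi-indices of length `∑ i, n i` at most `k`. -/
def lengthBall (d k : ℕ) : Finset (Fin d → ℕ) :=
  {n ∈ Fintype.piFinset fun _ : Fin d => Finset.range (k + 1) | ∑ i, n i ≤ k}

theorem mem_lengthBall {d k : ℕ} {n : Fin d → ℕ} : n ∈ lengthBall d k ↔ ∑ i, n i ≤ k := by
  simp only [lengthBall, Finset.mem_filter, Fintype.mem_piFinset, Finset.mem_range,
    and_iff_right_iff_imp]
  intro h i
  exact Nat.lt_succ_of_le
    ((Finset.single_le_sum (fun j _ => Nat.zero_le (n j)) (Finset.mem_univ i)).trans h)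

open Classical in
/-- The multi-indices of Euclidean norm at most `k`. -/
noncomputable def euclBall (d k : ℕ) : Finset (Fin d → ℕ) :=
  {n ∈ Fintype.piFinset fun _ : Fin d => Finset.range (k + 1) | euclNorm n ≤ k}

theorem mem_euclBall {d k : ℕ} {n : Fin d → ℕ} : n ∈ euclBall d k ↔ euclNorm n ≤ k := by
  simp only [euclBall, Finset.mem_filter, Fintype.mem_piFinset, Finset.mem_range,
    and_iff_right_iff_imp]
  intro h i
  have h₁ : (n i : ℝ) ≤ euclNorm n :=
    Real.le_sqrt_of_sq_le
      (Finset.single_le_sum (f := fun j => (n j : ℝ) ^ 2) (fun j _ => sq_nonneg _)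
        (Finset.mem_univ i))
  exact Nat.lt_succ_of_le (by exact_mod_cast h₁.trans h)

set_option linter.unusedSectionVars false

universe v

/-! ### Locally convex spaces and their continuous seminorms -/

section LocallyConvex

variable {𝕂 : Type*} [RCLike 𝕂] {E : Type*} [AddCommGroup E] [Module 𝕂 E] [TopologicalSpace E]

/-! Everything is transported from the sequence space. The core is that taking Hermite coefficients
(`analysis`) and summing Hermite series (`synthesis`) are continuous and mutually inverse. The
expansion, the Schauder decompositions and the `ε`-product statements then follow from their
elementary counterparts for coordinate sequences.

Local completeness enters through `LocallyComplete.exists_banach`: a bounded set lies in a ball of a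
Banach space continuously embedded in `E`. Hence a bounded family with summable coefficients is
summable, and a Schwartz function, being Lipschitz and decaying in such a Banach space, is Bochner
integrable against `h_n`; the image of that integral in `E` is the Pettis integral.

Synthesis. By the ladder relations, `∂_i` and multiplication by `x_i` act on Hermite series as
weighted shifts of the coefficients, each costing one order of decay. Since sup norms of Hermite
functions grow polynomially (`hermiteFun₁_sq_le`), differentiation is termwise, and every Schwartz
seminorm of the series is bounded by one sequence seminorm with the same `p`.

Analysis. Integration by parts moves `x_i - ∂_i` from `h_n` onto `f` as `x_i + ∂_i`
(`IsDirSchwartz.integral_raise`), so each application gains a factor `√(n_i + 1)`. This is done for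
the scalar functions `e' ∘ f` with `|e'| ≤ p`, and Hahn–Banach (`seminorm_le_of_dual`) returns the
estimate for `p`.

Inverse maps. Orthonormality gives one composition. The other needs completeness of the Hermite
system: if all coefficients of `u` vanish, then so do all moments of `h_0 u`, hence its Fourier
transform, hence `u`.

The `ε`-product. In the `κ`-dual of the scalar sequence space every `y` equals `∑ y(e_n) δ_n`
(`RapidSp.hasSum_smul_delta`), so `u` is determined by the values `u(δ_n)`. Conversely, a sequence
`x` defines `y ↦ ∑ y(e_n) x_n`, which is continuous because boxes with rapidly decreasing side
lengths are compact (`isCompact_rapidBox`). The Schwartz case is conjugated to this one by the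
coefficient isomorphisms, and the asserted factorization is then built in. -/

theorem polynormableSpace_of_locallyConvexSpace_real [Module ℝ E] [IsScalarTower ℝ 𝕂 E]
    [IsTopologicalAddGroup E] [ContinuousSMul 𝕂 E] [LocallyConvexSpace ℝ E] :
    PolynormableSpace 𝕂 E := by
  have : ContinuousSMul ℝ E := IsScalarTower.continuousSMul 𝕂
  -- In the order on `𝕂` the nonnegative scalars are exactly the nonnegative reals, so convexity
  -- over `ℝ` and over `𝕂` coincide.
  have : LocallyConvexSpace 𝕂 E := by
    refine ⟨fun x => ?_⟩
    refine (LocallyConvexSpace.convex_basis (𝕜 := ℝ) x).to_hasBasis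
      (fun s hs => ⟨s, ⟨hs.1, ?_⟩, subset_rfl⟩) (fun s hs => ⟨s, ⟨hs.1, ?_⟩, subset_rfl⟩)
    · exact convex_of_nonneg_surjective_algebraMap _
        (fun _ => RCLike.nonneg_iff_exists_ofReal.mp) hs.2
    · exact hs.2.lift ℝ
  infer_instance

theorem tendsto_of_contSeminorm [PolynormableSpace 𝕂 E] {α : Type*} {l : Filter α} {u : α → E}
    {e : E} (h : ∀ p : ContSeminorm 𝕂 E, Tendsto (fun a => p.1 (u a - e)) l (𝓝 0)) :
    Tendsto u l (𝓝 e) := by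
  rw [(PolynormableSpace.withSeminorms 𝕂 E).tendsto_nhds]
  intro p ε hε
  exact (h p).eventually_lt_const hε

theorem eq_of_contSeminorm [PolynormableSpace 𝕂 E] [T2Space E] {a b : E}
    (h : ∀ p : ContSeminorm 𝕂 E, p.1 (a - b) ≤ 0) : a = b := by
  refine tendsto_nhds_unique (f := fun _ : ℕ => a) (l := atTop) tendsto_const_nhds ?_
  refine tendsto_of_contSeminorm (𝕂 := 𝕂) fun p => ?_
  rw [le_antisymm (h p) (apply_nonneg _ _)]
  exact tendsto_const_nhds

/-- Hahn–Banach, applied to `c • e ↦ p(e) c` on the line through `e`. It reduces estimates of `p` to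
scalar estimates uniform over the functionals dominated by `p`. -/
theorem exists_dual_eq_seminorm [PolynormableSpace 𝕂 E] (p : ContSeminorm 𝕂 E) (e : E) :
    ∃ f : E →L[𝕂] 𝕂, (∀ x, ‖f x‖ ≤ p.1 x) ∧ ‖f e‖ = p.1 e := by
  rcases eq_or_ne e 0 with rfl | he
  · exact ⟨0, fun x => by simp, by simp⟩
  let ψ : (𝕂 ∙ e) →ₗ[𝕂] 𝕂 := (p.1 e : 𝕂) • (LinearEquiv.toSpanNonzeroSingleton 𝕂 E e he).symm
  have hψ : ∀ c : 𝕂, ∀ h, ψ ⟨c • e, h⟩ = p.1 e * c := fun c h => by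
    have : (LinearEquiv.toSpanNonzeroSingleton 𝕂 E e he).symm ⟨c • e, h⟩ = c := by
      rw [LinearEquiv.symm_apply_eq]; rfl
    simp [ψ, this, RCLike.real_smul_eq_coe_mul]
  obtain ⟨g, hg, hp⟩ := Module.Dual.exists_continuous_extension_of_le_seminorm (𝕂 ∙ e) ψ p.2
    (by
      rintro ⟨x, hx⟩
      obtain ⟨c, rfl⟩ := Submodule.mem_span_singleton.1 hx
      rw [hψ, norm_mul, RCLike.norm_ofReal, abs_of_nonneg (apply_nonneg _ _), map_smul_eq_mul,
        mul_comm])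
  refine ⟨g, hp, ?_⟩
  have h := hg ⟨(1 : 𝕂) • e, Submodule.smul_mem _ _ (Submodule.mem_span_singleton_self e)⟩
  rw [hψ] at h
  simp only [one_smul, mul_one] at h
  rw [h, RCLike.norm_ofReal, abs_of_nonneg (apply_nonneg _ _)]

theorem seminorm_le_of_dual [PolynormableSpace 𝕂 E] (p : ContSeminorm 𝕂 E) {e : E} {r : ℝ}
    (h : ∀ f : E →L[𝕂] 𝕂, (∀ x, ‖f x‖ ≤ p.1 x) → ‖f e‖ ≤ r) : p.1 e ≤ r := by
  obtain ⟨f, hf, he⟩ := exists_dual_eq_seminorm p e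
  exact he ▸ h f hf

theorem eq_of_dual [PolynormableSpace 𝕂 E] [T2Space E] {a b : E}
    (h : ∀ f : E →L[𝕂] 𝕂, f a = f b) : a = b :=
  eq_of_contSeminorm (𝕂 := 𝕂) fun p => seminorm_le_of_dual p fun f _ => by simp [h f]

end LocallyConvex

/-! ### Banach spaces spanned by disks -/

section Disk

variable {𝕂 : Type*} [RCLike 𝕂] {E : Type v} [AddCommGroup E] [Module 𝕂 E] [Module ℝ E]
  [IsScalarTower ℝ 𝕂 E] [TopologicalSpace E]

theorem ContSeminorm.map_real_smul (p : ContSeminorm 𝕂 E) (r : ℝ) (e : E) :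
    p.1 (r • e) = |r| * p.1 e := by
  rw [← algebraMap_smul 𝕂 r e, map_smul_eq_mul, norm_algebraMap', Real.norm_eq_abs]

/-- The set of points on which every continuous seminorm `p` is bounded by `M p`. -/
def seminormDisk (M : ContSeminorm 𝕂 E → ℝ) : Set E := {e | ∀ p, p.1 e ≤ M p}

theorem mem_smul_seminormDisk {M : ContSeminorm 𝕂 E → ℝ} {r : ℝ} (hr : 0 < r) {e : E} :
    e ∈ r • seminormDisk M ↔ ∀ p, p.1 e ≤ r * M p := by
  rw [Set.mem_smul_set_iff_inv_smul_mem₀ hr.ne']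
  refine forall_congr' fun p => ?_
  rw [p.map_real_smul, abs_of_pos (inv_pos.2 hr), inv_mul_le_iff₀ hr]

theorem isDisk_seminormDisk [PolynormableSpace 𝕂 E] {M : ContSeminorm 𝕂 E → ℝ}
    (hM : ∀ p, 0 ≤ M p) : IsDisk 𝕂 (seminormDisk M) where
  nonempty := ⟨0, fun p => by simpa using hM p⟩
  absConvex := by
    refine ⟨?_, ?_⟩
    · rintro a ha _ ⟨e, he, rfl⟩ p
      rw [map_smul_eq_mul]
      exact (mul_le_of_le_one_left (apply_nonneg _ _) ha).trans (he p)
    · intro x hx y hy a b ha hb hab p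
      obtain ⟨a, ha', rfl⟩ := RCLike.nonneg_iff_exists_ofReal.1 ha
      obtain ⟨b, hb', rfl⟩ := RCLike.nonneg_iff_exists_ofReal.1 hb
      have hab' : a + b = 1 := by exact_mod_cast hab
      refine (map_add_le_add _ _ _).trans ?_
      rw [map_smul_eq_mul, map_smul_eq_mul, RCLike.norm_ofReal, RCLike.norm_ofReal,
        abs_of_nonneg ha', abs_of_nonneg hb']
      calc a * p.1 x + b * p.1 y ≤ a * M p + b * M p := by
            gcongr
            exacts [hx p, hy p]
        _ = M p := by rw [← add_mul, hab', one_mul]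
  bounded := by
    rw [(PolynormableSpace.withSeminorms 𝕂 E).isVonNBounded_iff_seminorm_bounded]
    exact fun p => ⟨M p + 1, by linarith [hM p], fun x hx => (hx p).trans_lt (by linarith)⟩

theorem isClosed_seminormDisk (M : ContSeminorm 𝕂 E → ℝ) : IsClosed (seminormDisk M) := by
  have : seminormDisk M = ⋂ p : ContSeminorm 𝕂 E, {e | p.1 e ≤ M p} := by
    ext e; simp [seminormDisk]
  rw [this]
  exact isClosed_iInter fun p => isClosed_le p.2 continuous_const

/-- Every `t` above the gauge is admissible, and the non-strict inequalities survive `t ↓ r`, so the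
infimum is attained. Membership in the span (`he`) matters: off the span the gauge is the infimum of
the empty set, that is `0`. -/
theorem gauge_seminormDisk_le_iff {M : ContSeminorm 𝕂 E → ℝ} (hM : ∀ p, 0 ≤ M p) {e : E}
    (he : ∃ s, ∀ p, p.1 e ≤ s * M p) {r : ℝ} (hr : 0 ≤ r) :
    gauge (seminormDisk M) e ≤ r ↔ ∀ p, p.1 e ≤ r * M p := by
  have key : ∀ t, r < t → (gauge (seminormDisk M) e ≤ r → ∀ p, p.1 e ≤ t * M p) := by
    intro t ht h
    obtain ⟨s, hs⟩ := he
    have hne : {r ∈ Set.Ioi (0 : ℝ) | e ∈ r • seminormDisk M}.Nonempty := by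
      refine ⟨|s| + 1, by simp only [Set.mem_Ioi]; positivity, ?_⟩
      rw [mem_smul_seminormDisk (by positivity)]
      refine fun p => (hs p).trans (mul_le_mul_of_nonneg_right ?_ (hM p))
      linarith [le_abs_self s]
    obtain ⟨t', ⟨ht'0, ht'⟩, hlt⟩ := exists_lt_of_csInf_lt hne (h.trans_lt ht)
    rw [mem_smul_seminormDisk ht'0] at ht'
    exact fun p => (ht' p).trans (mul_le_mul_of_nonneg_right hlt.le (hM p))
  constructor
  · intro h p
    have : Tendsto (fun t => t * M p) (𝓝[>] r) (𝓝 (r * M p)) :=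
      ((continuous_mul_const (M p)).tendsto r).mono_left nhdsWithin_le_nhds
    refine ge_of_tendsto this ?_
    filter_upwards [self_mem_nhdsWithin] with t ht using key t ht h p
  · intro h
    refine le_of_forall_gt_imp_ge_of_dense fun t ht => ?_
    refine gauge_le_of_mem (hr.trans ht.le) ?_
    rw [mem_smul_seminormDisk (hr.trans_lt ht)]
    exact fun p => (h p).trans (mul_le_mul_of_nonneg_right ht.le (hM p))

/-- The span of a seminorm disk. -/
def seminormDiskSpan (M : ContSeminorm 𝕂 E → ℝ) : Submodule ℝ E where
  carrier := {e | ∃ s, 0 ≤ s ∧ ∀ p, p.1 e ≤ s * M p}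
  add_mem' := by
    rintro a b ⟨s, hs, ha⟩ ⟨t, ht, hb⟩
    exact ⟨s + t, by positivity, fun p => (map_add_le_add _ _ _).trans (by
      rw [add_mul]; exact add_le_add (ha p) (hb p))⟩
  zero_mem' := ⟨0, le_rfl, fun p => by simp⟩
  smul_mem' := by
    rintro c a ⟨s, hs, ha⟩
    refine ⟨|c| * s, by positivity, fun p => ?_⟩
    rw [p.map_real_smul, mul_assoc]
    exact mul_le_mul_of_nonneg_left (ha p) (abs_nonneg c)

theorem gauge_seminormDisk_smul [PolynormableSpace 𝕂 E] {M : ContSeminorm 𝕂 E → ℝ}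
    (c : ℝ) (e : E) :
    gauge (seminormDisk M) (c • e) = |c| * gauge (seminormDisk M) e := by
  have hb : Balanced ℝ (seminormDisk M) := by
    rintro a ha _ ⟨e, he, rfl⟩ p
    simp only [p.map_real_smul]
    exact (mul_le_of_le_one_left (apply_nonneg _ _) ha).trans (he p)
  rw [gauge_smul hb, Real.norm_eq_abs]

/-- In a locally complete space, every bounded set is contained in the image of a ball of a
Banach space. -/
theorem LocallyComplete.exists_banach [PolynormableSpace 𝕂 E] [T2Space E]
    (hE : LocallyComplete 𝕂 E) {M : ContSeminorm 𝕂 E → ℝ} (hM : ∀ p, 0 ≤ M p) :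
    ∃ (X : Type v) (_ : NormedAddCommGroup X) (_ : NormedSpace ℝ X) (_ : CompleteSpace X)
      (ι : X →ₗ[ℝ] E), Function.Injective ι ∧ (∀ x p, p.1 (ι x) ≤ ‖x‖ * M p) ∧
      ∀ (e : E) (r : ℝ), 0 ≤ r → (∀ p, p.1 e ≤ r * M p) → ∃ x, ι x = e ∧ ‖x‖ ≤ r := by
  let X := seminormDiskSpan M
  let g : X → ℝ := fun x => gauge (seminormDisk M) (x : E)
  have hX : ∀ x : X, ∃ s, ∀ p, p.1 (x : E) ≤ s * M p := fun ⟨x, s, _, hs⟩ => ⟨s, hs⟩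
  have hg : ∀ (x : X) {r : ℝ}, 0 ≤ r → (g x ≤ r ↔ ∀ p, p.1 (x : E) ≤ r * M p) :=
    fun x r hr => gauge_seminormDisk_le_iff hM (hX x) hr
  have hg0 : ∀ x, 0 ≤ g x := fun x => gauge_nonneg _
  have hgp : ∀ x : X, ∀ p, p.1 (x : E) ≤ g x * M p := fun x => (hg x (hg0 x)).1 le_rfl
  let : Norm X := ⟨g⟩
  have core : NormedSpace.Core ℝ X :=
    { norm_nonneg := hg0
      norm_smul := fun c x => gauge_seminormDisk_smul (M := M) c (x : E)
      norm_triangle := fun x y => by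
        refine (hg _ (add_nonneg (hg0 x) (hg0 y))).2 fun p => ?_
        rw [add_mul]
        exact (map_add_le_add p.1 _ _).trans (add_le_add (hgp x p) (hgp y p))
      norm_eq_zero_iff := fun x => by
        constructor
        · intro h
          refine Subtype.ext (eq_of_contSeminorm (𝕂 := 𝕂) fun p => ?_)
          have h₁ := hgp x p
          change g x = 0 at h
          simpa [h] using h₁
        · rintro rfl
          exact gauge_zero }
  let : NormedAddCommGroup X := NormedAddCommGroup.ofCore core
  let : NormedSpace ℝ X := NormedSpace.ofCore core
  have hnorm : ∀ x : X, ‖x‖ = g x := fun _ => rfl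
  have span_of_mem : ∀ x : X, (x : E) ∈ diskSpan 𝕂 (seminormDisk M) := by
    rintro ⟨x, s, hs, hx⟩
    obtain ⟨n, hn⟩ := exists_nat_gt s
    refine Set.mem_iUnion.2 ⟨n, ?_⟩
    have h0 : (0 : ℝ) < n := hs.trans_lt hn
    have : x ∈ (n : ℝ) • seminormDisk M := (mem_smul_seminormDisk h0).2 fun p =>
      (hx p).trans (mul_le_mul_of_nonneg_right hn.le (hM p))
    obtain ⟨y, hy, rfl⟩ := this
    refine ⟨y, hy, ?_⟩
    change (n : 𝕂) • y = (n : ℝ) • y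
    rw [Nat.cast_smul_eq_nsmul, Nat.cast_smul_eq_nsmul]
  have mem_of_span : ∀ x ∈ diskSpan 𝕂 (seminormDisk M), x ∈ X := by
    intro x hx
    obtain ⟨n, y, hy, rfl⟩ := Set.mem_iUnion.1 hx
    refine ⟨n, Nat.cast_nonneg n, fun p => ?_⟩
    change p.1 ((n : 𝕂) • y) ≤ _
    rw [map_smul_eq_mul, RCLike.norm_natCast]
    exact mul_le_mul_of_nonneg_left (hy p) (Nat.cast_nonneg n)
  refine ⟨X, inferInstance, inferInstance, ?_, X.subtype, X.subtype_injective, hgp, ?_⟩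
  -- The norm is the gauge by definition, so completeness is the defining property of local
  -- completeness for this closed disk.
  · refine Metric.complete_of_cauchySeq_tendsto fun u hu => ?_
    obtain ⟨x, hx, hux⟩ := hE (seminormDisk M) (isDisk_seminormDisk hM) (isClosed_seminormDisk M)
      (fun n => (u n : E)) (fun n => span_of_mem _) (fun ε hε => by
        obtain ⟨N, hN⟩ := Metric.cauchySeq_iff.1 hu ε hε
        refine ⟨N, fun m hm n hn => ?_⟩
        have := hN m hm n hn
        rwa [dist_eq_norm] at this)
    refine ⟨⟨x, mem_of_span x hx⟩, Metric.tendsto_atTop.2 fun ε hε => ?_⟩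
    obtain ⟨N, hN⟩ := hux ε hε
    refine ⟨N, fun n hn => ?_⟩
    rw [dist_eq_norm]
    exact hN n hn
  · intro e r hr h
    exact ⟨⟨e, r, hr, h⟩, rfl, (hg ⟨e, r, hr, h⟩ hr).2 h⟩

theorem continuous_of_seminorm_le [PolynormableSpace 𝕂 E]
    {X : Type*} [NormedAddCommGroup X] [NormedSpace ℝ X] (ι : X →ₗ[ℝ] E)
    {M : ContSeminorm 𝕂 E → ℝ} (h : ∀ x p, p.1 (ι x) ≤ ‖x‖ * M p) : Continuous ι := by
  rw [continuous_iff_continuousAt]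
  intro x
  refine tendsto_of_contSeminorm (𝕂 := 𝕂) fun p => ?_
  refine squeeze_zero (g := fun y => ‖y - x‖ * M p) (fun _ => apply_nonneg _ _) (fun y => ?_) ?_
  · rw [← map_sub]; exact h _ p
  · have : Continuous fun y => ‖y - x‖ * M p := by fun_prop
    simpa using this.tendsto x

/-- The family lies in the unit ball of the Banach space attached to its own bounds. There the
series converges absolutely, and the continuous inclusion carries the sum to `E`. -/
theorem LocallyComplete.summable_smul [PolynormableSpace 𝕂 E] [T2Space E]
    (hE : LocallyComplete 𝕂 E) {ι : Type*} {y : ι → E} {c : ι → ℝ} (hc : Summable c)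
    (hy : ∀ p : ContSeminorm 𝕂 E, ∃ B, ∀ i, p.1 (y i) ≤ B) : Summable fun i => c i • y i := by
  choose B hB using hy
  obtain ⟨X, _, _, _, J, -, hJ, hX⟩ := hE.exists_banach (M := fun p => |B p|)
    fun p => abs_nonneg _
  have : ∀ i, ∃ x, J x = y i ∧ ‖x‖ ≤ 1 := fun i => hX _ 1 zero_le_one fun p => by
    rw [one_mul]; exact (hB p i).trans (le_abs_self _)
  choose x hx hx1 using this
  have hs : Summable fun i => c i • x i := by
    refine Summable.of_norm_bounded hc.abs fun i => ?_
    rw [norm_smul, Real.norm_eq_abs]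
    exact mul_le_of_le_one_right (abs_nonneg _) (hx1 i)
  have hJc := continuous_of_seminorm_le J hJ
  obtain ⟨s, hs⟩ := hs
  refine ⟨J s, ?_⟩
  simpa [Function.comp_def, hx] using hs.map J hJc

theorem ContSeminorm.le_tsum (p : ContSeminorm 𝕂 E) {ι : Type*} {y : ι → E} {s : E}
    (hs : HasSum y s) {a : ι → ℝ} (ha : Summable a) (h : ∀ i, p.1 (y i) ≤ a i) :
    p.1 s ≤ ∑' i, a i := by
  refine le_of_tendsto ((p.2.tendsto s).comp hs) (Eventually.of_forall fun F => ?_)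
  calc p.1 (∑ i ∈ F, y i) ≤ ∑ i ∈ F, p.1 (y i) :=
        Finset.le_sum_of_subadditive _ (map_zero _).le (map_add_le_add _) _ _
    _ ≤ ∑ i ∈ F, a i := Finset.sum_le_sum fun i _ => h i
    _ ≤ ∑' i, a i := ha.sum_le_tsum _ fun i _ => (apply_nonneg _ _).trans (h i)

end Disk

/-! ### Local completeness of the scalar field -/

/-- Makes the vector-valued results available for `E = 𝕂`. As `D` is bounded, the gauge dominates a
multiple of the norm on the span, so a gauge-Cauchy sequence converges in `𝕂`; closedness of `D`
turns norm limits into gauge limits. -/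
theorem locallyComplete_self (𝕂 : Type*) [RCLike 𝕂] : LocallyComplete 𝕂 𝕂 := by
  intro D hD hDc u hu hC
  have hconv : Convex ℝ D := hD.absConvex.2.lift ℝ
  have hbal : Balanced ℝ D := by
    rintro a ha _ ⟨e, he, rfl⟩
    refine hD.absConvex.1 (a : 𝕂) (by simpa using ha) ⟨e, he, ?_⟩
    simp [Algebra.smul_def]
  have hcast : ∀ n : ℕ, (n : 𝕂) • D = (n : ℝ) • D := fun n => by
    ext x
    simp [Set.mem_smul_set, Algebra.smul_def]
  have mem_iff : ∀ x, x ∈ diskSpan 𝕂 D ↔ ∃ n : ℕ, x ∈ (n : ℝ) • D := fun x => by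
    simp only [diskSpan, Set.mem_iUnion, hcast]
  have hsub : ∀ {r s : ℝ} {x y : 𝕂}, 0 ≤ r → 0 ≤ s → x ∈ r • D → y ∈ s • D →
      x - y ∈ (r + s) • D := by
    intro r s x y hr hs hx hy
    rw [hconv.add_smul hr hs, sub_eq_add_neg]
    refine Set.add_mem_add hx ?_
    obtain ⟨z, hz, rfl⟩ := hy
    exact ⟨-z, hbal.neg_mem_iff.2 hz, by simp⟩
  have hmono : ∀ {r s : ℝ}, 0 ≤ r → r ≤ s → r • D ⊆ s • D := fun hr hrs =>
    hbal.smul_mono (by rwa [Real.norm_of_nonneg hr, Real.norm_of_nonneg (hr.trans hrs)])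
  have hgauge : ∀ {x : 𝕂} {ε : ℝ}, x ∈ diskSpan 𝕂 D → gauge D x < ε → x ∈ ε • D := by
    intro x ε hx hlt
    obtain ⟨n, hn⟩ := (mem_iff x).1 hx
    have hne : {r ∈ Set.Ioi (0 : ℝ) | x ∈ r • D}.Nonempty :=
      ⟨n + 1, by simp only [Set.mem_Ioi]; positivity, hmono (Nat.cast_nonneg n) (by linarith) hn⟩
    obtain ⟨t, ⟨ht0, ht⟩, hlt⟩ := exists_lt_of_csInf_lt hne hlt
    exact hmono (le_of_lt ht0) hlt.le ht
  have hspan : ∀ {x y : 𝕂}, x ∈ diskSpan 𝕂 D → y ∈ diskSpan 𝕂 D → x - y ∈ diskSpan 𝕂 D := by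
    intro x y hx hy
    obtain ⟨n, hn⟩ := (mem_iff x).1 hx
    obtain ⟨m, hm⟩ := (mem_iff y).1 hy
    exact (mem_iff _).2 ⟨n + m, by
      simpa using hsub (Nat.cast_nonneg n) (Nat.cast_nonneg m) hn hm⟩
  obtain ⟨R, hR0, hR⟩ := ((NormedSpace.isVonNBounded_iff 𝕂).1 hD.bounded).exists_pos_norm_le
  have hcauchy : CauchySeq u := by
    refine Metric.cauchySeq_iff.2 fun ε hε => ?_
    obtain ⟨N, hN⟩ := hC (ε / (2 * R)) (by positivity)
    refine ⟨N, fun m hm n hn => ?_⟩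
    obtain ⟨z, hz, hzu⟩ := hgauge (hspan (hu m) (hu n)) (hN m hm n hn)
    rw [dist_eq_norm, ← hzu]
    change ‖(ε / (2 * R)) • z‖ < ε
    rw [norm_smul, Real.norm_of_nonneg (by positivity)]
    calc ε / (2 * R) * ‖z‖ ≤ ε / (2 * R) * R := by gcongr; exact hR z hz
      _ = ε / 2 := by field_simp
      _ < ε := by linarith
  obtain ⟨x, hx⟩ := cauchySeq_tendsto_of_complete hcauchy
  -- Let `m → ∞` in `u n - u m ∈ ε • D`, a closed condition.
  have hlim : ∀ ε : ℝ, 0 < ε → ∃ N, ∀ n ≥ N, u n - x ∈ ε • D := by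
    intro ε hε
    obtain ⟨N, hN⟩ := hC ε hε
    refine ⟨N, fun n hn => (hDc.smul_of_ne_zero hε.ne').mem_of_tendsto
      (tendsto_const_nhds.sub hx) ?_⟩
    filter_upwards [eventually_ge_atTop N] with m hm
    exact hgauge (hspan (hu n) (hu m)) (hN n hn m hm)
  refine ⟨x, ?_, fun ε hε => ?_⟩
  · obtain ⟨N, hN⟩ := hlim 1 one_pos
    have h := hspan (hu N) ((mem_iff _).2 ⟨1, by simpa using hN N le_rfl⟩)
    simpa using h
  · obtain ⟨N, hN⟩ := hlim (ε / 2) (by positivity)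
    exact ⟨N, fun n hn => (gauge_le_of_mem (by positivity) (hN n hn)).trans_lt (by linarith)⟩

/-! ### Hermite functions on the line -/

section HermiteLine

/-- Differentiating the recursion closes the induction. This is what makes `d/dt` lower the degree,
so that the recursion becomes a pair of ladder relations. -/
theorem derivative_hermitePoly_succ (n : ℕ) :
    derivative (hermitePoly (n + 1)) = C (2 * ((n : ℝ) + 1)) * hermitePoly n := by
  induction n with
  | zero => simp [hermitePoly]; rfl
  | succ n ih =>
    have h : hermitePoly (n + 1 + 1)
        = 2 * X * hermitePoly (n + 1) - derivative (hermitePoly (n + 1)) := rfl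
    have h' : hermitePoly (n + 1) = 2 * X * hermitePoly n - derivative (hermitePoly n) := rfl
    rw [h, derivative_sub, derivative_mul, ih]
    simp only [derivative_mul, derivative_C, derivative_X, derivative_ofNat]
    have h2 : C (2 * (((n + 1 : ℕ) : ℝ) + 1)) = C (2 * ((n : ℝ) + 1)) + 2 := by
      rw [show (2 : ℝ[X]) = C 2 from rfl, ← C_add]; push_cast; ring_nf
    rw [h2]
    linear_combination (-C (2 * ((n : ℝ) + 1))) * h'

/-- The coefficient `√(n/2)` in the ladder relations between Hermite functions. -/
noncomputable def ladderCoeff (n : ℕ) : ℝ := √(n / 2)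

@[simp]
theorem ladderCoeff_zero : ladderCoeff 0 = 0 := by simp [ladderCoeff]

theorem ladderCoeff_nonneg (n : ℕ) : 0 ≤ ladderCoeff n := Real.sqrt_nonneg _

theorem ladderCoeff_sq (n : ℕ) : ladderCoeff n ^ 2 = n / 2 := Real.sq_sqrt (by positivity)

theorem ladderCoeff_succ_pos (n : ℕ) : 0 < ladderCoeff (n + 1) :=
  Real.sqrt_pos.2 (by positivity)

/-- From `n` to `n + 1` the number under the root is multiplied by `2(n + 1)`, which is the square
of `2 * ladderCoeff (n + 1)`. -/
theorem hermiteFun₁_const_succ (n : ℕ) :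
    2 * ladderCoeff (n + 1) * (2 ^ (n + 1) * (n + 1)! * √Real.pi) ^ (-(1 / 2) : ℝ) =
      (2 ^ n * n ! * √Real.pi) ^ (-(1 / 2) : ℝ) := by
  have h : (2 ^ (n + 1) * (n + 1)! * √Real.pi : ℝ)
      = (2 * ladderCoeff (n + 1)) ^ (2 : ℝ) * (2 ^ n * n ! * √Real.pi) := by
    rw [Real.rpow_two, mul_pow, ladderCoeff_sq, Nat.factorial_succ]
    push_cast
    ring
  have hp : 0 < 2 * ladderCoeff (n + 1) := mul_pos two_pos (ladderCoeff_succ_pos n)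
  rw [h, Real.mul_rpow (by positivity) (by positivity), ← Real.rpow_mul hp.le, ← mul_assoc]
  norm_num
  rw [Real.rpow_neg_one, mul_inv_cancel₀ hp.ne', one_mul]

theorem hasDerivAt_gaussian (t : ℝ) :
    HasDerivAt (fun t : ℝ => Real.exp (-t ^ 2 / 2)) (-t * Real.exp (-t ^ 2 / 2)) t := by
  have h : HasDerivAt (fun t : ℝ => -t ^ 2 / 2) (-t) t :=
    (((hasDerivAt_pow 2 t).neg).div_const 2).congr_deriv (by simp; ring)
  exact h.exp.congr_deriv (by ring)

theorem hasDerivAt_hermiteFun₁_aux (n : ℕ) (t : ℝ) :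
    HasDerivAt (hermiteFun₁ n) ((2 ^ n * n ! * √Real.pi) ^ (-(1 / 2) : ℝ) *
      ((derivative (hermitePoly n)).eval t - t * (hermitePoly n).eval t) *
        Real.exp (-t ^ 2 / 2)) t := by
  have h := (((hermitePoly n).hasDerivAt t).const_mul
    ((2 ^ n * n ! * √Real.pi) ^ (-(1 / 2) : ℝ))).mul (hasDerivAt_gaussian t)
  exact h.congr_deriv (by ring)

/-- The truncated `n - 1` is harmless at `n = 0` because `ladderCoeff 0 = 0`; the same convention is
used in all later lowering formulas. -/
theorem hermiteFun₁_lower (n : ℕ) (t : ℝ) :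
    (2 ^ n * n ! * √Real.pi) ^ (-(1 / 2) : ℝ) * (derivative (hermitePoly n)).eval t *
      Real.exp (-t ^ 2 / 2) = 2 * ladderCoeff n * hermiteFun₁ (n - 1) t := by
  cases n with
  | zero => simp [hermitePoly]
  | succ n =>
    rw [derivative_hermitePoly_succ, Nat.add_sub_cancel, hermiteFun₁, ← hermiteFun₁_const_succ n,
      eval_mul, eval_C]
    have := ladderCoeff_sq (n + 1)
    push_cast at this
    linear_combination (-4 * (2 ^ (n + 1) * (n + 1)! * √Real.pi) ^ (-(1 / 2) : ℝ) *
      eval t (hermitePoly n) * Real.exp (-t ^ 2 / 2)) * this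

theorem hermiteFun₁_raise (n : ℕ) (t : ℝ) :
    (2 ^ n * n ! * √Real.pi) ^ (-(1 / 2) : ℝ) *
      (2 * t * (hermitePoly n).eval t - (derivative (hermitePoly n)).eval t) *
      Real.exp (-t ^ 2 / 2) = 2 * ladderCoeff (n + 1) * hermiteFun₁ (n + 1) t := by
  rw [hermiteFun₁, ← hermiteFun₁_const_succ, hermitePoly]
  simp only [eval_sub, eval_mul, eval_X, eval_ofNat]
  ring

/-- Half the sum of the lowering relation for `t + d/dt` and the raising relation for `t - d/dt`;
half their difference gives the derivative. -/
theorem mul_hermiteFun₁ (n : ℕ) (t : ℝ) :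
    t * hermiteFun₁ n t =
      ladderCoeff n * hermiteFun₁ (n - 1) t + ladderCoeff (n + 1) * hermiteFun₁ (n + 1) t := by
  have h₁ := hermiteFun₁_lower n t
  have h₂ := hermiteFun₁_raise n t
  simp only [hermiteFun₁] at *
  linear_combination (h₁ + h₂) / 2

theorem hasDerivAt_hermiteFun₁ (n : ℕ) (t : ℝ) :
    HasDerivAt (hermiteFun₁ n)
      (ladderCoeff n * hermiteFun₁ (n - 1) t - ladderCoeff (n + 1) * hermiteFun₁ (n + 1) t) t := by
  refine (hasDerivAt_hermiteFun₁_aux n t).congr_deriv ?_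
  linear_combination (hermiteFun₁_lower n t - hermiteFun₁_raise n t) / 2

theorem continuous_hermiteFun₁ (n : ℕ) : Continuous (hermiteFun₁ n) :=
  continuous_iff_continuousAt.2 fun t => (hasDerivAt_hermiteFun₁ n t).continuousAt

theorem integrable_polynomial_mul_gaussian (p : ℝ[X]) :
    Integrable fun t : ℝ => p.eval t * Real.exp (-t ^ 2) := by
  induction p using Polynomial.induction_on' with
  | add p q hp hq => exact (hp.add hq).congr (Eventually.of_forall fun t => by simp [add_mul])
  | monomial n a =>
    have h := (integrable_rpow_mul_exp_neg_mul_sq one_pos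
      (show (-1 : ℝ) < n by linarith [Nat.cast_nonneg (α := ℝ) n])).const_mul a
    simpa [mul_assoc] using h

theorem integrable_hermiteFun₁_mul (n m : ℕ) :
    Integrable fun t => hermiteFun₁ n t * hermiteFun₁ m t := by
  have h := (integrable_polynomial_mul_gaussian (hermitePoly n * hermitePoly m)).const_mul
    ((2 ^ n * n ! * √Real.pi) ^ (-(1 / 2) : ℝ) * (2 ^ m * m ! * √Real.pi) ^ (-(1 / 2) : ℝ))
  refine h.congr (Eventually.of_forall fun t => ?_)
  have : Real.exp (-t ^ 2) = Real.exp (-t ^ 2 / 2) * Real.exp (-t ^ 2 / 2) := by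
    rw [← Real.exp_add]; ring_nf
  simp only [hermiteFun₁, this, eval_mul]
  ring

theorem integral_hermiteFun₁_zero_sq : ∫ t, hermiteFun₁ 0 t * hermiteFun₁ 0 t = 1 := by
  have h : ∀ t, hermiteFun₁ 0 t * hermiteFun₁ 0 t = (√Real.pi)⁻¹ * Real.exp (-1 * t ^ 2) := by
    intro t
    have : Real.exp (-1 * t ^ 2) = Real.exp (-t ^ 2 / 2) * Real.exp (-t ^ 2 / 2) := by
      rw [← Real.exp_add]; ring_nf
    have hpi : 0 < √Real.pi := Real.sqrt_pos.2 Real.pi_pos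
    have h2 : (√Real.pi) ^ (-(1 / 2) : ℝ) * (√Real.pi) ^ (-(1 / 2) : ℝ) = (√Real.pi)⁻¹ := by
      rw [← Real.rpow_add hpi, ← Real.rpow_neg_one]; norm_num
    simp only [hermiteFun₁, this, hermitePoly, eval_one, pow_zero, Nat.factorial_zero, Nat.cast_one,
      one_mul, mul_one]
    rw [← h2]
    ring
  simp_rw [h]
  rw [integral_const_mul, integral_gaussian, div_one, inv_mul_cancel₀]
  exact (Real.sqrt_pos.2 Real.pi_pos).ne'

/-- Raising and lowering are adjoint: integration by parts flips the sign of `d/dt`, while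
multiplication by `t` is symmetric. Both indices drop by one, which drives the induction for
orthonormality. -/
theorem integral_hermiteFun₁_succ_mul (n m : ℕ) :
    ladderCoeff (n + 1) * ∫ t, hermiteFun₁ (n + 1) t * hermiteFun₁ m t =
      ladderCoeff m * ∫ t, hermiteFun₁ n t * hermiteFun₁ (m - 1) t := by
  have I := integrable_hermiteFun₁_mul
  have h := integral_mul_deriv_eq_deriv_mul_of_integrable
    (fun t _ => hasDerivAt_hermiteFun₁ n t) (fun t _ => hasDerivAt_hermiteFun₁ m t)
    ((((I n (m - 1)).const_mul (ladderCoeff m)).sub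
      ((I n (m + 1)).const_mul (ladderCoeff (m + 1)))).congr
        (Eventually.of_forall fun t => by simp only [Pi.sub_apply, Pi.mul_apply]; ring))
    ((((I (n - 1) m).const_mul (ladderCoeff n)).sub
      ((I (n + 1) m).const_mul (ladderCoeff (n + 1)))).congr
        (Eventually.of_forall fun t => by simp only [Pi.sub_apply, Pi.mul_apply]; ring))
    (I n m)
  have h₁ : ∫ t, hermiteFun₁ n t * (t * hermiteFun₁ m t) =
      ∫ t, (t * hermiteFun₁ n t) * hermiteFun₁ m t := by
    congr 1; ext t; ring
  simp only [mul_hermiteFun₁] at h₁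
  -- `ε = 1` expands the integrals with `t h`, `ε = -1` those with `h'`.
  have s₁ : ∀ ε : ℝ, ∫ t, hermiteFun₁ n t * (ladderCoeff m * hermiteFun₁ (m - 1) t
      + ε * (ladderCoeff (m + 1) * hermiteFun₁ (m + 1) t)) =
      ladderCoeff m * (∫ t, hermiteFun₁ n t * hermiteFun₁ (m - 1) t) +
        ε * (ladderCoeff (m + 1) * ∫ t, hermiteFun₁ n t * hermiteFun₁ (m + 1) t) := by
    intro ε
    rw [← integral_const_mul, ← integral_const_mul, ← integral_const_mul, ← integral_add
      ((I _ _).const_mul _) (((I _ _).const_mul _).const_mul _)]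
    congr 1; ext t; ring
  have s₂ : ∀ ε : ℝ, ∫ t, (ladderCoeff n * hermiteFun₁ (n - 1) t
      + ε * (ladderCoeff (n + 1) * hermiteFun₁ (n + 1) t)) * hermiteFun₁ m t =
      ladderCoeff n * (∫ t, hermiteFun₁ (n - 1) t * hermiteFun₁ m t) +
        ε * (ladderCoeff (n + 1) * ∫ t, hermiteFun₁ (n + 1) t * hermiteFun₁ m t) := by
    intro ε
    rw [← integral_const_mul, ← integral_const_mul, ← integral_const_mul, ← integral_add
      ((I _ _).const_mul _) (((I _ _).const_mul _).const_mul _)]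
    congr 1; ext t; ring
  have a₁ := s₁ 1
  have a₂ := s₁ (-1)
  have b₁ := s₂ 1
  have b₂ := s₂ (-1)
  simp only [one_mul, neg_mul, ← sub_eq_add_neg] at a₁ a₂ b₁ b₂
  rw [a₂, b₂] at h
  rw [a₁, b₁] at h₁
  linear_combination (-h - h₁) / 2

/-- Lower both indices until one is zero. If only one of them has reached zero, a further step with
the roles exchanged has right-hand factor `ladderCoeff 0 = 0`. -/
theorem integral_hermiteFun₁_mul (n m : ℕ) :
    ∫ t, hermiteFun₁ n t * hermiteFun₁ m t = if n = m then 1 else 0 := by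
  induction n generalizing m with
  | zero =>
    cases m with
    | zero => simpa using integral_hermiteFun₁_zero_sq
    | succ m =>
      have h := integral_hermiteFun₁_succ_mul m 0
      rw [ladderCoeff_zero, zero_mul] at h
      rw [if_neg (Nat.succ_ne_zero m).symm]
      simp_rw [mul_comm (hermiteFun₁ 0 _)]
      exact (mul_eq_zero.1 h).resolve_left (ladderCoeff_succ_pos m).ne'
  | succ n ih =>
    have h := integral_hermiteFun₁_succ_mul n m
    refine mul_left_cancel₀ (ladderCoeff_succ_pos n).ne' (h.trans ?_)
    cases m with
    | zero => simp
    | succ m =>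
      rw [Nat.add_sub_cancel, ih]
      by_cases hnm : n = m
      · simp [hnm]
      · simp [hnm]

/-- `h_n(t)²` is the integral of `2 h_n h_n'` over `(-∞, t]`. The ladder formula bounds the
integrand by `h_n² + n h_{n-1}² + (n+1) h_{n+1}²`, whose integral over the line is `1 + n + (n + 1)`
by orthonormality. -/
theorem hermiteFun₁_sq_le (n : ℕ) (t : ℝ) : hermiteFun₁ n t ^ 2 ≤ 2 * n + 2 := by
  have I := integrable_hermiteFun₁_mul
  set a := ladderCoeff n
  set b := ladderCoeff (n + 1)
  have hder : ∀ t, HasDerivAt (fun t => hermiteFun₁ n t * hermiteFun₁ n t)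
      (2 * (a * (hermiteFun₁ n t * hermiteFun₁ (n - 1) t)
        - b * (hermiteFun₁ n t * hermiteFun₁ (n + 1) t))) t := fun t =>
    ((hasDerivAt_hermiteFun₁ n t).mul (hasDerivAt_hermiteFun₁ n t)).congr_deriv (by
      simp only [a, b]; ring)
  have hint : Integrable fun t => 2 * (a * (hermiteFun₁ n t * hermiteFun₁ (n - 1) t)
        - b * (hermiteFun₁ n t * hermiteFun₁ (n + 1) t)) :=
    (((I _ _).const_mul _).sub ((I _ _).const_mul _)).const_mul _
  have hlim := tendsto_zero_of_hasDerivAt_of_integrableOn_Iic (a := t) (fun x _ => hder x)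
    hint.integrableOn (I n n).integrableOn
  have h := integral_Iic_of_hasDerivAt_of_tendsto' (a := t) (fun x _ => hder x)
    hint.integrableOn hlim
  set g : ℝ → ℝ := fun t => hermiteFun₁ n t * hermiteFun₁ n t
    + (n * (hermiteFun₁ (n - 1) t * hermiteFun₁ (n - 1) t)
      + (n + 1) * (hermiteFun₁ (n + 1) t * hermiteFun₁ (n + 1) t)) with hg
  have hgi₂ : Integrable fun t => n * (hermiteFun₁ (n - 1) t * hermiteFun₁ (n - 1) t)
      + (n + 1) * (hermiteFun₁ (n + 1) t * hermiteFun₁ (n + 1) t) :=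
    ((I _ _).const_mul _).add ((I _ _).const_mul _)
  have hgi : Integrable g := (I n n).add hgi₂
  have hg0 : ∀ t, 0 ≤ g t := fun t =>
    add_nonneg (mul_self_nonneg _) (add_nonneg (mul_nonneg (by positivity) (mul_self_nonneg _))
      (mul_nonneg (by positivity) (mul_self_nonneg _)))
  have ha : a ^ 2 = n / 2 := ladderCoeff_sq n
  have hb : b ^ 2 = (n + 1) / 2 := by simpa using ladderCoeff_sq (n + 1)
  calc hermiteFun₁ n t ^ 2 = ∫ t in Set.Iic t, 2 * (a * (hermiteFun₁ n t * hermiteFun₁ (n - 1) t)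
        - b * (hermiteFun₁ n t * hermiteFun₁ (n + 1) t)) := by rw [h]; ring
    _ ≤ ∫ t in Set.Iic t, g t := by
        refine integral_mono hint.integrableOn hgi.integrableOn fun x => ?_
        simp only [hg]
        have e₁ : (n : ℝ) = 2 * a ^ 2 := by rw [ha]; ring
        have e₂ : (n : ℝ) + 1 = 2 * b ^ 2 := by rw [hb]; ring
        rw [e₂]
        conv_rhs => rw [e₁]
        -- The difference of the two sides is exactly the sum of these two squares.
        nlinarith [sq_nonneg (hermiteFun₁ n x - a * hermiteFun₁ (n - 1) x
          + b * hermiteFun₁ (n + 1) x), sq_nonneg (a * hermiteFun₁ (n - 1) x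
          + b * hermiteFun₁ (n + 1) x)]
    _ ≤ ∫ t, g t := setIntegral_le_integral hgi (Eventually.of_forall hg0)
    _ ≤ 2 * n + 2 := by
        simp only [hg]
        rw [integral_add (I _ _) hgi₂,
          integral_add ((I _ _).const_mul _) ((I _ _).const_mul _), integral_const_mul,
          integral_const_mul]
        simp only [integral_hermiteFun₁_mul, if_true]
        linarith

end HermiteLine

/-! ### Weights -/

section Weights

/-- The Japanese bracket `√(1 + r²)`. -/
noncomputable def bracket (r : ℝ) : ℝ := √(1 + r ^ 2)

theorem bracket_sq (r : ℝ) : bracket r ^ 2 = 1 + r ^ 2 := Real.sq_sqrt (by positivity)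

theorem one_le_bracket (r : ℝ) : 1 ≤ bracket r :=
  Real.one_le_sqrt.2 (by nlinarith [sq_nonneg r])

theorem bracket_pos (r : ℝ) : 0 < bracket r := one_pos.trans_le (one_le_bracket r)

theorem abs_le_bracket (r : ℝ) : |r| ≤ bracket r :=
  Real.abs_le_sqrt (by linarith)

theorem bracket_pow (r : ℝ) (j : ℕ) : (1 + r ^ 2) ^ ((j : ℝ) / 2) = bracket r ^ j := by
  rw [bracket, Real.sqrt_eq_rpow, ← Real.rpow_natCast _ j,
    ← Real.rpow_mul (by positivity)]
  ring_nf

theorem schwartzWeight_eq {d m : ℕ} (q : SchwartzIndex d m) :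
    schwartzWeight d m q = bracket ‖q.2‖ ^ m := bracket_pow _ _

variable {d : ℕ}

theorem rapidWeight_eq (j : ℕ) (n : Fin d → ℕ) : rapidWeight d j n = bracket (euclNorm n) ^ j :=
  bracket_pow _ _

theorem euclNorm_sq (n : Fin d → ℕ) : euclNorm n ^ 2 = ∑ i, (n i : ℝ) ^ 2 :=
  Real.sq_sqrt (Finset.sum_nonneg fun _ _ => sq_nonneg _)

theorem natCast_le_euclNorm (n : Fin d → ℕ) (i : Fin d) : (n i : ℝ) ≤ euclNorm n :=
  Real.le_sqrt_of_sq_le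
    (Finset.single_le_sum (f := fun j => (n j : ℝ) ^ 2) (fun _ _ => sq_nonneg _)
      (Finset.mem_univ i))

theorem natCast_add_one_le_bracket (n : Fin d → ℕ) (i : Fin d) :
    (n i : ℝ) + 1 ≤ 2 * bracket (euclNorm n) := by
  have h₁ := (natCast_le_euclNorm n i).trans ((le_abs_self _).trans (abs_le_bracket _))
  linarith [one_le_bracket (euclNorm n)]

theorem rapidWeight_pos (j : ℕ) (n : Fin d → ℕ) : 0 < rapidWeight d j n := by
  rw [rapidWeight_eq]; exact pow_pos (bracket_pos _) _

theorem one_le_rapidWeight (j : ℕ) (n : Fin d → ℕ) : 1 ≤ rapidWeight d j n := by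
  rw [rapidWeight_eq]; exact one_le_pow₀ (one_le_bracket _)

theorem rapidWeight_add (j k : ℕ) (n : Fin d → ℕ) :
    rapidWeight d (j + k) n = rapidWeight d j n * rapidWeight d k n := by
  simp_rw [rapidWeight_eq, pow_add]

theorem rapidWeight_mono {j k : ℕ} (h : j ≤ k) (n : Fin d → ℕ) :
    rapidWeight d j n ≤ rapidWeight d k n := by
  simp_rw [rapidWeight_eq]
  exact pow_le_pow_right₀ (one_le_bracket _) h

/-- The multi-index `n + e_i`. -/
def raiseIndex (i : Fin d) (n : Fin d → ℕ) : Fin d → ℕ := Function.update n i (n i + 1)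

/-- The multi-index `n - e_i` (or `n`, if the `i`-th entry of `n` is zero). -/
def lowerIndex (i : Fin d) (n : Fin d → ℕ) : Fin d → ℕ := Function.update n i (n i - 1)

@[simp] theorem raiseIndex_apply_self (i : Fin d) (n : Fin d → ℕ) : raiseIndex i n i = n i + 1 := by
  simp [raiseIndex]

@[simp] theorem lower_raise (i : Fin d) (n : Fin d → ℕ) : lowerIndex i (raiseIndex i n) = n := by
  simp [raiseIndex, lowerIndex]

theorem raise_lower {i : Fin d} {n : Fin d → ℕ} (h : n i ≠ 0) : raiseIndex i (lowerIndex i n) = n := by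
  simp [raiseIndex, lowerIndex, Nat.sub_add_cancel (Nat.one_le_iff_ne_zero.2 h)]

theorem raiseIndex_injective (i : Fin d) : Function.Injective (raiseIndex (d := d) i) :=
  Function.LeftInverse.injective (lower_raise i)

theorem euclNorm_raise_sq (i : Fin d) (n : Fin d → ℕ) :
    euclNorm (raiseIndex i n) ^ 2 = euclNorm n ^ 2 + 2 * n i + 1 := by
  rw [euclNorm_sq, euclNorm_sq, ← Finset.add_sum_erase _ _ (Finset.mem_univ i),
    ← Finset.add_sum_erase (a := i) _ (fun j => (n j : ℝ) ^ 2) (Finset.mem_univ i)]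
  have : ∑ x ∈ Finset.univ.erase i, (raiseIndex i n x : ℝ) ^ 2
      = ∑ x ∈ Finset.univ.erase i, (n x : ℝ) ^ 2 :=
    Finset.sum_congr rfl fun j hj => by
      rw [raiseIndex, Function.update_of_ne (Finset.ne_of_mem_erase hj)]
  rw [this, raiseIndex_apply_self]
  push_cast
  ring

theorem bracket_le_raise (i : Fin d) (n : Fin d → ℕ) :
    bracket (euclNorm n) ≤ bracket (euclNorm (raiseIndex i n)) := by
  refine Real.sqrt_le_sqrt ?_
  rw [euclNorm_raise_sq]
  linarith [Nat.cast_nonneg (α := ℝ) (n i)]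

theorem bracket_raise_le (i : Fin d) (n : Fin d → ℕ) :
    bracket (euclNorm (raiseIndex i n)) ≤ 2 * bracket (euclNorm n) := by
  refine abs_le_of_sq_le_sq' ?_ (by linarith [bracket_pos (euclNorm n)]) |>.2
  rw [mul_pow, bracket_sq, bracket_sq, euclNorm_raise_sq]
  have h := natCast_le_euclNorm n i
  nlinarith [sq_nonneg (euclNorm n - 1), Nat.cast_nonneg (α := ℝ) (n i)]

theorem rapidWeight_le_raise (j : ℕ) (i : Fin d) (n : Fin d → ℕ) :
    rapidWeight d j n ≤ rapidWeight d j (raiseIndex i n) := by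
  simp_rw [rapidWeight_eq]
  exact pow_le_pow_left₀ (bracket_pos _).le (bracket_le_raise i n) j

theorem rapidWeight_raise_le (j : ℕ) (i : Fin d) (n : Fin d → ℕ) :
    rapidWeight d j (raiseIndex i n) ≤ 2 ^ j * rapidWeight d j n := by
  simp_rw [rapidWeight_eq, ← mul_pow]
  exact pow_le_pow_left₀ (bracket_pos _).le (bracket_raise_le i n) j

/-- Hence each ladder operation costs a single order of the weight. -/
theorem ladderCoeff_le_rapidWeight (i : Fin d) (n : Fin d → ℕ) :
    ladderCoeff (n i + 1) ≤ rapidWeight d 1 n := by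
  rw [rapidWeight_eq, pow_one]
  refine abs_le_of_sq_le_sq' ?_ (bracket_pos _).le |>.2
  rw [ladderCoeff_sq]
  have h₁ := natCast_add_one_le_bracket n i
  have h₂ := one_le_bracket (euclNorm n)
  push_cast
  nlinarith

/-- `(1 + |n|²)^d` dominates `∏ (1 + n_i²)`, so the reciprocals are bounded by a product of
convergent one-dimensional series. Passing from sup bounds to sums therefore costs `2 * d` orders,
the shift seen in later estimates. -/
theorem summable_inv_rapidWeight : Summable fun n : Fin d → ℕ => (rapidWeight d (2 * d) n)⁻¹ := by
  have hs : Summable fun k : ℕ => (1 + (k : ℝ) ^ 2)⁻¹ := by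
    refine Summable.of_nonneg_of_le (fun k => by positivity) (fun k => ?_)
      ((summable_nat_add_iff 1).2 (Real.summable_nat_pow_inv.2 one_lt_two)|>.mul_left 2)
    rw [← inv_inv (2 : ℝ), ← mul_inv]
    refine inv_anti₀ (by positivity) ?_
    push_cast
    nlinarith [sq_nonneg ((k : ℝ) - 1)]
  have hle : ∀ n : Fin d → ℕ, (rapidWeight d (2 * d) n)⁻¹ ≤ ∏ i, (1 + (n i : ℝ) ^ 2)⁻¹ := by
    intro n
    rw [Finset.prod_inv_distrib, rapidWeight_eq, pow_mul, bracket_sq, euclNorm_sq]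
    refine inv_anti₀ (Finset.prod_pos fun i _ => by positivity) ?_
    calc ∏ i, (1 + (n i : ℝ) ^ 2) ≤ ∏ _i : Fin d, (1 + ∑ j, (n j : ℝ) ^ 2) := by
          refine Finset.prod_le_prod (fun i _ => by positivity) fun i _ => ?_
          have := Finset.single_le_sum (f := fun j => (n j : ℝ) ^ 2) (fun _ _ => sq_nonneg _)
            (Finset.mem_univ i)
          linarith
      _ = _ := by simp
  refine summable_of_sum_le (c := (∑' k : ℕ, (1 + (k : ℝ) ^ 2)⁻¹) ^ d)
    (fun n => (inv_pos.2 (rapidWeight_pos _ n)).le) fun F => ?_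
  -- Over a cube the sum of products factors into a power of a one-dimensional sum.
  obtain ⟨N, hN⟩ : ∃ N, F ⊆ Fintype.piFinset fun _ : Fin d => Finset.range N := by
    refine ⟨F.sup (fun n => Finset.univ.sup n) + 1, fun n hn => ?_⟩
    rw [Fintype.mem_piFinset]
    exact fun i => Finset.mem_range.2 (Nat.lt_succ_of_le
      ((Finset.le_sup (f := n) (Finset.mem_univ i)).trans
        (Finset.le_sup (f := fun n : Fin d → ℕ => Finset.univ.sup n) hn)))
  calc ∑ n ∈ F, (rapidWeight d (2 * d) n)⁻¹ ≤ ∑ n ∈ F, ∏ i, (1 + (n i : ℝ) ^ 2)⁻¹ :=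
        Finset.sum_le_sum fun n _ => hle n
    _ ≤ ∑ n ∈ Fintype.piFinset fun _ : Fin d => Finset.range N, ∏ i, (1 + (n i : ℝ) ^ 2)⁻¹ :=
        Finset.sum_le_sum_of_subset_of_nonneg hN fun n _ _ =>
          Finset.prod_nonneg fun i _ => by positivity
    _ = ∏ _i : Fin d, ∑ k ∈ Finset.range N, (1 + (k : ℝ) ^ 2)⁻¹ := (Finset.prod_univ_sum
        (fun _ => Finset.range N) fun _ k => (1 + (k : ℝ) ^ 2)⁻¹).symm
    _ = (∑ k ∈ Finset.range N, (1 + (k : ℝ) ^ 2)⁻¹) ^ d := by simp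
    _ ≤ _ := pow_le_pow_left₀ (Finset.sum_nonneg fun _ _ => by positivity)
        (hs.sum_le_tsum _ fun _ _ => by positivity) d

end Weights

/-! ### Hermite functions on `ℝ^d` -/

section HermiteSpace

variable {d : ℕ}

theorem hermiteFun_update (n : Fin d → ℕ) (i : Fin d) (k : ℕ) (x : EuclideanSpace ℝ (Fin d)) :
    hermiteFun (Function.update n i k) x =
      hermiteFun₁ k (x i) * ∏ j ∈ Finset.univ.erase i, hermiteFun₁ (n j) (x j) := by
  rw [hermiteFun, ← Finset.mul_prod_erase _ _ (Finset.mem_univ i), Function.update_self]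
  congr 1
  exact Finset.prod_congr rfl fun j hj => by
    rw [Function.update_of_ne (Finset.ne_of_mem_erase hj)]

theorem hermiteFun_eq_mul_erase (n : Fin d → ℕ) (i : Fin d) (x : EuclideanSpace ℝ (Fin d)) :
    hermiteFun n x =
      hermiteFun₁ (n i) (x i) * ∏ j ∈ Finset.univ.erase i, hermiteFun₁ (n j) (x j) := by
  rw [← hermiteFun_update, Function.update_eq_self]

theorem coord_mul_hermiteFun (i : Fin d) (n : Fin d → ℕ) (x : EuclideanSpace ℝ (Fin d)) :
    x i * hermiteFun n x = ladderCoeff (n i) * hermiteFun (lowerIndex i n) x +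
      ladderCoeff (n i + 1) * hermiteFun (raiseIndex i n) x := by
  rw [lowerIndex, raiseIndex, hermiteFun_update, hermiteFun_update, hermiteFun_eq_mul_erase n i, ← mul_assoc,
    mul_hermiteFun₁]
  ring

/-- The `i`-th partial derivative of the Hermite function with index `n`. -/
noncomputable def hermiteDeriv (i : Fin d) (n : Fin d → ℕ) (x : EuclideanSpace ℝ (Fin d)) : ℝ :=
  ladderCoeff (n i) * hermiteFun (lowerIndex i n) x - ladderCoeff (n i + 1) * hermiteFun (raiseIndex i n) x

theorem hasLineDerivAt_hermiteFun (i : Fin d) (n : Fin d → ℕ) (x : EuclideanSpace ℝ (Fin d)) :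
    HasLineDerivAt ℝ (hermiteFun n) (hermiteDeriv i n x) x (EuclideanSpace.single i 1) := by
  have h₁ : HasDerivAt (fun t : ℝ => x i + t) 1 0 := (hasDerivAt_id 0).const_add _
  have h₂ : HasDerivAt (hermiteFun₁ (n i))
      (ladderCoeff (n i) * hermiteFun₁ (n i - 1) (x i)
        - ladderCoeff (n i + 1) * hermiteFun₁ (n i + 1) (x i)) (x i + 0) := by
    rw [add_zero]; exact hasDerivAt_hermiteFun₁ (n i) (x i)
  have h := (h₂.comp 0 h₁).mul_const (∏ j ∈ Finset.univ.erase i, hermiteFun₁ (n j) (x j))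
  have e : (fun t : ℝ => hermiteFun n (x + t • EuclideanSpace.single i 1)) = fun t =>
      (hermiteFun₁ (n i) ∘ fun t => x i + t) t *
        ∏ j ∈ Finset.univ.erase i, hermiteFun₁ (n j) (x j) := by
    funext t
    rw [hermiteFun_eq_mul_erase n i]
    congr 1
    · simp
    · refine Finset.prod_congr rfl fun j hj => ?_
      simp [Finset.ne_of_mem_erase hj]
  rw [HasLineDerivAt, e]
  refine h.congr_deriv ?_
  rw [hermiteDeriv, lowerIndex, raiseIndex, hermiteFun_update, hermiteFun_update]
  ring

theorem continuous_hermiteFun (n : Fin d → ℕ) : Continuous (hermiteFun n) := by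
  unfold hermiteFun
  exact continuous_finsetProd _ fun k _ => (continuous_hermiteFun₁ _).comp (by fun_prop)

/-- Each factor satisfies `h² ≤ 2 n_k + 2 ≤ (2 ⟨n⟩)²` with `⟨n⟩ = √(1 + |n|²)`, so a rapidly
decreasing sequence compensates the growth of the sup norms in `n`. -/
theorem abs_hermiteFun_le (n : Fin d → ℕ) (x : EuclideanSpace ℝ (Fin d)) :
    |hermiteFun n x| ≤ 2 ^ d * rapidWeight d d n := by
  rw [hermiteFun, Finset.abs_prod, rapidWeight_eq, ← mul_pow]
  calc ∏ k, |hermiteFun₁ (n k) (x k)| ≤ ∏ _k : Fin d, 2 * bracket (euclNorm n) := by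
        refine Finset.prod_le_prod (fun _ _ => abs_nonneg _) fun k _ => ?_
        refine abs_le_of_sq_le_sq ((hermiteFun₁_sq_le _ _).trans ?_)
          (by linarith [bracket_pos (euclNorm n)])
        have h₁ := natCast_add_one_le_bracket n k
        have h₂ := one_le_bracket (euclNorm n)
        nlinarith
    _ = _ := by simp

theorem integrable_hermiteFun_mul (n m : Fin d → ℕ) :
    Integrable fun x : EuclideanSpace ℝ (Fin d) => hermiteFun n x * hermiteFun m x := by
  have h : Integrable fun x : Fin d → ℝ =>
      ∏ k, hermiteFun₁ (n k) (x k) * hermiteFun₁ (m k) (x k) :=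
    Integrable.fintype_prod (f := fun k t => hermiteFun₁ (n k) t * hermiteFun₁ (m k) t)
      fun k => integrable_hermiteFun₁_mul _ _
  have h' := (PiLp.volume_preserving_ofLp (Fin d)).integrable_comp_of_integrable h
  refine h'.congr (Eventually.of_forall fun x => ?_)
  simp only [Function.comp_apply, hermiteFun, ← Finset.prod_mul_distrib]

theorem integral_hermiteFun_mul (n m : Fin d → ℕ) :
    ∫ x : EuclideanSpace ℝ (Fin d), hermiteFun n x * hermiteFun m x = if n = m then 1 else 0 := by
  have h := (PiLp.volume_preserving_ofLp (Fin d)).integral_comp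
    (MeasurableEquiv.toLp 2 (Fin d → ℝ)).symm.measurableEmbedding
    (fun x : Fin d → ℝ => ∏ k, hermiteFun₁ (n k) (x k) * hermiteFun₁ (m k) (x k))
  rw [integral_fintype_prod_volume_eq_prod
    (fun k t => hermiteFun₁ (n k) t * hermiteFun₁ (m k) t)] at h
  simp only [integral_hermiteFun₁_mul] at h
  simp only [hermiteFun, ← Finset.prod_mul_distrib]
  rw [h]
  split_ifs with hnm
  · simp [hnm]
  · obtain ⟨k, hk⟩ := Function.ne_iff.1 hnm
    exact Finset.prod_eq_zero (Finset.mem_univ k) (if_neg hk)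

end HermiteSpace

/-! ### Estimates in the space of rapidly decreasing sequences -/

section Rapid

theorem continuous_of_seminorm_bound {𝕂 : Type*} [RCLike 𝕂] {V W ι κ : Type*} [AddCommGroup V]
    [Module 𝕂 V] [TopologicalSpace V] [AddCommGroup W] [Module 𝕂 W] [TopologicalSpace W]
    {p : SeminormFamily 𝕂 V ι} {q : SeminormFamily 𝕂 W κ} (hp : WithSeminorms p)
    (hq : WithSeminorms q) (f : V →ₗ[𝕂] W)
    (h : ∀ k, ∃ (i : ι) (C : ℝ), ∀ v, q k (f v) ≤ C * p i v) : Continuous f := by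
  refine WithSeminorms.continuous_of_isBounded hp hq f fun k => ?_
  obtain ⟨i, C, hC⟩ := h k
  refine ⟨{i}, C.toNNReal, fun v => ?_⟩
  rw [Finset.sup_singleton]
  exact (hC v).trans (mul_le_mul_of_nonneg_right (Real.le_coe_toNNReal C) (apply_nonneg _ _))

variable {𝕂 : Type*} [RCLike 𝕂] {d : ℕ} {E : Type*} [AddCommGroup E] [Module 𝕂 E]
  [TopologicalSpace E]

namespace RapidSp

@[simp] theorem add_apply (x y : RapidSp 𝕂 d E) (n : Fin d → ℕ) : (x + y) n = x n + y n := rfl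

@[simp] theorem zero_apply (n : Fin d → ℕ) : (0 : RapidSp 𝕂 d E) n = 0 := rfl

@[simp] theorem sub_apply (x y : RapidSp 𝕂 d E) (n : Fin d → ℕ) : (x - y) n = x n - y n := rfl

@[simp] theorem smul_apply (c : 𝕂) (x : RapidSp 𝕂 d E) (n : Fin d → ℕ) : (c • x) n = c • x n := rfl

theorem weight_mul_le (x : RapidSp 𝕂 d E) (j : ℕ) (p : ContSeminorm 𝕂 E) (n : Fin d → ℕ) :
    p.1 (x n) * rapidWeight d j n ≤ seminorms 𝕂 d E (j, p) x :=
  le_ciSup (x.2 j p) n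

theorem seminorms_le {x : RapidSp 𝕂 d E} {j : ℕ} {p : ContSeminorm 𝕂 E} {B : ℝ}
    (h : ∀ n, p.1 (x n) * rapidWeight d j n ≤ B) : seminorms 𝕂 d E (j, p) x ≤ B :=
  ciSup_le h

theorem seminorms_mono {j k : ℕ} (hjk : j ≤ k) (p : ContSeminorm 𝕂 E) (x : RapidSp 𝕂 d E) :
    seminorms 𝕂 d E (j, p) x ≤ seminorms 𝕂 d E (k, p) x :=
  seminorms_le fun n => (mul_le_mul_of_nonneg_left (rapidWeight_mono hjk n)
    (apply_nonneg _ _)).trans (x.weight_mul_le k p n)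

variable (𝕂 d E) in
/-- The operators on `s(ℕ₀^d, E)` all of whose estimates are uniform in the seminorms of `E`. -/
def tame : Subalgebra 𝕂 (Module.End 𝕂 (RapidSp 𝕂 d E)) where
  carrier := {T | ∀ j, ∃ C k, 0 ≤ C ∧ ∀ (p : ContSeminorm 𝕂 E) (x : RapidSp 𝕂 d E),
    seminorms 𝕂 d E (j, p) (T x) ≤ C * seminorms 𝕂 d E (k, p) x}
  mul_mem' := by
    intro S T hS hT j
    obtain ⟨C, k, hC, hk⟩ := hS j
    obtain ⟨D, l, hD, hl⟩ := hT k
    refine ⟨C * D, l, by positivity, fun p x => (hk p (T x)).trans ?_⟩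
    rw [mul_assoc]
    exact mul_le_mul_of_nonneg_left (hl p x) hC
  add_mem' := by
    intro S T hS hT j
    obtain ⟨C, k, hC, hk⟩ := hS j
    obtain ⟨D, l, hD, hl⟩ := hT j
    refine ⟨C + D, max k l, by positivity, fun p x => (map_add_le_add _ _ _).trans ?_⟩
    rw [add_mul]
    exact add_le_add
      ((hk p x).trans (mul_le_mul_of_nonneg_left (seminorms_mono (le_max_left _ _) p x) hC))
      ((hl p x).trans (mul_le_mul_of_nonneg_left (seminorms_mono (le_max_right _ _) p x) hD))
  algebraMap_mem' := fun c j => ⟨‖c‖, j, norm_nonneg c, fun p x =>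
    (map_smul_eq_mul (seminorms 𝕂 d E (j, p)) c x).le⟩

theorem exists_bound_of_mem_tame {T : Module.End 𝕂 (RapidSp 𝕂 d E)} (hT : T ∈ tame 𝕂 d E) (j : ℕ) :
    ∃ C k, 0 ≤ C ∧ ∀ (p : ContSeminorm 𝕂 E) (x : RapidSp 𝕂 d E),
      seminorms 𝕂 d E (j, p) (T x) ≤ C * seminorms 𝕂 d E (k, p) x :=
  hT j

variable [Module ℝ E] [IsScalarTower ℝ 𝕂 E]

theorem weight_mul_smul_le (x : RapidSp 𝕂 d E) {a : ℝ} {n m : Fin d → ℕ} {C : ℝ} {j k : ℕ}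
    (h : |a| * rapidWeight d j n ≤ C * rapidWeight d k m) (p : ContSeminorm 𝕂 E) :
    p.1 (a • x m) * rapidWeight d j n ≤ |C| * seminorms 𝕂 d E (k, p) x := by
  rw [p.map_real_smul]
  calc |a| * p.1 (x m) * rapidWeight d j n
      = |a| * rapidWeight d j n * p.1 (x m) := by ring
    _ ≤ |C| * rapidWeight d k m * p.1 (x m) :=
        mul_le_mul_of_nonneg_right (h.trans (mul_le_mul_of_nonneg_right (le_abs_self C)
          (rapidWeight_pos _ _).le)) (apply_nonneg _ _)
    _ ≤ |C| * seminorms 𝕂 d E (k, p) x := by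
        rw [mul_assoc, mul_comm (rapidWeight _ _ _)]
        exact mul_le_mul_of_nonneg_left (x.weight_mul_le _ p _) (abs_nonneg C)

/-- The operator `x ↦ (a n • x (τ n))_n`. -/
noncomputable def weightedShift (a : (Fin d → ℕ) → ℝ) (τ : (Fin d → ℕ) → Fin d → ℕ)
    (h : ∀ j, ∃ C, ∀ n, |a n| * rapidWeight d j n ≤ C * rapidWeight d (j + 1) (τ n)) :
    RapidSp 𝕂 d E →ₗ[𝕂] RapidSp 𝕂 d E where
  toFun x := ⟨fun n => a n • x (τ n), fun j p => by
    obtain ⟨C, hC⟩ := h j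
    refine ⟨|C| * seminorms 𝕂 d E (j + 1, p) x, ?_⟩
    rintro _ ⟨n, rfl⟩
    exact x.weight_mul_smul_le (hC n) p⟩
  map_add' x y := DFunLike.ext _ _ fun n => smul_add _ _ _
  map_smul' c x := DFunLike.ext _ _ fun n => smul_comm _ _ _

theorem weightedShift_apply {a : (Fin d → ℕ) → ℝ} {τ : (Fin d → ℕ) → Fin d → ℕ} (h)
    (x : RapidSp 𝕂 d E) (n : Fin d → ℕ) : weightedShift a τ h x n = a n • x (τ n) := rfl

theorem weightedShift_mem_tame {a : (Fin d → ℕ) → ℝ} {τ : (Fin d → ℕ) → Fin d → ℕ} (h) :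
    weightedShift a τ h ∈ tame 𝕂 d E := by
  intro j
  obtain ⟨C, hC⟩ := h j
  exact ⟨|C|, j + 1, abs_nonneg C, fun p x => seminorms_le fun n =>
    x.weight_mul_smul_le (hC n) p⟩

variable (𝕂 E) in
/-- The operator `x ↦ (√((n_i + 1)/2) x (n + e_i))_n`. -/
noncomputable def shiftUp (i : Fin d) : RapidSp 𝕂 d E →ₗ[𝕂] RapidSp 𝕂 d E :=
  weightedShift (fun n => ladderCoeff (n i + 1)) (raiseIndex i) fun j => ⟨1, fun n => by
    rw [abs_of_nonneg (ladderCoeff_nonneg _), one_mul, add_comm j, rapidWeight_add]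
    exact mul_le_mul ((ladderCoeff_le_rapidWeight i n).trans (rapidWeight_le_raise _ i n))
      (rapidWeight_le_raise _ i n) (rapidWeight_pos _ _).le (rapidWeight_pos _ _).le⟩

variable (𝕂 E) in
/-- The operator `x ↦ (√(n_i/2) x (n - e_i))_n`. -/
noncomputable def shiftDown (i : Fin d) : RapidSp 𝕂 d E →ₗ[𝕂] RapidSp 𝕂 d E :=
  weightedShift (fun n => ladderCoeff (n i)) (lowerIndex i) fun j => ⟨2 ^ j, fun n => by
    -- When `n_i = 0` the index is not really lowered, but the coefficient vanishes. Otherwise `n =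
    -- m + e_i`, and the weights at `n` and `m` differ by at most `2 ^ j`.
    by_cases hn : n i = 0
    · rw [hn, ladderCoeff_zero, abs_zero, zero_mul]
      exact mul_nonneg (by positivity) (rapidWeight_pos _ _).le
    · obtain ⟨m, rfl⟩ : ∃ m, n = raiseIndex i m := ⟨_, (raise_lower hn).symm⟩
      rw [abs_of_nonneg (ladderCoeff_nonneg _), lower_raise, raiseIndex_apply_self, add_comm j,
        rapidWeight_add, mul_left_comm]
      exact mul_le_mul (ladderCoeff_le_rapidWeight i m) (rapidWeight_raise_le _ i m)
        (rapidWeight_pos _ _).le (rapidWeight_pos _ _).le⟩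

variable (𝕂 E) in
/-- The operator on `s(ℕ₀^d, E)` that corresponds to the `i`-th partial derivative. -/
noncomputable def derivOp (i : Fin d) : Module.End 𝕂 (RapidSp 𝕂 d E) :=
  shiftUp 𝕂 E i - shiftDown 𝕂 E i

variable (𝕂 E) in
/-- The operator on `s(ℕ₀^d, E)` that corresponds to the multiplication by `x_i`. -/
noncomputable def coordOp (i : Fin d) : Module.End 𝕂 (RapidSp 𝕂 d E) :=
  shiftUp 𝕂 E i + shiftDown 𝕂 E i

variable (𝕂 E) in
/-- The operator on `s(ℕ₀^d, E)` that corresponds to the multiplication by `1 + |x|²`. -/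
noncomputable def bracketOp : Module.End 𝕂 (RapidSp 𝕂 d E) := 1 + ∑ i, coordOp 𝕂 E i ^ 2

variable (𝕂 E) in
/-- The operator on `s(ℕ₀^d, E)` that corresponds to `∂^β`. -/
noncomputable def iterDerivOp (β : Fin d → ℕ) : Module.End 𝕂 (RapidSp 𝕂 d E) :=
  (List.finRange d).foldr (fun i T => derivOp 𝕂 E i ^ β i * T) 1

theorem derivOp_mem_tame (i : Fin d) : derivOp 𝕂 E i ∈ tame 𝕂 d E :=
  sub_mem (weightedShift_mem_tame _) (weightedShift_mem_tame _)

theorem coordOp_mem_tame (i : Fin d) : coordOp 𝕂 E i ∈ tame 𝕂 d E :=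
  add_mem (weightedShift_mem_tame _) (weightedShift_mem_tame _)

theorem bracketOp_mem_tame : bracketOp 𝕂 E ∈ tame 𝕂 d E :=
  add_mem (one_mem _) (sum_mem fun i _ => pow_mem (coordOp_mem_tame i) 2)

theorem iterDerivOp_mem_tame (β : Fin d → ℕ) : iterDerivOp 𝕂 E β ∈ tame 𝕂 d E := by
  unfold iterDerivOp
  induction List.finRange d with
  | nil => exact one_mem _
  | cons i l ih => exact mul_mem (pow_mem (derivOp_mem_tame i) _) ih

/-! ### Sums of rapidly decreasing sequences with polynomially bounded coefficients -/

variable [PolynormableSpace 𝕂 E] [T2Space E]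

/-- Split `c_n x_n` as `w_n⁻¹ • (c_n w_n x_n)` with `w` the weight of order `2 * d`: the scalars are
summable and the vectors are bounded in every seminorm. -/
theorem summable_smul_apply (hE : LocallyComplete 𝕂 E) (x : RapidSp 𝕂 d E)
    {c : (Fin d → ℕ) → ℝ} {C : ℝ} {k : ℕ} (hc : ∀ n, |c n| ≤ C * rapidWeight d k n) :
    Summable fun n => c n • x n := by
  have h := hE.summable_smul (c := fun n : Fin d → ℕ => (rapidWeight d (2 * d) n)⁻¹)
    (y := fun n => (c n * rapidWeight d (2 * d) n) • x n) summable_inv_rapidWeight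
    (fun p => ⟨|C| * seminorms 𝕂 d E (k + 2 * d, p) x, fun n => by
      rw [p.map_real_smul, abs_mul, abs_of_pos (rapidWeight_pos _ _)]
      calc |c n| * rapidWeight d (2 * d) n * p.1 (x n)
          ≤ |C| * rapidWeight d k n * rapidWeight d (2 * d) n * p.1 (x n) :=
            mul_le_mul_of_nonneg_right (mul_le_mul_of_nonneg_right ((hc n).trans
              (mul_le_mul_of_nonneg_right (le_abs_self C) (rapidWeight_pos _ _).le))
                (rapidWeight_pos _ _).le) (apply_nonneg _ _)
        _ = |C| * (p.1 (x n) * rapidWeight d (k + 2 * d) n) := by rw [rapidWeight_add]; ring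
        _ ≤ _ := mul_le_mul_of_nonneg_left (x.weight_mul_le _ p n) (abs_nonneg C)⟩)
  refine h.congr fun n => ?_
  rw [smul_smul, mul_comm, mul_assoc, mul_inv_cancel₀ (rapidWeight_pos _ _).ne', mul_one]

theorem mul_seminorm_apply_le (x : RapidSp 𝕂 d E) (p : ContSeminorm 𝕂 E) {c : (Fin d → ℕ) → ℝ}
    {C : ℝ} {k : ℕ} (hc : ∀ n, |c n| ≤ C * rapidWeight d k n) (n : Fin d → ℕ) :
    |c n| * p.1 (x n) ≤ C * seminorms 𝕂 d E (k + 2 * d, p) x * (rapidWeight d (2 * d) n)⁻¹ := by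
  have hC : 0 ≤ C := nonneg_of_mul_nonneg_left ((abs_nonneg _).trans (hc n)) (rapidWeight_pos k n)
  rw [← div_eq_mul_inv, le_div_iff₀ (rapidWeight_pos _ n)]
  calc |c n| * p.1 (x n) * rapidWeight d (2 * d) n
      ≤ C * rapidWeight d k n * p.1 (x n) * rapidWeight d (2 * d) n :=
        mul_le_mul_of_nonneg_right (mul_le_mul_of_nonneg_right (hc n) (apply_nonneg _ _))
          (rapidWeight_pos _ _).le
    _ = C * (p.1 (x n) * rapidWeight d (k + 2 * d) n) := by rw [rapidWeight_add]; ring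
    _ ≤ _ := mul_le_mul_of_nonneg_left (x.weight_mul_le _ p n) hC

theorem summable_mul_seminorm_apply (x : RapidSp 𝕂 d E) (p : ContSeminorm 𝕂 E)
    {c : (Fin d → ℕ) → ℝ} {C : ℝ} {k : ℕ} (hc : ∀ n, |c n| ≤ C * rapidWeight d k n) :
    Summable fun n => |c n| * p.1 (x n) :=
  Summable.of_nonneg_of_le (fun _ => mul_nonneg (abs_nonneg _) (apply_nonneg _ _))
    (x.mul_seminorm_apply_le p hc) (summable_inv_rapidWeight.mul_left _)

theorem seminorm_tsum_le (hE : LocallyComplete 𝕂 E) (x : RapidSp 𝕂 d E) (p : ContSeminorm 𝕂 E)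
    {c : (Fin d → ℕ) → ℝ} {C : ℝ} {k : ℕ} (hc : ∀ n, |c n| ≤ C * rapidWeight d k n) :
    p.1 (∑' n, c n • x n) ≤ ∑' n, |c n| * p.1 (x n) :=
  p.le_tsum (x.summable_smul_apply hE hc).hasSum (x.summable_mul_seminorm_apply p hc)
    fun _ => (p.map_real_smul _ _).le

theorem seminorm_tsum_le_seminorms (hE : LocallyComplete 𝕂 E) (x : RapidSp 𝕂 d E)
    (p : ContSeminorm 𝕂 E) {c : (Fin d → ℕ) → ℝ} {C : ℝ} {k : ℕ}
    (hc : ∀ n, |c n| ≤ C * rapidWeight d k n) :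
    p.1 (∑' n, c n • x n) ≤
      C * (∑' n : Fin d → ℕ, (rapidWeight d (2 * d) n)⁻¹) * seminorms 𝕂 d E (k + 2 * d, p) x := by
  refine (x.seminorm_tsum_le hE p hc).trans (((x.summable_mul_seminorm_apply p hc).tsum_le_tsum
    (x.mul_seminorm_apply_le p hc) (summable_inv_rapidWeight.mul_left _)).trans ?_)
  rw [tsum_mul_left]
  exact le_of_eq (by ring)

/-- Dominated convergence for the scalar series `∑ |c_n - c₀_n| p(x_n)`. It serves both for
continuity of Hermite series and for their termwise differentiation. -/
theorem tendsto_tsum_smul [IsTopologicalAddGroup E] (hE : LocallyComplete 𝕂 E)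
    (x : RapidSp 𝕂 d E) {α : Type*} {l : Filter α}
    {c : α → (Fin d → ℕ) → ℝ} {c₀ : (Fin d → ℕ) → ℝ} {C : ℝ} {k : ℕ}
    (hc : ∀ a n, |c a n| ≤ C * rapidWeight d k n) (hc₀ : ∀ n, |c₀ n| ≤ C * rapidWeight d k n)
    (h : ∀ n, Tendsto (fun a => c a n) l (𝓝 (c₀ n))) :
    Tendsto (fun a => ∑' n, c a n • x n) l (𝓝 (∑' n, c₀ n • x n)) := by
  refine tendsto_of_contSeminorm (𝕂 := 𝕂) fun p => ?_
  have hdiff : ∀ a n, |c a n - c₀ n| ≤ 2 * C * rapidWeight d k n := fun a n =>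
    (abs_sub _ _).trans (by linarith [hc a n, hc₀ n])
  have hle : ∀ a, p.1 (∑' n, c a n • x n - ∑' n, c₀ n • x n) ≤
      ∑' n, |c a n - c₀ n| * p.1 (x n) := fun a => by
    rw [← (x.summable_smul_apply hE (hc a)).tsum_sub (x.summable_smul_apply hE hc₀)]
    simp_rw [← sub_smul]
    exact x.seminorm_tsum_le hE p (hdiff a)
  refine squeeze_zero (fun _ => apply_nonneg _ _) hle ?_
  have h0 : (0 : ℝ) = ∑' n : Fin d → ℕ, |c₀ n - c₀ n| * p.1 (x n) := by simp
  rw [h0]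
  refine tendsto_tsum_of_dominated_convergence (summable_inv_rapidWeight.mul_left
    (2 * C * seminorms 𝕂 d E (k + 2 * d, p) x)) (fun n => ?_) (Eventually.of_forall fun a n => ?_)
  · exact ((h n).sub_const _).abs.mul_const _
  · rw [Real.norm_of_nonneg (mul_nonneg (abs_nonneg _) (apply_nonneg _ _))]
    exact x.mul_seminorm_apply_le p (hdiff a) n

end RapidSp

end Rapid

/-! ### Hermite series -/

section Synthesis

variable {d : ℕ}

theorem abs_ladderCoeff_mul_lower_le (i : Fin d) (n : Fin d → ℕ) (x : EuclideanSpace ℝ (Fin d)) :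
    |ladderCoeff (n i) * hermiteFun (lowerIndex i n) x| ≤
      2 ^ d * 2 ^ d * rapidWeight d (1 + d) n := by
  by_cases hn : n i = 0
  · rw [hn, ladderCoeff_zero, zero_mul, abs_zero]
    exact mul_nonneg (by positivity) (rapidWeight_pos _ _).le
  · obtain ⟨m, rfl⟩ : ∃ m, n = raiseIndex i m := ⟨_, (raise_lower hn).symm⟩
    rw [lower_raise, raiseIndex_apply_self, abs_mul, abs_of_nonneg (ladderCoeff_nonneg _)]
    calc ladderCoeff (m i + 1) * |hermiteFun m x|
        ≤ rapidWeight d 1 m * (2 ^ d * rapidWeight d d m) :=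
          mul_le_mul (ladderCoeff_le_rapidWeight i m) (abs_hermiteFun_le m x) (abs_nonneg _)
            (rapidWeight_pos _ _).le
      _ = 2 ^ d * 1 * rapidWeight d (1 + d) m := by rw [rapidWeight_add]; ring
      _ ≤ _ := mul_le_mul (mul_le_mul_of_nonneg_left (one_le_pow₀ one_le_two) (by positivity))
          (rapidWeight_le_raise _ i m) (rapidWeight_pos _ _).le (by positivity)

theorem abs_ladderCoeff_mul_raise_le (i : Fin d) (n : Fin d → ℕ) (x : EuclideanSpace ℝ (Fin d)) :
    |ladderCoeff (n i + 1) * hermiteFun (raiseIndex i n) x| ≤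
      2 ^ d * 2 ^ d * rapidWeight d (1 + d) n := by
  rw [abs_mul, abs_of_nonneg (ladderCoeff_nonneg _)]
  calc ladderCoeff (n i + 1) * |hermiteFun (raiseIndex i n) x|
      ≤ rapidWeight d 1 n * (2 ^ d * (2 ^ d * rapidWeight d d n)) :=
        mul_le_mul (ladderCoeff_le_rapidWeight i n) ((abs_hermiteFun_le _ x).trans
          (mul_le_mul_of_nonneg_left (rapidWeight_raise_le d i n) (by positivity)))
          (abs_nonneg _) (rapidWeight_pos _ _).le
    _ = _ := by rw [rapidWeight_add]; ring

theorem abs_hermiteDeriv_le (i : Fin d) (n : Fin d → ℕ) (x : EuclideanSpace ℝ (Fin d)) :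
    |hermiteDeriv i n x| ≤ (2 * (2 ^ d * 2 ^ d)) * rapidWeight d (1 + d) n :=
  (abs_sub _ _).trans (by
    linarith [abs_ladderCoeff_mul_lower_le i n x, abs_ladderCoeff_mul_raise_le i n x])

theorem hasDerivAt_hermiteFun_line (i : Fin d) (n : Fin d → ℕ) (x : EuclideanSpace ℝ (Fin d))
    (s : ℝ) : HasDerivAt (fun s : ℝ => hermiteFun n (x + s • EuclideanSpace.single i 1))
      (hermiteDeriv i n (x + s • EuclideanSpace.single i 1)) s := by
  have h := hasLineDerivAt_hermiteFun i n (x + s • EuclideanSpace.single i 1)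
  have h' : HasDerivAt (fun t : ℝ => t - s) 1 s := (hasDerivAt_id s).sub_const s
  rw [HasLineDerivAt, ← sub_self s] at h
  refine (HasDerivAt.comp (h := fun t => t - s) s h h').congr_deriv (mul_one _) |>.congr_of_eventuallyEq
    (Eventually.of_forall fun t => ?_)
  simp only [Function.comp_apply, add_assoc, ← add_smul, add_sub_cancel]

/-- Mean value inequality along the `i`-th coordinate line. Uniformity in `h` supplies the majorant
for dominated convergence; at `h = 0` the quotient is `0` since `h⁻¹ = 0`. -/
theorem abs_hermiteFun_diffQuot_le (i : Fin d) (n : Fin d → ℕ) (x : EuclideanSpace ℝ (Fin d))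
    (h : ℝ) : |diffQuot i (hermiteFun n) x h| ≤
      (2 * (2 ^ d * 2 ^ d)) * rapidWeight d (1 + d) n := by
  have hb := Convex.norm_image_sub_le_of_norm_hasDerivWithin_le
    (fun s _ => (hasDerivAt_hermiteFun_line i n x s).hasDerivWithinAt)
    (fun s _ => abs_hermiteDeriv_le i n _) convex_univ (Set.mem_univ 0) (Set.mem_univ h)
  rw [zero_smul, add_zero, sub_zero, Real.norm_eq_abs, Real.norm_eq_abs] at hb
  rw [diffQuot, smul_eq_mul, abs_mul, abs_inv]
  refine inv_mul_le_of_le_mul₀ (abs_nonneg _)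
    (mul_nonneg (by positivity) (rapidWeight_pos _ _).le) ?_
  rwa [mul_comm]

theorem tendsto_hermiteFun_diffQuot (i : Fin d) (n : Fin d → ℕ) (x : EuclideanSpace ℝ (Fin d)) :
    Tendsto (diffQuot i (hermiteFun n) x) (𝓝[≠] 0) (𝓝 (hermiteDeriv i n x)) := by
  have h := hasDerivAt_iff_tendsto_slope_zero.1 (hasLineDerivAt_hermiteFun i n x)
  exact h.congr fun t => by simp [diffQuot]

variable {𝕂 : Type*} [RCLike 𝕂] {E : Type*} [AddCommGroup E] [Module 𝕂 E] [Module ℝ E]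
  [IsScalarTower ℝ 𝕂 E] [TopologicalSpace E] [IsTopologicalAddGroup E] [ContinuousSMul 𝕂 E]
  [T2Space E] [PolynormableSpace 𝕂 E]

/-- The Hermite series `∑ n, h_n(t) x_n`. -/
noncomputable def hermiteSeries (x : RapidSp 𝕂 d E) (t : EuclideanSpace ℝ (Fin d)) : E :=
  ∑' n, hermiteFun n t • x n

theorem hasSum_hermiteSeries (hE : LocallyComplete 𝕂 E) (x : RapidSp 𝕂 d E)
    (t : EuclideanSpace ℝ (Fin d)) :
    HasSum (fun n => hermiteFun n t • x n) (hermiteSeries x t) :=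
  (x.summable_smul_apply hE fun n => abs_hermiteFun_le n t).hasSum

theorem continuous_hermiteSeries (hE : LocallyComplete 𝕂 E) (x : RapidSp 𝕂 d E) :
    Continuous (hermiteSeries x) :=
  continuous_iff_continuousAt.2 fun t => x.tendsto_tsum_smul hE
    (fun t n => abs_hermiteFun_le n t) (fun n => abs_hermiteFun_le n t)
    fun n => (continuous_hermiteFun n).tendsto t

theorem hermiteSeries_add (hE : LocallyComplete 𝕂 E) (x y : RapidSp 𝕂 d E)
    (t : EuclideanSpace ℝ (Fin d)) :
    hermiteSeries (x + y) t = hermiteSeries x t + hermiteSeries y t := by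
  refine HasSum.tsum_eq ?_
  simpa [smul_add] using (hasSum_hermiteSeries hE x t).add (hasSum_hermiteSeries hE y t)

theorem hermiteSeries_sub (hE : LocallyComplete 𝕂 E) (x y : RapidSp 𝕂 d E)
    (t : EuclideanSpace ℝ (Fin d)) :
    hermiteSeries (x - y) t = hermiteSeries x t - hermiteSeries y t := by
  refine HasSum.tsum_eq ?_
  simpa [smul_sub] using (hasSum_hermiteSeries hE x t).sub (hasSum_hermiteSeries hE y t)

theorem hermiteSeries_smul (hE : LocallyComplete 𝕂 E) (c : 𝕂) (x : RapidSp 𝕂 d E)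
    (t : EuclideanSpace ℝ (Fin d)) :
    hermiteSeries (c • x) t = c • hermiteSeries x t := by
  refine HasSum.tsum_eq ?_
  simpa [smul_comm c] using (hasSum_hermiteSeries hE x t).const_smul c

/-- Reindexing along the injection `n ↦ n + e_i`; indices outside its range have `n_i = 0` and
contribute nothing. -/
theorem hermiteSeries_shiftUp (x : RapidSp 𝕂 d E) (i : Fin d) (t : EuclideanSpace ℝ (Fin d)) :
    hermiteSeries (RapidSp.shiftUp 𝕂 E i x) t =
      ∑' n, (ladderCoeff (n i) * hermiteFun (lowerIndex i n) t) • x n := by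
  rw [hermiteSeries, ← (raiseIndex_injective i).tsum_eq
    (f := fun n => (ladderCoeff (n i) * hermiteFun (lowerIndex i n) t) • x n)]
  · refine tsum_congr fun n => ?_
    rw [RapidSp.shiftUp, RapidSp.weightedShift_apply, smul_smul, lower_raise,
      raiseIndex_apply_self, mul_comm]
  · intro n hn
    refine ⟨lowerIndex i n, raise_lower fun h => hn ?_⟩
    simp [h]

theorem hermiteSeries_shiftDown (x : RapidSp 𝕂 d E) (i : Fin d)
    (t : EuclideanSpace ℝ (Fin d)) :
    hermiteSeries (RapidSp.shiftDown 𝕂 E i x) t =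
      ∑' n, (ladderCoeff (n i + 1) * hermiteFun (raiseIndex i n) t) • x n := by
  rw [hermiteSeries, ← (raiseIndex_injective i).tsum_eq]
  · refine tsum_congr fun n => ?_
    rw [RapidSp.shiftDown, RapidSp.weightedShift_apply, smul_smul, lower_raise,
      raiseIndex_apply_self, mul_comm]
  · intro n hn
    refine ⟨lowerIndex i n, raise_lower fun h => hn ?_⟩
    simp [h, RapidSp.shiftDown, RapidSp.weightedShift_apply]

theorem hermiteSeries_derivOp (hE : LocallyComplete 𝕂 E) (x : RapidSp 𝕂 d E) (i : Fin d)
    (t : EuclideanSpace ℝ (Fin d)) :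
    hermiteSeries (RapidSp.derivOp 𝕂 E i x) t = ∑' n, hermiteDeriv i n t • x n := by
  rw [RapidSp.derivOp, LinearMap.sub_apply, hermiteSeries_sub hE, hermiteSeries_shiftUp,
    hermiteSeries_shiftDown, ← Summable.tsum_sub]
  · exact tsum_congr fun n => (sub_smul _ _ _).symm
  · exact x.summable_smul_apply hE fun n => abs_ladderCoeff_mul_lower_le i n t
  · exact x.summable_smul_apply hE fun n => abs_ladderCoeff_mul_raise_le i n t

theorem hermiteSeries_coordOp (hE : LocallyComplete 𝕂 E) (x : RapidSp 𝕂 d E) (i : Fin d)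
    (t : EuclideanSpace ℝ (Fin d)) :
    hermiteSeries (RapidSp.coordOp 𝕂 E i x) t = t i • hermiteSeries x t := by
  have : ContinuousSMul ℝ E := IsScalarTower.continuousSMul 𝕂
  rw [RapidSp.coordOp, LinearMap.add_apply, hermiteSeries_add hE, hermiteSeries_shiftUp,
    hermiteSeries_shiftDown, ← Summable.tsum_add]
  · rw [hermiteSeries, ← (hasSum_hermiteSeries hE x t).summable.tsum_const_smul]
    refine tsum_congr fun n => ?_
    rw [smul_smul, coord_mul_hermiteFun, add_smul]
  · exact x.summable_smul_apply hE fun n => abs_ladderCoeff_mul_lower_le i n t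
  · exact x.summable_smul_apply hE fun n => abs_ladderCoeff_mul_raise_le i n t

/-- Difference quotients are taken termwise and the limit is interchanged with the sum by
`tendsto_tsum_smul`. As the derivative is again a Hermite series of a rapidly decreasing sequence,
smoothness follows by induction. -/
theorem hasPartialDerivAt_hermiteSeries (hE : LocallyComplete 𝕂 E) (x : RapidSp 𝕂 d E) (i : Fin d)
    (t : EuclideanSpace ℝ (Fin d)) :
    HasPartialDerivAt i (hermiteSeries x) (hermiteSeries (RapidSp.derivOp 𝕂 E i x) t) t := by
  have : ContinuousSMul ℝ E := IsScalarTower.continuousSMul 𝕂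
  rw [hermiteSeries_derivOp hE]
  refine (x.tendsto_tsum_smul hE (fun h n => abs_hermiteFun_diffQuot_le i n t h)
    (fun n => abs_hermiteDeriv_le i n t) fun n => tendsto_hermiteFun_diffQuot i n t).congr
      fun h => ?_
  have h₁ := hasSum_hermiteSeries hE x (t + h • EuclideanSpace.single i (1 : ℝ))
  refine HasSum.tsum_eq (((h₁.sub (hasSum_hermiteSeries hE x t)).const_smul h⁻¹).congr_fun
    fun n => ?_)
  simp [diffQuot, sub_smul, mul_smul]

theorem partialDeriv_hermiteSeries (hE : LocallyComplete 𝕂 E) (x : RapidSp 𝕂 d E) (i : Fin d) :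
    partialDeriv i (hermiteSeries x) = hermiteSeries (RapidSp.derivOp 𝕂 E i x) :=
  funext fun t => (hasPartialDerivAt_hermiteSeries hE x i t).partialDeriv_eq

theorem isSmooth_hermiteSeries (hE : LocallyComplete 𝕂 E) (x : RapidSp 𝕂 d E) :
    IsSmooth (hermiteSeries x) := by
  intro k
  induction k generalizing x with
  | zero => exact continuous_hermiteSeries hE x
  | succ k ih =>
    intro i
    rw [partialDeriv_hermiteSeries hE]
    exact ⟨fun t => ⟨_, hasPartialDerivAt_hermiteSeries hE x i t⟩, continuous_hermiteSeries hE _,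
      ih _⟩

theorem iterPartialDeriv_hermiteSeries (hE : LocallyComplete 𝕂 E) (x : RapidSp 𝕂 d E)
    (β : Fin d → ℕ) :
    iterPartialDeriv β (hermiteSeries x) = hermiteSeries (RapidSp.iterDerivOp 𝕂 E β x) := by
  have hp : ∀ (i : Fin d) (n : ℕ) (y : RapidSp 𝕂 d E),
      (partialDeriv i)^[n] (hermiteSeries y) =
        hermiteSeries ((RapidSp.derivOp 𝕂 E i ^ n) y) := by
    intro i n
    induction n with
    | zero => intro y; rfl
    | succ n ih =>
      intro y
      rw [pow_succ, Module.End.mul_apply, ← ih, Function.iterate_succ_apply,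
        partialDeriv_hermiteSeries hE]
  unfold iterPartialDeriv RapidSp.iterDerivOp
  induction List.finRange d with
  | nil => rfl
  | cons i l ih => rw [List.foldr_cons, List.foldr_cons, Module.End.mul_apply, ih, hp]

theorem hermiteSeries_bracketOp (hE : LocallyComplete 𝕂 E) (x : RapidSp 𝕂 d E)
    (t : EuclideanSpace ℝ (Fin d)) :
    hermiteSeries (RapidSp.bracketOp 𝕂 E x) t = bracket ‖t‖ ^ 2 • hermiteSeries x t := by
  have hsum : ∀ s : Finset (Fin d), hermiteSeries ((∑ i ∈ s, RapidSp.coordOp 𝕂 E i ^ 2) x) t =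
      (∑ i ∈ s, t i ^ 2) • hermiteSeries x t := by
    intro s
    induction s using Finset.cons_induction with
    | empty => simp [hermiteSeries]
    | cons i s hi ih =>
      rw [Finset.sum_cons, Finset.sum_cons, LinearMap.add_apply, hermiteSeries_add hE, ih, add_smul,
        pow_two, Module.End.mul_apply, hermiteSeries_coordOp hE, hermiteSeries_coordOp hE,
        smul_smul, pow_two]
  rw [RapidSp.bracketOp, LinearMap.add_apply, hermiteSeries_add hE, hsum, bracket_sq,
    EuclideanSpace.real_norm_sq_eq, add_smul, one_smul]
  rfl

theorem hermiteSeries_bracketOp_pow (hE : LocallyComplete 𝕂 E) (x : RapidSp 𝕂 d E) (m : ℕ)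
    (t : EuclideanSpace ℝ (Fin d)) :
    hermiteSeries ((RapidSp.bracketOp 𝕂 E ^ m) x) t =
      (bracket ‖t‖ ^ 2) ^ m • hermiteSeries x t := by
  induction m with
  | zero => simp
  | succ m ih =>
    rw [pow_succ', Module.End.mul_apply, hermiteSeries_bracketOp hE, ih, smul_smul,
      pow_succ' (bracket ‖t‖ ^ 2) m]

theorem seminorm_hermiteSeries_le (hE : LocallyComplete 𝕂 E) (x : RapidSp 𝕂 d E)
    (p : ContSeminorm 𝕂 E) (t : EuclideanSpace ℝ (Fin d)) :
    p.1 (hermiteSeries x t) ≤ 2 ^ d * (∑' n : Fin d → ℕ, (rapidWeight d (2 * d) n)⁻¹) *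
      RapidSp.seminorms 𝕂 d E (d + 2 * d, p) x :=
  x.seminorm_tsum_le_seminorms hE p fun n => abs_hermiteFun_le n t

/-- Derivatives and weight are both moved onto the sequence as tame operators, leaving only the sup
bound of a Hermite series. The constants do not depend on `p`. -/
theorem exists_seminorm_iterPartialDeriv_hermiteSeries_le (hE : LocallyComplete 𝕂 E) (m : ℕ)
    (β : Fin d → ℕ) : ∃ C k, 0 ≤ C ∧ ∀ (p : ContSeminorm 𝕂 E) (x : RapidSp 𝕂 d E)
      (t : EuclideanSpace ℝ (Fin d)),
      p.1 (iterPartialDeriv β (hermiteSeries x) t) * bracket ‖t‖ ^ m ≤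
        C * RapidSp.seminorms 𝕂 d E (k, p) x := by
  obtain ⟨C, k, hC, hk⟩ := RapidSp.exists_bound_of_mem_tame (mul_mem
    (pow_mem (RapidSp.bracketOp_mem_tame (𝕂 := 𝕂) (E := E) (d := d)) m)
    (RapidSp.iterDerivOp_mem_tame β)) (d + 2 * d)
  have hS : 0 ≤ ∑' n : Fin d → ℕ, (rapidWeight d (2 * d) n)⁻¹ :=
    tsum_nonneg fun n => (inv_pos.2 (rapidWeight_pos _ n)).le
  refine ⟨2 ^ d * (∑' n : Fin d → ℕ, (rapidWeight d (2 * d) n)⁻¹) * C, k,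
    mul_nonneg (mul_nonneg (by positivity) hS) hC, fun p x t => ?_⟩
  rw [iterPartialDeriv_hermiteSeries hE]
  -- The exponent is doubled to obtain a power of `1 + |t|²`, which is polynomial in the coordinates
  -- and hence realized by `bracketOp`.
  have h1 : bracket ‖t‖ ^ m ≤ (bracket ‖t‖ ^ 2) ^ m := by
    rw [← pow_mul]
    exact pow_le_pow_right₀ (one_le_bracket _) (by omega)
  refine (mul_le_mul_of_nonneg_left h1 (apply_nonneg _ _)).trans ?_
  have h2 : p.1 (hermiteSeries (RapidSp.iterDerivOp 𝕂 E β x) t) * (bracket ‖t‖ ^ 2) ^ m =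
      p.1 (hermiteSeries ((RapidSp.bracketOp 𝕂 E ^ m * RapidSp.iterDerivOp 𝕂 E β :
        Module.End 𝕂 (RapidSp 𝕂 d E)) x) t) := by
    rw [Module.End.mul_apply, hermiteSeries_bracketOp_pow hE, p.map_real_smul,
      abs_of_nonneg (by positivity), mul_comm]
  rw [h2, mul_assoc _ C]
  exact (seminorm_hermiteSeries_le hE _ p t).trans
    (mul_le_mul_of_nonneg_left (hk p x) (mul_nonneg (by positivity) hS))

theorem exists_seminorm_hermiteSeries_le (hE : LocallyComplete 𝕂 E) (m : ℕ) :
    ∃ C k, ∀ (p : ContSeminorm 𝕂 E) (x : RapidSp 𝕂 d E) (q : SchwartzIndex d m),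
      p.1 (iterPartialDeriv q.1.1 (hermiteSeries x) q.2) * schwartzWeight d m q ≤
        C * RapidSp.seminorms 𝕂 d E (k, p) x := by
  choose C k hC hk using
    exists_seminorm_iterPartialDeriv_hermiteSeries_le (𝕂 := 𝕂) (d := d) hE m
  -- Only finitely many `β` have `|β| ≤ m`, so constants are added and orders maximized.
  refine ⟨∑ β ∈ lengthBall d m, C β, (lengthBall d m).sup k, fun p x q => ?_⟩
  have hq : q.1.1 ∈ lengthBall d m := mem_lengthBall.2 q.1.2
  rw [schwartzWeight_eq]
  exact (hk q.1.1 p x q.2).trans (mul_le_mul (Finset.single_le_sum (fun β _ => hC β) hq)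
    (RapidSp.seminorms_mono (Finset.le_sup hq) p x) (apply_nonneg _ _)
    (Finset.sum_nonneg fun β _ => hC β))

/-- The synthesis operator `(x_n)_n ↦ ∑ n, x_n h_n` as a linear map. -/
noncomputable def synthesisₗ (hE : LocallyComplete 𝕂 E) :
    RapidSp 𝕂 d E →ₗ[𝕂] SchwartzSp 𝕂 d E where
  toFun x := ⟨⟨hermiteSeries x, isSmooth_hermiteSeries hE x⟩, fun m p => by
    obtain ⟨C, k, h⟩ := exists_seminorm_hermiteSeries_le (𝕂 := 𝕂) (d := d) hE m
    refine ⟨C * RapidSp.seminorms 𝕂 d E (k, p) x, ?_⟩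
    rintro _ ⟨q, rfl⟩
    exact h p x q⟩
  map_add' x y := DFunLike.ext _ _ (hermiteSeries_add hE x y)
  map_smul' c x := DFunLike.ext _ _ (hermiteSeries_smul hE c x)

variable (d) in
/-- The synthesis operator `(x_n)_n ↦ ∑ n, x_n h_n` from `s(ℕ₀^d, E)` to `S(ℝ^d, E)`. -/
noncomputable def synthesis (hE : LocallyComplete 𝕂 E) :
    RapidSp 𝕂 d E →L[𝕂] SchwartzSp 𝕂 d E where
  toLinearMap := synthesisₗ hE
  cont := by
    refine continuous_of_seminorm_bound (RapidSp.withSeminorms 𝕂 d E)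
      (SchwartzSp.withSeminorms 𝕂 d E) _ ?_
    rintro ⟨m, p⟩
    obtain ⟨C, k, h⟩ := exists_seminorm_hermiteSeries_le (𝕂 := 𝕂) (d := d) hE m
    have : Nonempty (SchwartzIndex d m) := ⟨⟨0, by simp⟩, 0⟩
    exact ⟨(k, p), C, fun x => ciSup_le (h p x)⟩

end Synthesis

/-! ### Scalar functions with rapidly decreasing derivatives in one coordinate direction -/

section Directional

variable {d : ℕ} {𝕂 : Type*} [RCLike 𝕂]

theorem integrable_inv_bracket_pow {m : ℕ} (hm : d < m) :
    Integrable fun x : EuclideanSpace ℝ (Fin d) => (bracket ‖x‖ ^ m)⁻¹ := by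
  have h := integrable_rpow_neg_one_add_norm_sq (E := EuclideanSpace ℝ (Fin d)) (μ := volume)
    (r := m) (by simpa using hm)
  refine h.congr (Eventually.of_forall fun x => ?_)
  simp only
  rw [← bracket_pow, neg_div, Real.rpow_neg (by positivity)]

theorem integrable_of_decay {F : Type*} [NormedAddCommGroup F]
    {g : EuclideanSpace ℝ (Fin d) → F} (hg : Continuous g) {B : ℝ}
    (h : ∀ x, ‖g x‖ * bracket ‖x‖ ^ (d + 1) ≤ B) : Integrable g := by
  refine Integrable.mono' ((integrable_inv_bracket_pow (Nat.lt_succ_self d)).const_mul B)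
    hg.aestronglyMeasurable (Eventually.of_forall fun x => ?_)
  rw [← div_eq_mul_inv, le_div_iff₀ (pow_pos (bracket_pos _) _)]
  exact h x

/-- The functions `f a` are the iterated derivatives of `f 0` in the direction of the `i`-th
coordinate, and they are rapidly decreasing. -/
structure IsDirSchwartz (i : Fin d) (f : ℕ → EuclideanSpace ℝ (Fin d) → 𝕂) : Prop where
  cont : ∀ a, Continuous (f a)
  deriv : ∀ a x, HasLineDerivAt ℝ (f a) (f (a + 1) x) x (EuclideanSpace.single i 1)
  decay : ∀ a m, ∃ B, ∀ x, ‖f a x‖ * bracket ‖x‖ ^ m ≤ B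

/-- The derivatives of `(x_i + ∂_i) f`. -/
noncomputable def ladderSeq (i : Fin d) (f : ℕ → EuclideanSpace ℝ (Fin d) → 𝕂) (a : ℕ)
    (x : EuclideanSpace ℝ (Fin d)) : 𝕂 :=
  x i • f a x + (a : ℝ) • f (a - 1) x + f (a + 1) x

theorem abs_coord_le_bracket (i : Fin d) (x : EuclideanSpace ℝ (Fin d)) :
    |x i| ≤ bracket ‖x‖ := by
  have h := PiLp.norm_apply_le x i
  rw [Real.norm_eq_abs] at h
  exact h.trans ((le_abs_self _).trans (abs_le_bracket _))

/-- One application of `x_i + ∂_i` costs one derivative, one order of weight and a factor `a + 2`,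
one unit each for the outer terms and `a` for the middle one. -/
theorem norm_ladderSeq_mul_le {i : Fin d} {f : ℕ → EuclideanSpace ℝ (Fin d) → 𝕂} {a m : ℕ} {B : ℝ}
    {x : EuclideanSpace ℝ (Fin d)} (h : ∀ b ≤ a + 1, ‖f b x‖ * bracket ‖x‖ ^ (m + 1) ≤ B) :
    ‖ladderSeq i f a x‖ * bracket ‖x‖ ^ m ≤ (a + 2) * B := by
  have hb := one_le_bracket ‖x‖
  have hb0 := pow_pos (bracket_pos ‖x‖) m
  have hm : bracket ‖x‖ ^ m ≤ bracket ‖x‖ ^ (m + 1) := pow_le_pow_right₀ hb (Nat.le_succ m)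
  have h₁ : |x i| * ‖f a x‖ * bracket ‖x‖ ^ m ≤ B := by
    refine le_trans ?_ (h a (Nat.le_succ a))
    rw [pow_succ']
    calc |x i| * ‖f a x‖ * bracket ‖x‖ ^ m ≤ bracket ‖x‖ * ‖f a x‖ * bracket ‖x‖ ^ m := by
          gcongr; exact abs_coord_le_bracket i x
      _ = _ := by ring
  have h₂ : (a : ℝ) * ‖f (a - 1) x‖ * bracket ‖x‖ ^ m ≤ a * B := by
    rw [mul_assoc]
    refine mul_le_mul_of_nonneg_left ?_ (Nat.cast_nonneg a)
    exact (mul_le_mul_of_nonneg_left hm (norm_nonneg _)).trans (h _ (by omega))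
  have h₃ : ‖f (a + 1) x‖ * bracket ‖x‖ ^ m ≤ B :=
    (mul_le_mul_of_nonneg_left hm (norm_nonneg _)).trans (h _ le_rfl)
  calc ‖ladderSeq i f a x‖ * bracket ‖x‖ ^ m
      ≤ (|x i| * ‖f a x‖ + a * ‖f (a - 1) x‖ + ‖f (a + 1) x‖) * bracket ‖x‖ ^ m := by
        refine mul_le_mul_of_nonneg_right ((norm_add₃_le).trans ?_) hb0.le
        rw [norm_smul, norm_smul, Real.norm_eq_abs, RCLike.norm_natCast]
    _ ≤ (a + 2) * B := by linarith

theorem hasLineDerivAt_coord (i : Fin d) (x : EuclideanSpace ℝ (Fin d)) :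
    HasLineDerivAt ℝ (fun x : EuclideanSpace ℝ (Fin d) => x i) 1 x
      (EuclideanSpace.single i 1) := by
  have h : HasDerivAt (fun t : ℝ => x i + t) 1 0 := (hasDerivAt_id 0).const_add _
  simpa [HasLineDerivAt] using h

/-- Leibniz: `∂^a (x_i f + ∂_i f) = x_i ∂^a f + a ∂^(a-1) f + ∂^(a+1) f`. Stability under `x_i +
∂_i` is what permits iteration with derivatives in one direction only. -/
theorem IsDirSchwartz.ladderSeq {i : Fin d} {f : ℕ → EuclideanSpace ℝ (Fin d) → 𝕂}
    (hf : IsDirSchwartz i f) : IsDirSchwartz i (ladderSeq i f) where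
  cont a := by
    have h₁ := hf.cont a
    have h₂ := hf.cont (a - 1)
    have h₃ := hf.cont (a + 1)
    unfold _root_.ladderSeq
    fun_prop
  deriv a x := by
    have h₁ := HasDerivAt.smul (hasLineDerivAt_coord i x) (hf.deriv a x)
    have h₂ : HasLineDerivAt ℝ (fun x => (a : ℝ) • f (a - 1) x) ((a : ℝ) • f a x) x
        (EuclideanSpace.single i 1) := by
      cases a with
      | zero => simpa [HasLineDerivAt] using hasDerivAt_const (0 : ℝ) (0 : 𝕂)
      | succ a => exact HasDerivAt.const_smul ((a + 1 : ℕ) : ℝ) (hf.deriv a x)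
    refine ((h₁.add h₂).add (hf.deriv (a + 1) x)).congr_deriv ?_
    simp only [zero_smul, add_zero, one_smul, _root_.ladderSeq, Nat.add_sub_cancel]
    push_cast
    rw [add_smul, one_smul]
    ring
  decay a m := by
    choose B hB using fun b => hf.decay b (m + 1)
    refine ⟨(a + 2) * ∑ b ∈ Finset.range (a + 2), |B b|, fun x => norm_ladderSeq_mul_le
      fun b hb => (hB b x).trans ((le_abs_self _).trans ?_)⟩
    exact Finset.single_le_sum (f := fun b => |B b|) (fun _ _ => abs_nonneg _)
      (Finset.mem_range.2 (by omega))

theorem integrable_smul_of_decay {g : EuclideanSpace ℝ (Fin d) → 𝕂}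
    (hg : Continuous g) {B : ℝ} (h : ∀ x, ‖g x‖ * bracket ‖x‖ ^ (d + 2) ≤ B)
    {u : EuclideanSpace ℝ (Fin d) → ℝ} (hu : Continuous u) {C : ℝ}
    (hC : ∀ x, |u x| ≤ C * bracket ‖x‖) : Integrable fun x => u x • g x := by
  refine integrable_of_decay (hu.smul hg) (B := C * B) fun x => ?_
  have hC0 : 0 ≤ C := nonneg_of_mul_nonneg_left ((abs_nonneg _).trans (hC 0)) (bracket_pos _)
  rw [norm_smul, Real.norm_eq_abs]
  calc |u x| * ‖g x‖ * bracket ‖x‖ ^ (d + 1)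
      ≤ C * bracket ‖x‖ * ‖g x‖ * bracket ‖x‖ ^ (d + 1) := by
        have := hC x
        have := bracket_pos ‖x‖
        gcongr
    _ = C * (‖g x‖ * bracket ‖x‖ ^ (d + 2)) := by ring
    _ ≤ C * B := mul_le_mul_of_nonneg_left (h x) hC0

theorem continuous_hermiteDeriv (i : Fin d) (n : Fin d → ℕ) : Continuous (hermiteDeriv i n) :=
  ((continuous_hermiteFun _).const_mul _).sub ((continuous_hermiteFun _).const_mul _)

theorem two_ladderCoeff_mul_hermiteFun (i : Fin d) (n : Fin d → ℕ)
    (x : EuclideanSpace ℝ (Fin d)) :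
    2 * ladderCoeff (n i + 1) * hermiteFun (raiseIndex i n) x =
      x i * hermiteFun n x - hermiteDeriv i n x := by
  rw [coord_mul_hermiteFun, hermiteDeriv]
  ring

/-- The operator `x_i - ∂_i`, which raises `h_n`, becomes `x_i + ∂_i` on `f` after integration by
parts. The left factor is `√(2(n_i + 1))`, the source of all decay of the coefficients. -/
theorem IsDirSchwartz.integral_raise {i : Fin d} {f : ℕ → EuclideanSpace ℝ (Fin d) → 𝕂}
    (hf : IsDirSchwartz i f) (n : Fin d → ℕ) :
    (2 * ladderCoeff (n i + 1)) • ∫ x, hermiteFun (raiseIndex i n) x • f 0 x =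
      ∫ x, hermiteFun n x • _root_.ladderSeq i f 0 x := by
  obtain ⟨B₀, hB₀⟩ := hf.decay 0 (d + 2)
  obtain ⟨B₁, hB₁⟩ := hf.decay 1 (d + 2)
  have bd : ∀ {u : EuclideanSpace ℝ (Fin d) → ℝ} {C : ℝ}, (∀ x, |u x| ≤ C) →
      ∀ x, |u x| ≤ C * bracket ‖x‖ := fun {u C} h x => (h x).trans
    (le_mul_of_one_le_right ((abs_nonneg _).trans (h x)) (one_le_bracket _))
  have i₁ := integrable_smul_of_decay (hf.cont 1) hB₁ (continuous_hermiteFun n)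
    (bd (abs_hermiteFun_le n))
  have i₂ := integrable_smul_of_decay (hf.cont 0) hB₀ (continuous_hermiteDeriv i n)
    (bd (abs_hermiteDeriv_le i n))
  have i₃ := integrable_smul_of_decay (hf.cont 0) hB₀ (continuous_hermiteFun n)
    (bd (abs_hermiteFun_le n))
  have i₄ := integrable_smul_of_decay (hf.cont 0) hB₀
    (u := fun x => x i * hermiteFun n x) (C := 2 ^ d * rapidWeight d d n)
    ((by fun_prop : Continuous fun x : EuclideanSpace ℝ (Fin d) => x i).mul
      (continuous_hermiteFun n)) (fun x => by
      rw [abs_mul, mul_comm]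
      exact mul_le_mul (abs_hermiteFun_le n x) (abs_coord_le_bracket i x) (abs_nonneg _)
        (mul_nonneg (by positivity) (rapidWeight_pos _ _).le))
  have h := integral_bilinear_hasLineDerivAt_right_eq_neg_left_of_integrable
    (μ := volume) (B := ContinuousLinearMap.lsmul ℝ ℝ (E := 𝕂)) (f := hermiteFun n)
    (f' := hermiteDeriv i n) (g := f 0) (g' := f 1) i₂ i₁ i₃
    (fun x _ => hasLineDerivAt_hermiteFun i n x) (fun x _ => hf.deriv 0 x)
  simp only [ContinuousLinearMap.lsmul_apply] at h
  rw [← integral_smul]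
  have e₁ : ∀ x, (2 * ladderCoeff (n i + 1)) • hermiteFun (raiseIndex i n) x • f 0 x =
      (x i * hermiteFun n x) • f 0 x - hermiteDeriv i n x • f 0 x := fun x => by
    rw [smul_smul, two_ladderCoeff_mul_hermiteFun, sub_smul]
  have e₂ : ∀ x, hermiteFun n x • _root_.ladderSeq i f 0 x =
      (x i * hermiteFun n x) • f 0 x + hermiteFun n x • f 1 x := fun x => by
    simp only [_root_.ladderSeq, Nat.cast_zero, zero_smul, add_zero, smul_add, smul_smul, zero_add]
    rw [mul_comm]
  simp_rw [e₁, e₂]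
  rw [integral_sub i₄ i₂, integral_add i₄ i₁, h, sub_eq_add_neg]

/-- Uniform in `n` because `∫ h_n² = 1`: with `w = ⟨x⟩^{-(d+1)}`, which is square integrable, `2
|h_n| w ≤ h_n² + w²`. -/
theorem exists_norm_integral_hermiteFun_le (d : ℕ) (𝕂 : Type*) [RCLike 𝕂] :
    ∃ C, 0 ≤ C ∧ ∀ (f : EuclideanSpace ℝ (Fin d) → 𝕂) (B : ℝ),
      (∀ x, ‖f x‖ * bracket ‖x‖ ^ (d + 1) ≤ B) → ∀ n : Fin d → ℕ,
        ‖∫ x, hermiteFun n x • f x‖ ≤ C * B := by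
  have hw := integrable_inv_bracket_pow (d := d) (m := (d + 1) * 2) (by omega)
  refine ⟨(1 + ∫ x : EuclideanSpace ℝ (Fin d), (bracket ‖x‖ ^ ((d + 1) * 2))⁻¹) / 2, ?_,
    fun f B hB n => ?_⟩
  · have : 0 ≤ ∫ x : EuclideanSpace ℝ (Fin d), (bracket ‖x‖ ^ ((d + 1) * 2))⁻¹ :=
      integral_nonneg fun x => inv_nonneg.2 (pow_nonneg (bracket_pos _).le _)
    positivity
  · have hB0 : 0 ≤ B := (mul_nonneg (norm_nonneg _) (pow_nonneg (bracket_pos _).le _)).trans (hB 0)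
    have hi := integrable_hermiteFun_mul n n
    have key : ∀ x, ‖hermiteFun n x • f x‖ ≤
        B / 2 * (hermiteFun n x * hermiteFun n x + (bracket ‖x‖ ^ ((d + 1) * 2))⁻¹) := by
      intro x
      have hb := pow_pos (bracket_pos ‖x‖) (d + 1)
      have h₁ : ‖f x‖ ≤ B * (bracket ‖x‖ ^ (d + 1))⁻¹ := by
        rw [← div_eq_mul_inv, le_div_iff₀ hb]; exact hB x
      rw [norm_smul, Real.norm_eq_abs, pow_mul, ← inv_pow]
      set w := (bracket ‖x‖ ^ (d + 1))⁻¹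
      calc |hermiteFun n x| * ‖f x‖ ≤ |hermiteFun n x| * (B * w) := by gcongr
        _ = B * (|hermiteFun n x| * w) := by ring
        _ ≤ B * ((hermiteFun n x * hermiteFun n x + w ^ 2) / 2) := by
            refine mul_le_mul_of_nonneg_left ?_ hB0
            nlinarith [sq_nonneg (|hermiteFun n x| - w), abs_mul_abs_self (hermiteFun n x)]
        _ = _ := by ring
    refine (norm_integral_le_of_norm_le ((hi.add hw).const_mul (B / 2))
      (Eventually.of_forall key)).trans ?_
    simp only [Pi.add_apply]
    rw [integral_const_mul, integral_add hi hw, integral_hermiteFun_mul, if_pos rfl]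
    exact le_of_eq (by ring)

/-- Induction on `k`: if `n_i > 0`, one unit is taken off `n_i` by replacing `f` with `(x_i + ∂_i)
f`, which gains one factor `√(n_i + 1)` up to constants. If `n_i = 0`, that factor is `1` and the
uniform bound suffices. -/
theorem exists_norm_integral_hermiteFun_mul_le (d : ℕ) (𝕂 : Type*) [RCLike 𝕂] (k : ℕ) :
    ∃ C, 0 ≤ C ∧ ∀ (i : Fin d) (f : ℕ → EuclideanSpace ℝ (Fin d) → 𝕂) (B : ℝ),
      IsDirSchwartz i f → (∀ a ≤ d + 1 + k, ∀ x, ‖f a x‖ * bracket ‖x‖ ^ (d + 1 + k) ≤ B) →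
        ∀ n : Fin d → ℕ, ‖∫ x, hermiteFun n x • f 0 x‖ * √(n i + 1) ^ k ≤ C * B := by
  induction k with
  | zero =>
    obtain ⟨C, hC, h⟩ := exists_norm_integral_hermiteFun_le d 𝕂
    exact ⟨C, hC, fun i f B _ hB n => by simpa using h (f 0) B (hB 0 (Nat.zero_le _)) n⟩
  | succ k ih =>
    obtain ⟨C₀, hC₀, h₀⟩ := exists_norm_integral_hermiteFun_le d 𝕂
    obtain ⟨C, hC, h⟩ := ih
    -- `C₀` covers `n_i = 0`. In the other summand `d + 1 + k + 2` is the largest factor `a + 2`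
    -- from a ladder step, and `2 ^ k` comes from comparing `√(n_i + 1)` before and after lowering.
    refine ⟨C₀ + 2 ^ k * (C * (d + 1 + k + 2)), by positivity, fun i f B hf hB n => ?_⟩
    have hB0 : 0 ≤ B :=
      (mul_nonneg (norm_nonneg _) (pow_nonneg (bracket_pos _).le _)).trans (hB 0 (Nat.zero_le _) 0)
    rw [add_mul]
    by_cases hn : n i = 0
    · refine le_trans ?_ (le_add_of_nonneg_right (by positivity))
      rw [hn]
      simp only [Nat.cast_zero, zero_add, Real.sqrt_one, one_pow, mul_one]
      refine h₀ (f 0) B (fun x => le_trans ?_ (hB 0 (Nat.zero_le _) x)) n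
      exact mul_le_mul_of_nonneg_left (pow_le_pow_right₀ (one_le_bracket _) (by omega))
        (norm_nonneg _)
    · refine le_trans ?_ (le_add_of_nonneg_left (by positivity))
      obtain ⟨m, rfl⟩ : ∃ m, n = raiseIndex i m := ⟨_, (raise_lower hn).symm⟩
      have hT := h i _ ((d + 1 + k + 2) * B) hf.ladderSeq (fun a ha x => by
        refine (norm_ladderSeq_mul_le (B := B) fun b hb => hB b (by omega) x).trans ?_
        refine mul_le_mul_of_nonneg_right ?_ hB0
        have : (a : ℝ) ≤ ((d + 1 + k : ℕ) : ℝ) := by exact_mod_cast ha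
        push_cast at this
        linarith) m
      rw [← hf.integral_raise m, norm_smul,
        Real.norm_of_nonneg (mul_nonneg two_pos.le (ladderCoeff_nonneg _))] at hT
      -- With `n = m + e_i`, the claim is `m_i + 2 ≤ 2(m_i + 1)` after squaring.
      have hs₁ : √((raiseIndex i m i : ℕ) + 1 : ℝ) ≤ 2 * ladderCoeff (m i + 1) := by
        refine Real.sqrt_le_iff.2 ⟨mul_nonneg two_pos.le (ladderCoeff_nonneg _), ?_⟩
        rw [mul_pow, ladderCoeff_sq, raiseIndex_apply_self]
        push_cast
        linarith [Nat.cast_nonneg (α := ℝ) (m i)]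
      have hs₂ : √((raiseIndex i m i : ℕ) + 1 : ℝ) ≤ 2 * √(m i + 1) := by
        refine Real.sqrt_le_iff.2 ⟨by positivity, ?_⟩
        rw [mul_pow, Real.sq_sqrt (by positivity), raiseIndex_apply_self]
        push_cast
        linarith [Nat.cast_nonneg (α := ℝ) (m i)]
      set I := ‖∫ x, hermiteFun (raiseIndex i m) x • f 0 x‖
      have hI : 0 ≤ I := norm_nonneg _
      rw [pow_succ]
      calc I * (√((raiseIndex i m i : ℕ) + 1 : ℝ) ^ k * √((raiseIndex i m i : ℕ) + 1 : ℝ))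
          ≤ I * ((2 * √(m i + 1)) ^ k * (2 * ladderCoeff (m i + 1))) := by gcongr
        _ = 2 ^ k * (2 * ladderCoeff (m i + 1) * I * √(m i + 1) ^ k) := by rw [mul_pow]; ring
        _ ≤ 2 ^ k * (C * ((d + 1 + k + 2) * B)) := by gcongr
        _ = _ := by ring

end Directional

/-! ### Hermite coefficients of vector-valued Schwartz functions -/

section Analysis

variable {d : ℕ} {𝕂 : Type*} [RCLike 𝕂] {E : Type*} [AddCommGroup E] [Module 𝕂 E] [Module ℝ E]
  [IsScalarTower ℝ 𝕂 E] [TopologicalSpace E]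

theorem HasPartialDerivAt.hasLineDerivAt_dual {i : Fin d} {f : EuclideanSpace ℝ (Fin d) → E} {e : E}
    {x : EuclideanSpace ℝ (Fin d)} (h : HasPartialDerivAt i f e x) (e' : E →L[𝕂] 𝕂) :
    HasLineDerivAt ℝ (fun x => e' (f x)) (e' e) x (EuclideanSpace.single i 1) := by
  rw [HasLineDerivAt, hasDerivAt_iff_tendsto_slope_zero]
  refine ((e'.continuous.tendsto e).comp h).congr fun t => ?_
  simp only [Function.comp_apply, diffQuot, zero_add, zero_smul, add_zero]
  exact (LinearMap.map_smul_of_tower e'.toLinearMap _ _).trans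
    (congrArg (t⁻¹ • ·) (map_sub e' _ _))

/-- Coefficient decay uses only pure derivatives in one coordinate; this locates them among the
`∂^β` controlled by the Schwartz seminorms. -/
theorem iterPartialDeriv_single (i : Fin d) (a : ℕ) (f : EuclideanSpace ℝ (Fin d) → E) :
    iterPartialDeriv (Pi.single i a) f = (partialDeriv i)^[a] f := by
  have key : ∀ l : List (Fin d), l.Nodup →
      l.foldr (fun j g => (partialDeriv j)^[(Pi.single i a : Fin d → ℕ) j] g) f =
        if i ∈ l then (partialDeriv i)^[a] f else f := by
    intro l
    induction l with
    | nil => simp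
    | cons j l ih =>
      intro hl
      obtain ⟨hj, hl⟩ := List.nodup_cons.1 hl
      rw [List.foldr_cons, ih hl]
      by_cases hij : i = j
      · subst hij
        simp [hj]
      · simp [hij, Ne.symm hij]
  rw [iterPartialDeriv, key _ (List.nodup_finRange d), if_pos (List.mem_finRange i)]

variable [IsTopologicalAddGroup E] [ContinuousSMul 𝕂 E] [T2Space E]

namespace SchwartzSp

@[simp] theorem add_apply (f g : SchwartzSp 𝕂 d E) (x : EuclideanSpace ℝ (Fin d)) :
    (f + g) x = f x + g x := rfl

@[simp] theorem smul_apply (c : 𝕂) (f : SchwartzSp 𝕂 d E) (x : EuclideanSpace ℝ (Fin d)) :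
    (c • f) x = c • f x := rfl

theorem isSmooth (f : SchwartzSp 𝕂 d E) : IsSmooth f := f.1.2

theorem isSmooth_iterate (f : SchwartzSp 𝕂 d E) (i : Fin d) (a : ℕ) :
    IsSmooth ((partialDeriv i)^[a] f) := by
  induction a with
  | zero => exact f.isSmooth
  | succ a ih => rw [Function.iterate_succ_apply']; exact ih.partialDeriv i

theorem hasPartialDerivAt_iterate (f : SchwartzSp 𝕂 d E) (i : Fin d) (a : ℕ)
    (x : EuclideanSpace ℝ (Fin d)) :
    HasPartialDerivAt i ((partialDeriv i)^[a] f) ((partialDeriv i)^[a + 1] f x) x := by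
  obtain ⟨e, he⟩ := (f.isSmooth_iterate i a).exists_hasPartialDerivAt i x
  rw [Function.iterate_succ_apply', he.partialDeriv_eq]
  exact he

theorem seminorm_iterate_le (f : SchwartzSp 𝕂 d E) (p : ContSeminorm 𝕂 E) (i : Fin d) {a m : ℕ}
    (ha : a ≤ m) (x : EuclideanSpace ℝ (Fin d)) :
    p.1 ((partialDeriv i)^[a] f x) * bracket ‖x‖ ^ m ≤ seminorms 𝕂 d E (m, p) f := by
  have h := le_ciSup (f.2 m p) (⟨Pi.single i a, by simpa using ha⟩, x)
  rw [schwartzWeight_eq] at h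
  simp only [iterPartialDeriv_single] at h
  exact h

theorem iterPartialDeriv_zero (f : EuclideanSpace ℝ (Fin d) → E) :
    iterPartialDeriv (0 : Fin d → ℕ) f = f := by
  unfold iterPartialDeriv
  induction List.finRange d with
  | nil => rfl
  | cons i l ih => rw [List.foldr_cons, ih]; rfl

theorem seminorm_apply_le (f : SchwartzSp 𝕂 d E) (p : ContSeminorm 𝕂 E) (m : ℕ)
    (x : EuclideanSpace ℝ (Fin d)) :
    p.1 (f x) * bracket ‖x‖ ^ m ≤ seminorms 𝕂 d E (m, p) f := by
  have h := le_ciSup (f.2 m p) (⟨0, by simp⟩, x)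
  rw [schwartzWeight_eq] at h
  simp only [iterPartialDeriv_zero] at h
  exact h

theorem isDirSchwartz_dual (f : SchwartzSp 𝕂 d E) (i : Fin d) (e' : E →L[𝕂] 𝕂) :
    IsDirSchwartz i fun a x => e' ((partialDeriv i)^[a] f x) where
  cont a := e'.continuous.comp (f.isSmooth_iterate i a 0)
  deriv a x := (f.hasPartialDerivAt_iterate i a x).hasLineDerivAt_dual e'
  decay a m := by
    -- `|e'|` is itself a continuous seminorm of `E`; order `a + m` covers both `a` derivatives and
    -- the weight of order `m`.
    let p : ContSeminorm 𝕂 E := ⟨(normSeminorm 𝕂 𝕂).comp e'.toLinearMap,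
      continuous_norm.comp e'.continuous⟩
    refine ⟨seminorms 𝕂 d E (a + m, p) f, fun x => ?_⟩
    refine le_trans ?_ (f.seminorm_iterate_le p i (Nat.le_add_right a m) x)
    exact mul_le_mul_of_nonneg_left
      (pow_le_pow_right₀ (one_le_bracket _) (Nat.le_add_left m a)) (norm_nonneg _)

end SchwartzSp

/-! ### Lipschitz estimates and Pettis integrability -/

/-- Only coordinate derivatives are available, so `y` is joined to `x` by `d` segments parallel to
the axes, each of length at most `‖x - y‖`, with the mean value inequality on each. -/
theorem norm_sub_le_of_hasLineDerivAt {g : EuclideanSpace ℝ (Fin d) → 𝕂}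
    {g' : Fin d → EuclideanSpace ℝ (Fin d) → 𝕂} {B : ℝ}
    (hg : ∀ i x, HasLineDerivAt ℝ g (g' i x) x (EuclideanSpace.single i 1))
    (hB : ∀ i x, ‖g' i x‖ ≤ B) (x y : EuclideanSpace ℝ (Fin d)) :
    ‖g x - g y‖ ≤ d * ‖x - y‖ * B := by
  have line : ∀ (i : Fin d) (z : EuclideanSpace ℝ (Fin d)) (s : ℝ),
      ‖g (z + s • EuclideanSpace.single i 1) - g z‖ ≤ B * |s| := by
    intro i z s
    have hder : ∀ s : ℝ, HasDerivAt (fun s : ℝ => g (z + s • EuclideanSpace.single i 1))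
        (g' i (z + s • EuclideanSpace.single i 1)) s := by
      intro s
      have h := hg i (z + s • EuclideanSpace.single i 1)
      have h' : HasDerivAt (fun t : ℝ => t - s) 1 s := (hasDerivAt_id s).sub_const s
      rw [HasLineDerivAt, ← sub_self s] at h
      refine (HasDerivAt.scomp (h := fun t => t - s) s h h').congr_deriv (one_smul _ _)
        |>.congr_of_eventuallyEq (Eventually.of_forall fun t => ?_)
      simp only [Function.comp_apply, add_assoc, ← add_smul, add_sub_cancel]
    have hb := Convex.norm_image_sub_le_of_norm_hasDerivWithin_le
      (fun s _ => (hder s).hasDerivWithinAt) (fun s _ => hB i _) convex_univ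
      (Set.mem_univ 0) (Set.mem_univ s)
    simpa using hb
  have key : ∀ s : Finset (Fin d),
      ‖g (y + ∑ i ∈ s, (x - y) i • EuclideanSpace.single i (1 : ℝ)) - g y‖ ≤
        s.card * ‖x - y‖ * B := by
    intro s
    induction s using Finset.cons_induction with
    | empty => simp
    | cons i s hi ih =>
      rw [Finset.sum_cons, add_comm (_ • _), ← add_assoc, Finset.card_cons]
      refine (norm_sub_le_norm_sub_add_norm_sub _
        (g (y + ∑ i ∈ s, (x - y) i • EuclideanSpace.single i (1 : ℝ))) _).trans ?_
      have h := line i (y + ∑ i ∈ s, (x - y) i • EuclideanSpace.single i (1 : ℝ)) ((x - y) i)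
      have hc := PiLp.norm_apply_le (x - y) i
      rw [Real.norm_eq_abs] at hc
      have hB0 : 0 ≤ B := (norm_nonneg _).trans (hB i x)
      push_cast
      nlinarith
  have h := key Finset.univ
  have hsum : ∑ i, (x - y) i • EuclideanSpace.single i (1 : ℝ) = x - y := by
    have := (EuclideanSpace.basisFun (Fin d) ℝ).sum_repr (x - y)
    simpa using this
  rwa [hsum, add_sub_cancel, Finset.card_univ, Fintype.card_fin] at h

variable [PolynormableSpace 𝕂 E]

theorem SchwartzSp.seminorm_sub_le (f : SchwartzSp 𝕂 d E) (p : ContSeminorm 𝕂 E) {m : ℕ}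
    (hm : 1 ≤ m) (x y : EuclideanSpace ℝ (Fin d)) :
    p.1 (f x - f y) ≤ d * ‖x - y‖ * seminorms 𝕂 d E (m, p) f := by
  refine seminorm_le_of_dual p fun e' he' => ?_
  rw [map_sub]
  refine norm_sub_le_of_hasLineDerivAt (g := fun x => e' (f x))
    (fun i x => (f.hasPartialDerivAt_iterate i 0 x).hasLineDerivAt_dual e')
    (fun i x => (he' _).trans ?_) x y
  exact (le_mul_of_one_le_right (apply_nonneg _ _) (one_le_pow₀ (one_le_bracket _))).trans
    (f.seminorm_iterate_le p i hm x)

/-- With `M p = |f|_{d+1,p}`, `f` factors through the associated Banach space as a map `g` that is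
Lipschitz and of order `⟨x⟩^{-(d+1)}`. Thus `h_n g` is Bochner integrable, and the image of its
integral in `E` has the required dual pairings. -/
theorem SchwartzSp.pettisIntegrable (hE : LocallyComplete 𝕂 E) (f : SchwartzSp 𝕂 d E)
    (n : Fin d → ℕ) : PettisIntegrable 𝕂 (fun x => hermiteFun n x • f x) volume := by
  obtain ⟨X, _, _, _, J, hJ, hJp, hX⟩ := hE.exists_banach
    (M := fun p => seminorms 𝕂 d E (d + 1, p) f) fun p => apply_nonneg _ _
  have : ∀ x, ∃ z, J z = f x ∧ ‖z‖ ≤ (bracket ‖x‖ ^ (d + 1))⁻¹ := fun x =>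
    hX _ _ (inv_nonneg.2 (pow_nonneg (bracket_pos _).le _)) fun p => by
      rw [inv_mul_eq_div, le_div_iff₀ (pow_pos (bracket_pos _) _)]
      exact f.seminorm_apply_le p _ x
  choose g hg hgb using this
  have hlip : ∀ x y, ‖g x - g y‖ ≤ d * ‖x - y‖ := by
    intro x y
    obtain ⟨z, hz, hzb⟩ := hX (f x - f y) (d * ‖x - y‖) (by positivity) fun p =>
      f.seminorm_sub_le p (Nat.le_add_left 1 d) x y
    rw [← hg, ← hg, ← map_sub] at hz
    -- Injectivity of the inclusion identifies the vector of controlled norm with `g x - g y`.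
    rwa [← hJ hz]
  have hgc : Continuous g :=
    (LipschitzWith.of_dist_le_mul (K := d) fun x y => by
      simpa [dist_eq_norm] using hlip x y).continuous
  have hint : Integrable fun x => hermiteFun n x • g x := by
    refine integrable_of_decay ((continuous_hermiteFun n).smul hgc)
      (B := 2 ^ d * rapidWeight d d n) fun x => ?_
    have hb := pow_pos (bracket_pos ‖x‖) (d + 1)
    have h₁ := hgb x
    rw [← one_div, le_div_iff₀ hb] at h₁
    rw [norm_smul, Real.norm_eq_abs, mul_assoc]
    exact (mul_le_of_le_one_right (abs_nonneg _) h₁).trans (abs_hermiteFun_le n x)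
  have : ContinuousSMul ℝ E := IsScalarTower.continuousSMul 𝕂
  let L : (E →L[𝕂] 𝕂) → X →L[ℝ] 𝕂 := fun e' =>
    (e'.restrictScalars ℝ).comp ⟨J, continuous_of_seminorm_le J hJp⟩
  have hL : ∀ e' x, L e' (hermiteFun n x • g x) = e' (hermiteFun n x • f x) := fun e' x => by
    change e' (J _) = _
    rw [map_smul, hg]
  refine ⟨fun e' => ?_, J (∫ x, hermiteFun n x • g x), fun e' => ?_⟩
  · exact ((L e').integrable_comp hint).congr (Eventually.of_forall (hL e'))
  · refine ((L e').integral_comp_comm hint).symm.trans ?_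
    simp_rw [hL]

/-! ### Decay of the coefficients -/

theorem SchwartzSp.dual_hermiteCoeff (hE : LocallyComplete 𝕂 E) (f : SchwartzSp 𝕂 d E)
    (n : Fin d → ℕ) (e' : E →L[𝕂] 𝕂) :
    e' (hermiteCoeff 𝕂 f n) = ∫ x, hermiteFun n x • e' (f x) := by
  have h := f.pettisIntegrable hE n
  rw [hermiteCoeff, pettisIntegral, dif_pos h, h.2.choose_spec e']
  congr 1
  ext x
  exact LinearMap.map_smul_of_tower e'.toLinearMap _ _

theorem SchwartzSp.integrable_hermiteFun_smul_dual (hE : LocallyComplete 𝕂 E)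
    (f : SchwartzSp 𝕂 d E) (n : Fin d → ℕ) (e' : E →L[𝕂] 𝕂) :
    Integrable fun x => hermiteFun n x • e' (f x) :=
  ((f.pettisIntegrable hE n).1 e').congr (Eventually.of_forall fun _ =>
    LinearMap.map_smul_of_tower e'.toLinearMap _ _)

/-- Take `i` with `n_i` maximal. Decay in this single direction then controls the full weight. -/
theorem bracket_euclNorm_le (hd : 0 < d) (n : Fin d → ℕ) :
    ∃ i, bracket (euclNorm n) ≤ (d + 1) * (n i + 1) := by
  have : Nonempty (Fin d) := ⟨⟨0, hd⟩⟩
  obtain ⟨i, -, hi⟩ := Finset.exists_max_image Finset.univ n Finset.univ_nonempty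
  refine ⟨i, Real.sqrt_le_iff.2 ⟨by positivity, ?_⟩⟩
  rw [euclNorm_sq]
  have h : ∑ j, (n j : ℝ) ^ 2 ≤ d * (n i : ℝ) ^ 2 := by
    have h := Finset.sum_le_card_nsmul Finset.univ (fun j => (n j : ℝ) ^ 2) ((n i : ℝ) ^ 2)
      fun j hj => pow_le_pow_left₀ (Nat.cast_nonneg _) (by exact_mod_cast hi j hj) 2
    simpa using h
  have h₁ : (0 : ℝ) ≤ n i := Nat.cast_nonneg _
  have h₂ : (0 : ℝ) ≤ d := Nat.cast_nonneg _
  nlinarith [mul_nonneg h₂ h₁, mul_nonneg h₂ (mul_nonneg h₁ h₁), mul_nonneg h₂ (mul_nonneg h₂ h₁),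
    mul_nonneg (mul_nonneg h₂ h₁) (mul_nonneg h₂ h₁), mul_nonneg h₂ h₂]

/-- The scalar estimate is applied to `e' ∘ f` for all `|e'| ≤ p` with the same bound, in the
direction of the largest entry of `n`. It takes `2 * j` ladder steps because each one gains only a
square root. -/
theorem exists_seminorm_hermiteCoeff_le (hE : LocallyComplete 𝕂 E) (hd : 0 < d) (j : ℕ) :
    ∃ C m, ∀ (p : ContSeminorm 𝕂 E) (f : SchwartzSp 𝕂 d E) (n : Fin d → ℕ),
      p.1 (hermiteCoeff 𝕂 f n) * rapidWeight d j n ≤ C * SchwartzSp.seminorms 𝕂 d E (m, p) f := by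
  obtain ⟨C, hC, h⟩ := exists_norm_integral_hermiteFun_mul_le d 𝕂 (2 * j)
  refine ⟨(d + 1) ^ j * C, d + 1 + 2 * j, fun p f n => ?_⟩
  obtain ⟨i, hi⟩ := bracket_euclNorm_le hd n
  have hp : p.1 (hermiteCoeff 𝕂 f n) * √(n i + 1) ^ (2 * j) ≤
      C * SchwartzSp.seminorms 𝕂 d E (d + 1 + 2 * j, p) f := by
    rw [← le_div_iff₀ (by positivity)]
    refine seminorm_le_of_dual p fun e' he' => ?_
    rw [le_div_iff₀ (by positivity), f.dual_hermiteCoeff hE]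
    refine h i _ _ (f.isDirSchwartz_dual i e') (fun a ha x => ?_) n
    exact (mul_le_mul_of_nonneg_right (he' _) (pow_nonneg (bracket_pos _).le _)).trans
      (f.seminorm_iterate_le p i ha x)
  rw [pow_mul, Real.sq_sqrt (by positivity)] at hp
  rw [rapidWeight_eq]
  calc p.1 (hermiteCoeff 𝕂 f n) * bracket (euclNorm n) ^ j
      ≤ p.1 (hermiteCoeff 𝕂 f n) * ((d + 1) * (n i + 1)) ^ j :=
        mul_le_mul_of_nonneg_left (pow_le_pow_left₀ (bracket_pos _).le hi j) (apply_nonneg _ _)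
    _ = (d + 1) ^ j * (p.1 (hermiteCoeff 𝕂 f n) * (n i + 1) ^ j) := by rw [mul_pow]; ring
    _ ≤ (d + 1) ^ j * (C * SchwartzSp.seminorms 𝕂 d E (d + 1 + 2 * j, p) f) := by gcongr
    _ = _ := (mul_assoc _ _ _).symm

/-- The coefficient map `f ↦ (f^(n))_n` as a linear map. -/
noncomputable def analysisₗ (hE : LocallyComplete 𝕂 E) (hd : 0 < d) :
    SchwartzSp 𝕂 d E →ₗ[𝕂] RapidSp 𝕂 d E where
  toFun f := ⟨hermiteCoeff 𝕂 f, fun j p => by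
    obtain ⟨C, m, h⟩ := exists_seminorm_hermiteCoeff_le (𝕂 := 𝕂) hE hd j
    refine ⟨C * SchwartzSp.seminorms 𝕂 d E (m, p) f, ?_⟩
    rintro _ ⟨n, rfl⟩
    exact h p f n⟩
  map_add' f g := DFunLike.ext _ _ fun n => eq_of_dual (𝕂 := 𝕂) fun e' => by
    change e' (hermiteCoeff 𝕂 (f + g) n) = e' (hermiteCoeff 𝕂 f n + hermiteCoeff 𝕂 g n)
    rw [map_add]
    simp only [SchwartzSp.dual_hermiteCoeff hE, SchwartzSp.add_apply, map_add, smul_add]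
    exact integral_add (f.integrable_hermiteFun_smul_dual hE n e')
      (g.integrable_hermiteFun_smul_dual hE n e')
  map_smul' c f := DFunLike.ext _ _ fun n => eq_of_dual (𝕂 := 𝕂) fun e' => by
    change e' (hermiteCoeff 𝕂 (c • f) n) = e' (c • hermiteCoeff 𝕂 f n)
    rw [map_smul]
    simp only [SchwartzSp.dual_hermiteCoeff hE, SchwartzSp.smul_apply, map_smul,
      smul_comm (hermiteFun n _) c]
    exact integral_smul _ _

/-- The coefficient map `f ↦ (f^(n))_n` from `S(ℝ^d, E)` to `s(ℕ₀^d, E)`. -/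
noncomputable def analysis (hE : LocallyComplete 𝕂 E) (hd : 0 < d) :
    SchwartzSp 𝕂 d E →L[𝕂] RapidSp 𝕂 d E where
  toLinearMap := analysisₗ hE hd
  cont := by
    refine continuous_of_seminorm_bound (SchwartzSp.withSeminorms 𝕂 d E)
      (RapidSp.withSeminorms 𝕂 d E) _ ?_
    rintro ⟨j, p⟩
    obtain ⟨C, m, h⟩ := exists_seminorm_hermiteCoeff_le (𝕂 := 𝕂) hE hd j
    exact ⟨(m, p), C, fun f => ciSup_le (h p f)⟩

theorem analysis_apply (hE : LocallyComplete 𝕂 E) (hd : 0 < d) (f : SchwartzSp 𝕂 d E)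
    (n : Fin d → ℕ) : analysis hE hd f n = hermiteCoeff 𝕂 f n := rfl

end Analysis

/-! ### Completeness of the Hermite functions -/

section Completeness

open scoped FourierTransform

variable {d : ℕ}

theorem hermiteFun_zero (x : EuclideanSpace ℝ (Fin d)) :
    hermiteFun 0 x = ((√Real.pi) ^ (-(1 / 2) : ℝ)) ^ d * Real.exp (-‖x‖ ^ 2 / 2) := by
  have h : ∀ k, hermiteFun₁ ((0 : Fin d → ℕ) k) (x k) =
      (√Real.pi) ^ (-(1 / 2) : ℝ) * Real.exp (-(x k) ^ 2 / 2) := fun k => by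
    simp [hermiteFun₁, hermitePoly]
  rw [hermiteFun, Finset.prod_congr rfl fun k _ => h k, Finset.prod_mul_distrib,
    ← Real.exp_sum, EuclideanSpace.real_norm_sq_eq]
  simp [← Finset.sum_div]

theorem hermiteFun_zero_pos (x : EuclideanSpace ℝ (Fin d)) : 0 < hermiteFun 0 x := by
  rw [hermiteFun_zero]
  have := Real.pi_pos
  positivity

theorem integrable_inner_pow_mul_hermiteFun {u : EuclideanSpace ℝ (Fin d) → ℝ} (hu : Continuous u)
    (hdecay : ∀ m, ∃ B, ∀ x, ‖u x‖ * bracket ‖x‖ ^ m ≤ B) (ξ : EuclideanSpace ℝ (Fin d)) (k : ℕ)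
    (n : Fin d → ℕ) : Integrable fun x => inner ℝ ξ x ^ k * (hermiteFun n x * u x) := by
  obtain ⟨B, hB⟩ := hdecay (k + (d + 1))
  have hc : Continuous fun x => inner ℝ ξ x ^ k * (hermiteFun n x * u x) :=
    ((continuous_const.inner continuous_id).pow k).mul ((continuous_hermiteFun n).mul hu)
  refine integrable_of_decay hc (B := ‖ξ‖ ^ k * (2 ^ d * rapidWeight d d n) * B) fun x => ?_
  rw [norm_mul, norm_mul, norm_pow]
  have h₁ : ‖(inner ℝ ξ x : ℝ)‖ ≤ ‖ξ‖ * bracket ‖x‖ := (norm_inner_le_norm ξ x).trans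
    (mul_le_mul_of_nonneg_left ((le_abs_self _).trans (abs_le_bracket _)) (norm_nonneg _))
  have h₂ : ‖hermiteFun n x‖ ≤ _ := abs_hermiteFun_le n x
  have hb := bracket_pos ‖x‖
  have hr := rapidWeight_pos d n
  calc ‖(inner ℝ ξ x : ℝ)‖ ^ k * (‖hermiteFun n x‖ * ‖u x‖) * bracket ‖x‖ ^ (d + 1)
      ≤ (‖ξ‖ * bracket ‖x‖) ^ k * (2 ^ d * rapidWeight d d n * ‖u x‖) * bracket ‖x‖ ^ (d + 1) := by
        gcongr
    _ = ‖ξ‖ ^ k * (2 ^ d * rapidWeight d d n) * (‖u x‖ * bracket ‖x‖ ^ (k + (d + 1))) := by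
        rw [mul_pow, pow_add]; ring
    _ ≤ _ := by
        refine mul_le_mul_of_nonneg_left (hB x) ?_
        positivity

/-- Multiplying `h_n` by `x_i` gives a combination of neighbouring Hermite functions, so vanishing
for all `n` passes from `k` to `k + 1`. -/
theorem integral_inner_pow_mul_hermiteFun_eq_zero {u : EuclideanSpace ℝ (Fin d) → ℝ}
    (hu : Continuous u) (hdecay : ∀ m, ∃ B, ∀ x, ‖u x‖ * bracket ‖x‖ ^ m ≤ B)
    (h0 : ∀ n, ∫ x, hermiteFun n x * u x = 0) (ξ : EuclideanSpace ℝ (Fin d)) (k : ℕ)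
    (n : Fin d → ℕ) : ∫ x, inner ℝ ξ x ^ k * (hermiteFun n x * u x) = 0 := by
  induction k generalizing n with
  | zero => simpa using h0 n
  | succ k ih =>
    have I := integrable_inner_pow_mul_hermiteFun hu hdecay ξ k
    have e : ∀ x, inner ℝ ξ x ^ (k + 1) * (hermiteFun n x * u x) =
        ∑ i, ξ i * (ladderCoeff (n i) * (inner ℝ ξ x ^ k * (hermiteFun (lowerIndex i n) x * u x)) +
          ladderCoeff (n i + 1) * (inner ℝ ξ x ^ k * (hermiteFun (raiseIndex i n) x * u x))) := by
      intro x
      have h : ∀ i, ξ i * (ladderCoeff (n i) *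
          (inner ℝ ξ x ^ k * (hermiteFun (lowerIndex i n) x * u x)) +
          ladderCoeff (n i + 1) * (inner ℝ ξ x ^ k * (hermiteFun (raiseIndex i n) x * u x))) =
          (ξ i * x i) * (inner ℝ ξ x ^ k * (hermiteFun n x * u x)) := fun i => by
        linear_combination (-ξ i * inner ℝ ξ x ^ k * u x) * coord_mul_hermiteFun i n x
      simp_rw [h]
      rw [← Finset.sum_mul, pow_succ']
      have : (inner ℝ ξ x : ℝ) = ∑ i, ξ i * x i := by
        simp [PiLp.inner_apply, mul_comm]
      rw [← this, mul_assoc]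
    have I₂ : ∀ i, Integrable fun x => ξ i *
        (ladderCoeff (n i) * (inner ℝ ξ x ^ k * (hermiteFun (lowerIndex i n) x * u x)) +
          ladderCoeff (n i + 1) * (inner ℝ ξ x ^ k * (hermiteFun (raiseIndex i n) x * u x))) :=
      fun i => (((I (lowerIndex i n)).const_mul _).add
        ((I (raiseIndex i n)).const_mul _)).const_mul _
    simp_rw [e]
    rw [integral_finsetSum _ fun i _ => I₂ i]
    refine Finset.sum_eq_zero fun i _ => ?_
    rw [integral_const_mul, integral_add ((I (lowerIndex i n)).const_mul _)
      ((I (raiseIndex i n)).const_mul _), integral_const_mul, integral_const_mul, ih, ih]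
    simp

/-- `|⟨ξ, x⟩| ≤ (|ξ|² + |x|²) / 2`: the Gaussian in `h_0` absorbs the exponential, providing a
majorant for the exponential series. -/
theorem exp_abs_inner_mul_hermiteFun_zero_le (ξ x : EuclideanSpace ℝ (Fin d)) :
    Real.exp |inner ℝ ξ x| * hermiteFun 0 x ≤
      ((√Real.pi) ^ (-(1 / 2) : ℝ)) ^ d * Real.exp (‖ξ‖ ^ 2 / 2) := by
  rw [hermiteFun_zero, mul_left_comm, ← Real.exp_add]
  have := Real.pi_pos
  gcongr
  have h := abs_real_inner_le_norm ξ x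
  nlinarith [sq_nonneg (‖ξ‖ - ‖x‖)]

/-- Expand the exponential and integrate termwise; every term is a vanishing moment of `h_0 u`. -/
theorem integral_exp_inner_mul_hermiteFun_eq_zero {u : EuclideanSpace ℝ (Fin d) → ℝ}
    (hu : Continuous u) (hdecay : ∀ m, ∃ B, ∀ x, ‖u x‖ * bracket ‖x‖ ^ m ≤ B)
    (h0 : ∀ n, ∫ x, hermiteFun n x * u x = 0) (ξ : EuclideanSpace ℝ (Fin d)) :
    ∫ x, Complex.exp (inner ℝ ξ x * Complex.I) * ((hermiteFun 0 x * u x : ℝ) : ℂ) = 0 := by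
  set F : ℕ → EuclideanSpace ℝ (Fin d) → ℂ := fun k x =>
    (Complex.I ^ k / (k ! : ℂ)) * ((inner ℝ ξ x ^ k * (hermiteFun 0 x * u x) : ℝ) : ℂ) with hF
  have hFint : ∀ k, ∫ x, F k x = 0 := fun k => by
    rw [hF, integral_const_mul, integral_complex_ofReal,
      integral_inner_pow_mul_hermiteFun_eq_zero hu hdecay h0]
    simp
  have hFc : ∀ k, Continuous (F k) := fun k =>
    continuous_const.mul (Complex.continuous_ofReal.comp
      (((continuous_const.inner continuous_id).pow k).mul ((continuous_hermiteFun 0).mul hu)))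
  have hsum : ∀ x, HasSum
      (fun k : ℕ => |inner ℝ ξ x| ^ k / (k ! : ℝ) * (hermiteFun 0 x * |u x|))
      (Real.exp |inner ℝ ξ x| * (hermiteFun 0 x * |u x|)) := fun x => by
    refine HasSum.mul_right _ ?_
    rw [Real.exp_eq_exp_ℝ]
    exact NormedSpace.expSeries_div_hasSum_exp _
  have h := hasSum_integral_of_dominated_convergence (μ := volume) (F := F)
    (f := fun x => Complex.exp (inner ℝ ξ x * Complex.I) * ((hermiteFun 0 x * u x : ℝ) : ℂ))
    (fun k x => |inner ℝ ξ x| ^ k / (k ! : ℝ) * (hermiteFun 0 x * |u x|))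
    (fun k => (hFc k).aestronglyMeasurable)
    (fun k => Eventually.of_forall fun x => by
      rw [hF]
      simp only [norm_mul, norm_div, norm_pow, Complex.norm_I, one_pow, Complex.norm_real,
        Complex.norm_natCast, Real.norm_eq_abs]
      rw [abs_of_pos (hermiteFun_zero_pos x)]
      exact le_of_eq (by ring))
    (Eventually.of_forall fun x => (hsum x).summable)
    (by
      simp_rw [fun x => (hsum x).tsum_eq]
      obtain ⟨B, hB⟩ := hdecay (d + 1)
      refine integrable_of_decay (B := ((√Real.pi) ^ (-(1 / 2) : ℝ)) ^ d *
        Real.exp (‖ξ‖ ^ 2 / 2) * B) ?_ fun x => ?_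
      · exact (Real.continuous_exp.comp (continuous_const.inner continuous_id).abs).mul
          ((continuous_hermiteFun 0).mul hu.abs)
      · have h₁ := exp_abs_inner_mul_hermiteFun_zero_le ξ x
        have h₂ := hermiteFun_zero_pos x
        have hb := bracket_pos ‖x‖
        rw [Real.norm_of_nonneg (by positivity), ← mul_assoc, mul_assoc]
        have := Real.pi_pos
        exact mul_le_mul h₁ (hB x) (by positivity) (by positivity))
    (Eventually.of_forall fun x => by
      have hx : HasSum (fun k : ℕ => ((inner ℝ ξ x : ℂ) * Complex.I) ^ k / (k ! : ℂ))
          (Complex.exp (inner ℝ ξ x * Complex.I)) := by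
        rw [Complex.exp_eq_exp_ℂ]
        exact NormedSpace.expSeries_div_hasSum_exp _
      refine (hx.mul_right ((hermiteFun 0 x * u x : ℝ) : ℂ)).congr_fun fun k => ?_
      rw [hF]
      push_cast
      ring)
  simp_rw [hFint] at h
  exact h.unique hasSum_zero

/-- The Fourier transform of the continuous integrable function `h_0 u` vanishes, so Fourier
inversion gives `h_0 u = 0`, and `h_0 > 0`. -/
theorem eq_zero_of_integral_hermiteFun_mul_eq_zero {u : EuclideanSpace ℝ (Fin d) → ℝ}
    (hu : Continuous u) (hdecay : ∀ m, ∃ B, ∀ x, ‖u x‖ * bracket ‖x‖ ^ m ≤ B)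
    (h0 : ∀ n, ∫ x, hermiteFun n x * u x = 0) (x : EuclideanSpace ℝ (Fin d)) : u x = 0 := by
  set g : EuclideanSpace ℝ (Fin d) → ℂ := fun x => ((hermiteFun 0 x * u x : ℝ) : ℂ) with hg
  have hgc : Continuous g := Complex.continuous_ofReal.comp ((continuous_hermiteFun 0).mul hu)
  have hgi : Integrable g := by
    have := integrable_inner_pow_mul_hermiteFun hu hdecay 0 0 0
    simp only [pow_zero, one_mul] at this
    exact this.ofReal
  have hF : 𝓕 g = 0 := by
    ext w
    rw [Real.fourier_eq']
    -- The frequency `-2πw` matches the normalization of the Fourier integral.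
    have h := integral_exp_inner_mul_hermiteFun_eq_zero hu hdecay h0 ((-2 * Real.pi) • w)
    rw [Pi.zero_apply, ← h]
    congr 1
    ext v
    rw [smul_eq_mul, real_inner_smul_left, real_inner_comm]
  have h := hgc.fourierInv_fourier_eq hgi (by rw [hF]; exact integrable_zero _ _ _)
  have hx := congrFun h x
  rw [hF, Real.fourierInv_eq'] at hx
  simp only [Pi.zero_apply, smul_zero, integral_zero] at hx
  have hx' : hermiteFun 0 x * u x = 0 := Complex.ofReal_eq_zero.1 hx.symm
  exact (mul_eq_zero.1 hx').resolve_left (hermiteFun_zero_pos x).ne'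

theorem eq_zero_of_integral_hermiteFun_smul_eq_zero {𝕂 : Type*} [RCLike 𝕂]
    {g : EuclideanSpace ℝ (Fin d) → 𝕂} (hg : Continuous g)
    (hdecay : ∀ m, ∃ B, ∀ x, ‖g x‖ * bracket ‖x‖ ^ m ≤ B)
    (h0 : ∀ n, ∫ x, hermiteFun n x • g x = 0) (x : EuclideanSpace ℝ (Fin d)) : g x = 0 := by
  have hint : ∀ n, Integrable fun x => hermiteFun n x • g x := fun n => by
    obtain ⟨B, hB⟩ := hdecay (d + 2)
    exact integrable_smul_of_decay hg hB (continuous_hermiteFun n) fun x =>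
      (abs_hermiteFun_le n x).trans (le_mul_of_one_le_right
        (mul_nonneg (by positivity) (rapidWeight_pos _ _).le) (one_le_bracket _))
  have key : ∀ L : 𝕂 →L[ℝ] ℝ, (∀ z, ‖L z‖ ≤ ‖z‖) → L (g x) = 0 := by
    intro L hL
    refine eq_zero_of_integral_hermiteFun_mul_eq_zero (u := fun x => L (g x))
      (L.continuous.comp hg) (fun m => ?_) (fun n => ?_) x
    · obtain ⟨B, hB⟩ := hdecay m
      exact ⟨B, fun x => (mul_le_mul_of_nonneg_right (hL _)
        (pow_nonneg (bracket_pos _).le _)).trans (hB x)⟩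
    · have h := L.integral_comp_comm (hint n)
      rw [h0, map_zero] at h
      simpa using h
  refine RCLike.ext ?_ ?_
  · rw [map_zero]; exact key RCLike.reCLM RCLike.norm_re_le_norm
  · rw [map_zero]; exact key RCLike.imCLM RCLike.norm_im_le_norm

end Completeness

/-! ### Hermite expansion -/

section Expansion

variable {d : ℕ} {𝕂 : Type*} [RCLike 𝕂] {E : Type*} [AddCommGroup E] [Module 𝕂 E] [Module ℝ E]
  [IsScalarTower ℝ 𝕂 E] [TopologicalSpace E] [IsTopologicalAddGroup E] [ContinuousSMul 𝕂 E]
  [T2Space E] [PolynormableSpace 𝕂 E]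

/-- Orthonormality after exchanging sum and integral, tested on functionals. The exchange is allowed
since `∫ |h_n h_m| ≤ 1` and `∑ |e'(x_m)| < ∞`. -/
theorem analysis_synthesis (hE : LocallyComplete 𝕂 E) (hd : 0 < d) (x : RapidSp 𝕂 d E) :
    analysis hE hd (synthesis d hE x) = x := by
  refine DFunLike.ext _ _ fun n => eq_of_dual (𝕂 := 𝕂) fun e' => ?_
  rw [analysis_apply, SchwartzSp.dual_hermiteCoeff hE]
  let p : ContSeminorm 𝕂 E := ⟨(normSeminorm 𝕂 𝕂).comp e'.toLinearMap,
    continuous_norm.comp e'.continuous⟩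
  have hsum : Summable fun m => ‖e' (x m)‖ := by
    have := x.summable_mul_seminorm_apply p (c := fun _ => 1) (C := 1) (k := 0) fun n => by
      simpa using one_le_rapidWeight 0 n
    simp only [abs_one, one_mul] at this
    exact this
  set F : (Fin d → ℕ) → EuclideanSpace ℝ (Fin d) → 𝕂 := fun m t =>
    (hermiteFun n t * hermiteFun m t) • e' (x m)
  have hFi : ∀ m, Integrable (F m) := fun m => (integrable_hermiteFun_mul n m).smul_const _
  have hFn : ∀ m, ∫ t, ‖F m t‖ ≤ ‖e' (x m)‖ := fun m => by
    have h₁ := integrable_hermiteFun_mul n n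
    have h₂ := integrable_hermiteFun_mul m m
    have h : ∀ t, ‖F m t‖ ≤ (hermiteFun n t * hermiteFun n t + hermiteFun m t * hermiteFun m t) *
        (‖e' (x m)‖ / 2) := fun t => by
      have h := two_mul_le_add_sq |hermiteFun n t| |hermiteFun m t|
      rw [sq_abs, sq_abs] at h
      calc ‖F m t‖ = 2 * |hermiteFun n t| * |hermiteFun m t| * (‖e' (x m)‖ / 2) := by
            rw [norm_smul, Real.norm_eq_abs, abs_mul]; ring
        _ ≤ (hermiteFun n t ^ 2 + hermiteFun m t ^ 2) * (‖e' (x m)‖ / 2) := by gcongr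
        _ = _ := by ring
    refine (integral_mono (hFi m).norm ((h₁.add h₂).mul_const _) h).trans ?_
    simp only [Pi.add_apply]
    rw [integral_mul_const, integral_add h₁ h₂, integral_hermiteFun_mul, integral_hermiteFun_mul,
      if_pos rfl, if_pos rfl]
    linarith
  have h := hasSum_integral_of_summable_integral_norm hFi
    (Summable.of_nonneg_of_le (fun m => integral_nonneg fun t => norm_nonneg _) hFn hsum)
  have e₁ : ∀ m, ∫ t, F m t = if m = n then e' (x n) else 0 := fun m => by
    rw [integral_smul_const, integral_hermiteFun_mul]
    rcases eq_or_ne m n with rfl | hmn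
    · simp
    · simp [hmn, hmn.symm]
  have e₂ : ∀ t, ∑' m, F m t = hermiteFun n t • e' (synthesis d hE x t) := fun t => by
    refine HasSum.tsum_eq ?_
    refine (((hasSum_hermiteSeries hE x t).mapL e').const_smul (hermiteFun n t)).congr_fun
      fun m => ?_
    refine (mul_smul _ _ _).trans ?_
    exact congrArg _ (LinearMap.map_smul_of_tower e'.toLinearMap _ _).symm
  simp_rw [e₁, e₂] at h
  exact h.unique (hasSum_ite_eq n _)

/-- The difference `g` has zero coefficients by `analysis_synthesis`, so every `e' ∘ g` vanishes by
completeness of the Hermite functions. -/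
theorem synthesis_analysis (hE : LocallyComplete 𝕂 E) (hd : 0 < d) (f : SchwartzSp 𝕂 d E) :
    synthesis d hE (analysis hE hd f) = f := by
  set g := synthesis d hE (analysis hE hd f) - f with hg
  have hg0 : analysis hE hd g = 0 := by
    rw [hg, map_sub, analysis_synthesis, sub_self]
  rw [← sub_eq_zero, ← hg]
  refine DFunLike.ext _ _ fun x => eq_of_dual (𝕂 := 𝕂) fun e' => ?_
  -- The choice of direction is irrelevant: only continuity and decay of `e' ∘ g` are read off.
  have hdir := g.isDirSchwartz_dual ⟨0, hd⟩ e'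
  have h := eq_zero_of_integral_hermiteFun_smul_eq_zero (hdir.cont 0) (hdir.decay 0) (fun n => ?_) x
  · exact h.trans (map_zero e').symm
  · refine (g.dual_hermiteCoeff hE n e').symm.trans ?_
    rw [← analysis_apply hE hd, hg0]
    exact map_zero e'

/-- The coefficient map `S(ℝ^d, E) → s(ℕ₀^d, E)` is a topological isomorphism. -/
noncomputable def coeffEquiv (hE : LocallyComplete 𝕂 E) (hd : 0 < d) :
    SchwartzSp 𝕂 d E ≃L[𝕂] RapidSp 𝕂 d E :=
  ContinuousLinearEquiv.equivOfInverse (analysis hE hd) (synthesis d hE)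
    (synthesis_analysis hE hd) (analysis_synthesis hE hd)

end Expansion

/-! ### Unit vectors in the space of rapidly decreasing sequences -/

section UnitVectors

variable {d : ℕ} {𝕂 : Type*} [RCLike 𝕂] {E : Type*} [AddCommGroup E] [Module 𝕂 E]
  [TopologicalSpace E]

namespace RapidSp

variable (𝕂 E) in
/-- The inclusion of `E` into `s(ℕ₀^d, E)` at the index `n`. -/
noncomputable def single (n : Fin d → ℕ) : E →ₗ[𝕂] RapidSp 𝕂 d E where
  toFun e := ⟨fun m => if m = n then e else 0, fun j p => by
    refine ⟨p.1 e * rapidWeight d j n, ?_⟩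
    rintro _ ⟨m, rfl⟩
    have := mul_nonneg (apply_nonneg p.1 e) (rapidWeight_pos j n).le
    dsimp only
    split_ifs with h
    · rw [h]
    · simpa using this⟩
  map_add' a b := DFunLike.ext _ _ fun m => by
    change (if m = n then a + b else 0) = (if m = n then a else 0) + if m = n then b else 0
    split_ifs <;> simp
  map_smul' c a := DFunLike.ext _ _ fun m => by
    change (if m = n then c • a else 0) = c • if m = n then a else 0
    split_ifs <;> simp

theorem single_apply (n m : Fin d → ℕ) (e : E) : single 𝕂 E n e m = if m = n then e else 0 := rfl

theorem sum_apply {ι : Type*} (s : Finset ι) (x : ι → RapidSp 𝕂 d E) (m : Fin d → ℕ) :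
    (∑ i ∈ s, x i) m = ∑ i ∈ s, x i m :=
  map_sum ({ toFun := fun x => x m, map_zero' := rfl, map_add' := fun _ _ => rfl } :
    RapidSp 𝕂 d E →+ E) x s

theorem sum_single_apply (s : Finset (Fin d → ℕ)) (x : RapidSp 𝕂 d E) (m : Fin d → ℕ) :
    (∑ n ∈ s, single 𝕂 E n (x n)) m = if m ∈ s then x m else 0 := by
  rw [sum_apply]
  simp only [single_apply]
  exact Finset.sum_ite_eq s m x

theorem single_eq_smul (n : Fin d → ℕ) (a : 𝕂) : single 𝕂 𝕂 n a = a • single 𝕂 𝕂 n 1 := by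
  rw [← map_smul, smul_eq_mul, mul_one]

theorem eventually_mul_inv_rapidWeight_le (M : ℝ) {ε : ℝ} (hε : 0 < ε) :
    ∀ᶠ n : Fin d → ℕ in cofinite, M * (rapidWeight d (2 * d) n)⁻¹ ≤ ε :=
  (((summable_inv_rapidWeight (d := d)).mul_left M).tendsto_cofinite_zero.eventually_lt_const
    hε).mono fun _ h => h.le

/-- Outside a finite set the weight of order `2 * d` beats `M / ε`. Uniformity over a bounded set of
the higher seminorm is what gives uniform convergence on compact sets later. -/
theorem eventually_seminorms_sub_sum_single_le (p : ContSeminorm 𝕂 E) (j : ℕ) (M : ℝ) {ε : ℝ}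
    (hε : 0 < ε) : ∀ᶠ s : Finset (Fin d → ℕ) in atTop, ∀ x : RapidSp 𝕂 d E,
      seminorms 𝕂 d E (j + 2 * d, p) x ≤ M →
        seminorms 𝕂 d E (j, p) (x - ∑ n ∈ s, single 𝕂 E n (x n)) ≤ ε := by
  have h := eventually_mul_inv_rapidWeight_le (d := d) M hε
  rw [eventually_cofinite] at h
  filter_upwards [eventually_ge_atTop h.toFinset] with s hs x hx
  refine seminorms_le fun n => ?_
  rw [sub_apply, sum_single_apply]
  split_ifs with hn
  · simpa using hε.le
  · have hn' : M * (rapidWeight d (2 * d) n)⁻¹ ≤ ε := by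
      by_contra hc
      exact hn (hs (h.mem_toFinset.2 hc))
    refine le_trans ?_ hn'
    rw [sub_zero, ← div_eq_mul_inv, le_div_iff₀ (rapidWeight_pos _ n), mul_assoc,
      ← rapidWeight_add]
    exact (x.weight_mul_le _ p n).trans hx

theorem hasSum_single (x : RapidSp 𝕂 d E) : HasSum (fun n => single 𝕂 E n (x n)) x := by
  refine ((withSeminorms 𝕂 d E).tendsto_nhds _ _).2 fun a ε hε => ?_
  filter_upwards [eventually_seminorms_sub_sum_single_le (𝕂 := 𝕂) (d := d) a.2 a.1
    (seminorms 𝕂 d E (a.1 + 2 * d, a.2) x) (half_pos hε)] with s hs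
  rw [map_sub_rev]
  exact (hs x le_rfl).trans_lt (half_lt_self hε)

variable (𝕂 E) in
/-- The projection of `s(ℕ₀^d, E)` onto the `n`-th coordinate axis. -/
noncomputable def coordProj (n : Fin d → ℕ) :
    RapidSp 𝕂 d E →L[𝕂] RapidSp 𝕂 d E where
  toFun x := single 𝕂 E n (x n)
  map_add' x y := map_add (single 𝕂 E n) (x n) (y n)
  map_smul' c x := map_smul (single 𝕂 E n) c (x n)
  cont := by
    refine continuous_of_seminorm_bound (withSeminorms 𝕂 d E) (withSeminorms 𝕂 d E)
      ({ toFun := fun x => single 𝕂 E n (x n)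
         map_add' := fun x y => map_add (single 𝕂 E n) (x n) (y n)
         map_smul' := fun c x => map_smul (single 𝕂 E n) c (x n) } :
        RapidSp 𝕂 d E →ₗ[𝕂] RapidSp 𝕂 d E) fun a => ⟨a, 1, fun x => seminorms_le fun m => ?_⟩
    rw [one_mul]
    refine le_trans ?_ (x.weight_mul_le a.1 a.2 m)
    change a.2.1 (single 𝕂 E n (x n) m) * _ ≤ _
    rw [single_apply]
    split_ifs with h
    · rw [h]
    · rw [map_zero, zero_mul]
      exact mul_nonneg (apply_nonneg _ _) (rapidWeight_pos _ _).le

theorem coordProj_apply (n : Fin d → ℕ) (x : RapidSp 𝕂 d E) :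
    coordProj 𝕂 E n x = single 𝕂 E n (x n) := rfl

end RapidSp

end UnitVectors

/-! ### Functionals on the space of rapidly decreasing sequences -/

section Dual

variable {d : ℕ} {𝕂 : Type*} [RCLike 𝕂]

variable (𝕂) in
/-- The absolute value of `𝕂` as a continuous seminorm. -/
noncomputable def absSeminorm : ContSeminorm 𝕂 𝕂 := ⟨normSeminorm 𝕂 𝕂, continuous_norm⟩

theorem absSeminorm_apply (a : 𝕂) : (absSeminorm 𝕂).1 a = ‖a‖ := rfl

namespace RapidSp

theorem continuous_seminorms {E : Type*} [AddCommGroup E] [Module 𝕂 E] [TopologicalSpace E]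
    (j : ℕ) (p : ContSeminorm 𝕂 E) : Continuous (seminorms 𝕂 d E (j, p)) :=
  (withSeminorms 𝕂 d E).continuous_seminorm (j, p)

/-- Every seminorm on `𝕂` is a multiple of the absolute value and the weights increase with the
order, so finitely many defining seminorms are dominated by one norm. -/
theorem exists_le_mul_seminorms {q : Seminorm 𝕂 (RapidSp 𝕂 d 𝕂)} (hq : Continuous q) :
    ∃ (j : ℕ) (C : ℝ), 0 ≤ C ∧ ∀ z, q z ≤ C * seminorms 𝕂 d 𝕂 (j, absSeminorm 𝕂) z := by
  obtain ⟨s, C, -, h⟩ := Seminorm.bound_of_continuous (withSeminorms 𝕂 d 𝕂) q hq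
  have hA : 0 ≤ ∑ i ∈ s, i.2.1 1 := Finset.sum_nonneg fun i _ => apply_nonneg _ _
  refine ⟨s.sup Prod.fst, C * ∑ i ∈ s, i.2.1 1, by positivity, fun z => (h z).trans ?_⟩
  rw [mul_assoc]
  refine mul_le_mul_of_nonneg_left (Seminorm.finset_sup_apply_le
    (mul_nonneg hA (apply_nonneg _ _)) fun i hi => seminorms_le fun n => ?_) C.2
  have h₁ : i.2.1 (z n) = ‖z n‖ * i.2.1 1 := by
    rw [← map_smul_eq_mul, smul_eq_mul, mul_one]
  have h₂ : i.2.1 1 ≤ ∑ i ∈ s, i.2.1 1 :=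
    Finset.single_le_sum (f := fun i : ℕ × ContSeminorm 𝕂 𝕂 => i.2.1 1)
      (fun i _ => apply_nonneg _ _) hi
  have h₃ := z.weight_mul_le (s.sup Prod.fst) (absSeminorm 𝕂) n
  rw [h₁, mul_comm ‖z n‖, mul_assoc]
  refine mul_le_mul h₂ (le_trans (mul_le_mul_of_nonneg_left
    (rapidWeight_mono (Finset.le_sup (f := Prod.fst) hi) n) (norm_nonneg _)) h₃)
    (mul_nonneg (norm_nonneg _) (rapidWeight_pos _ _).le) hA

theorem equicontinuous_iff_exists_bound {H : Set (KappaDual 𝕂 (RapidSp 𝕂 d 𝕂))} :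
    (Equicontinuous fun (y : H) (z : RapidSp 𝕂 d 𝕂) => y.1 z) ↔
      ∃ (j : ℕ) (C : ℝ), 0 ≤ C ∧ ∀ y ∈ H, ∀ z, ‖y z‖ ≤
        C * seminorms 𝕂 d 𝕂 (j, absSeminorm 𝕂) z := by
  let : UniformSpace (RapidSp 𝕂 d 𝕂) := IsTopologicalAddGroup.rightUniformSpace _
  have : IsUniformAddGroup (RapidSp 𝕂 d 𝕂) := isUniformAddGroup_of_addCommGroup
  have h := ((norm_withSeminorms 𝕂 𝕂).equicontinuous_TFAE fun y : H =>
    ((UniformConvergenceCLM.ofFun (RingHom.id 𝕂) 𝕂 _).symm y.1).toLinearMap).out 1 3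
  refine h.trans ⟨fun h => ?_, ?_⟩
  · obtain ⟨q, hq, hb⟩ := h 0
    obtain ⟨j, C, hC, hle⟩ := exists_le_mul_seminorms hq
    exact ⟨j, C, hC, fun y hy z => (hb ⟨y, hy⟩ z).trans (hle z)⟩
  · rintro ⟨j, C, hC, hb⟩ -
    exact ⟨C.toNNReal • seminorms 𝕂 d 𝕂 (j, absSeminorm 𝕂),
      (continuous_seminorms j _).const_smul C.toNNReal, fun y z =>
      (hb y.1 y.2 z).trans (by
        rw [_root_.smul_apply, NNReal.smul_def, Real.coe_toNNReal _ hC, smul_eq_mul])⟩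

theorem exists_norm_dual_le (y : KappaDual 𝕂 (RapidSp 𝕂 d 𝕂)) : ∃ (j : ℕ) (C : ℝ), 0 ≤ C ∧
    ∀ z, ‖y z‖ ≤ C * seminorms 𝕂 d 𝕂 (j, absSeminorm 𝕂) z :=
  exists_le_mul_seminorms (q := (normSeminorm 𝕂 𝕂).comp
    ((UniformConvergenceCLM.ofFun (RingHom.id 𝕂) 𝕂 _).symm y).toLinearMap)
    (continuous_norm.comp (map_continuous y))

theorem delta_apply (n : Fin d → ℕ) (z : RapidSp 𝕂 d 𝕂) : delta 𝕂 d n z = z n := rfl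

theorem hasSum_smul_delta (y : KappaDual 𝕂 (RapidSp 𝕂 d 𝕂)) :
    HasSum (fun n => y (single 𝕂 𝕂 n 1) • delta 𝕂 d n) y := by
  obtain ⟨j, C, hC, hb⟩ := exists_norm_dual_le y
  refine tendsto_sub_nhds_zero_iff.1 ?_
  rw [UniformConvergenceCLM.nhds_zero_eq_of_basis _ _ _ Metric.nhds_basis_ball]
  simp only [tendsto_iInf, tendsto_principal]
  rintro K ⟨-, hK⟩ ε hε
  obtain ⟨M, hM⟩ := hK.bddAbove_image (continuous_seminorms (j + 2 * d) (absSeminorm 𝕂)).continuousOn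
  have hε' : 0 < ε / (C + 1) := by positivity
  filter_upwards [eventually_seminorms_sub_sum_single_le (absSeminorm 𝕂) j M hε'] with s hs z hz
  have hval : (∑ n ∈ s, y (single 𝕂 𝕂 n 1) • delta 𝕂 d n - y) z =
      -y (z - ∑ n ∈ s, single 𝕂 𝕂 n (z n)) := by
    rw [map_sub, map_sum, neg_sub, _root_.sub_apply, _root_.sum_apply]
    congr 1
    refine Finset.sum_congr rfl fun n _ => ?_
    rw [single_eq_smul n (z n), map_smul]
    exact mul_comm (y (single 𝕂 𝕂 n 1)) (z n)
  rw [mem_ball_zero_iff, hval, norm_neg]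
  calc _ ≤ C * (ε / (C + 1)) := (hb _).trans
        (mul_le_mul_of_nonneg_left (hs z (hM ⟨z, hz, rfl⟩)) hC)
    _ < (C + 1) * (ε / (C + 1)) := by gcongr; exact lt_add_one C
    _ = ε := by field_simp

end RapidSp

end Dual

/-! ### Compact boxes in the space of rapidly decreasing sequences -/

section Box

variable {d : ℕ} {𝕂 : Type*} [RCLike 𝕂]

variable (𝕂) in
/-- The sequences dominated by `r`. -/
def rapidBox (r : (Fin d → ℕ) → ℝ) : Set (RapidSp 𝕂 d 𝕂) := {z | ∀ n, ‖z n‖ ≤ r n}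

theorem absConvex_rapidBox (r : (Fin d → ℕ) → ℝ) : AbsConvex 𝕂 (rapidBox 𝕂 r) := by
  constructor
  · rintro a ha _ ⟨z, hz, rfl⟩ n
    change ‖a * z n‖ ≤ r n
    rw [norm_mul]
    exact (mul_le_of_le_one_left (norm_nonneg _) ha).trans (hz n)
  · intro z hz w hw a b ha hb hab n
    have hc : Convex 𝕂 (Metric.closedBall (0 : 𝕂) (r n)) :=
      convex_RCLike_iff_convex_real.2 (convex_closedBall _ _)
    have := hc (mem_closedBall_zero_iff.2 (hz n)) (mem_closedBall_zero_iff.2 (hw n)) ha hb hab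
    exact mem_closedBall_zero_iff.1 this

theorem isCompact_rapidBox {r : (Fin d → ℕ) → ℝ}
    (hr : ∀ j, ∃ M, ∀ n, r n * rapidWeight d j n ≤ M) : IsCompact (rapidBox 𝕂 r) := by
  let X := {z : (Fin d → ℕ) → 𝕂 // ∀ n, ‖z n‖ ≤ r n}
  have hX : CompactSpace X := by
    refine (isCompact_iff_compactSpace (s := {z : (Fin d → ℕ) → 𝕂 | ∀ n, ‖z n‖ ≤ r n})).1 ?_
    convert isCompact_univ_pi fun n => isCompact_closedBall (0 : 𝕂) (r n) using 1
    ext z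
    simp
  have hmem : ∀ z : X, z.1 ∈ rapidSubmodule 𝕂 d 𝕂 := fun z j p => by
    obtain ⟨M, hM⟩ := hr j
    refine ⟨p.1 1 * M, ?_⟩
    rintro _ ⟨n, rfl⟩
    have h : p.1 (z.1 n) = p.1 1 * ‖z.1 n‖ := by
      rw [mul_comm, ← map_smul_eq_mul, smul_eq_mul, mul_one]
    dsimp only
    rw [h, mul_assoc]
    exact mul_le_mul_of_nonneg_left ((mul_le_mul_of_nonneg_right (z.2 n)
      (rapidWeight_pos _ _).le).trans (hM n)) (apply_nonneg _ _)
  let J : X → RapidSp 𝕂 d 𝕂 := fun z => ⟨z.1, hmem z⟩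
  have hrange : Set.range J = rapidBox 𝕂 r := by
    ext z
    exact ⟨by rintro ⟨z, rfl⟩; exact z.2, fun hz => ⟨⟨z.1, hz⟩, rfl⟩⟩
  rw [← hrange]
  refine isCompact_range (continuous_iff_continuousAt.2 fun z₀ => ?_)
  refine ((RapidSp.withSeminorms 𝕂 d 𝕂).tendsto_nhds _ _).2 ?_
  rintro ⟨j, p⟩ ε hε
  obtain ⟨M, hM⟩ := hr (j + 2 * d)
  have hfin := RapidSp.eventually_mul_inv_rapidWeight_le (d := d) (p.1 1 * (2 * M)) (half_pos hε)
  rw [eventually_cofinite] at hfin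
  have hev : ∀ n, ∀ᶠ z : X in 𝓝 z₀, p.1 (z.1 n - z₀.1 n) * rapidWeight d j n < ε / 2 := fun n => by
    have hc : Continuous fun z : X => p.1 (z.1 n - z₀.1 n) * rapidWeight d j n :=
      (p.2.comp (((continuous_apply n).comp continuous_subtype_val).sub continuous_const)).mul
        continuous_const
    have := hc.tendsto z₀
    rw [sub_self, map_zero, zero_mul] at this
    exact this.eventually_lt_const (half_pos hε)
  filter_upwards [(eventually_all_finite hfin).2 fun n _ => hev n] with z hz
  refine (RapidSp.seminorms_le fun n => ?_).trans_lt (half_lt_self hε)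
  by_cases hn : p.1 1 * (2 * M) * (rapidWeight d (2 * d) n)⁻¹ ≤ ε / 2
  · refine le_trans ?_ hn
    change p.1 (z.1 n - z₀.1 n) * _ ≤ _
    have h : p.1 (z.1 n - z₀.1 n) = p.1 1 * ‖z.1 n - z₀.1 n‖ := by
      rw [mul_comm, ← map_smul_eq_mul, smul_eq_mul, mul_one]
    have h₁ : ‖z.1 n - z₀.1 n‖ ≤ 2 * r n := (norm_sub_le _ _).trans (by linarith [z.2 n, z₀.2 n])
    rw [← div_eq_mul_inv, le_div_iff₀ (rapidWeight_pos _ n), h]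
    have hw := rapidWeight_pos (d := d) j n
    have hw' := rapidWeight_pos (d := d) (2 * d) n
    calc p.1 1 * ‖z.1 n - z₀.1 n‖ * rapidWeight d j n * rapidWeight d (2 * d) n
        ≤ p.1 1 * (2 * r n) * rapidWeight d j n * rapidWeight d (2 * d) n := by
          have := apply_nonneg p.1 (1 : 𝕂)
          gcongr
      _ = p.1 1 * (2 * (r n * rapidWeight d (j + 2 * d) n)) := by rw [rapidWeight_add]; ring
      _ ≤ _ := by
          have := apply_nonneg p.1 (1 : 𝕂)
          have := hM n
          gcongr
  · exact (hz n hn).le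

end Box

/-! ### The `ε`-product with the space of rapidly decreasing sequences -/

section EpsRapid

variable {d : ℕ} {𝕂 : Type*} [RCLike 𝕂] {E : Type*} [AddCommGroup E] [Module 𝕂 E]
  [TopologicalSpace E] [IsTopologicalAddGroup E] [ContinuousSMul 𝕂 E]

theorem exists_contSeminorm_ball_subset [PolynormableSpace 𝕂 E] {U : Set E} (hU : U ∈ 𝓝 0) :
    ∃ (p : ContSeminorm 𝕂 E) (ε : ℝ), 0 < ε ∧ ∀ e, p.1 e < ε → e ∈ U := by
  obtain ⟨s, ε, hε, h⟩ := ((PolynormableSpace.withSeminorms 𝕂 E).mem_nhds_iff _ _).1 hU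
  refine ⟨⟨s.sup fun p : ContSeminorm 𝕂 E => p.1, ?_⟩, ε, hε, fun e he => h ?_⟩
  · exact Seminorm.continuous_finsetSup fun p _ => p.2
  · rwa [Seminorm.mem_ball_zero]

/-- The set `{(1 + |n|²)^{j/2} δ_n}` of functionals. -/
def weightedDeltas (𝕂 : Type*) [RCLike 𝕂] (d j : ℕ) : Set (KappaDual 𝕂 (RapidSp 𝕂 d 𝕂)) :=
  Set.range fun n => (rapidWeight d j n : 𝕂) • RapidSp.delta 𝕂 d n

theorem norm_weightedDelta_apply_le (j : ℕ) (n : Fin d → ℕ) (z : RapidSp 𝕂 d 𝕂) :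
    ‖((rapidWeight d j n : 𝕂) • RapidSp.delta 𝕂 d n) z‖ ≤
      RapidSp.seminorms 𝕂 d 𝕂 (j, absSeminorm 𝕂) z := by
  refine le_trans (le_of_eq ?_) (z.weight_mul_le j (absSeminorm 𝕂) n)
  rw [smul_apply, norm_smul, RCLike.norm_ofReal, abs_of_pos (rapidWeight_pos j n), mul_comm]
  rfl

theorem equicontinuous_weightedDeltas (j : ℕ) :
    Equicontinuous fun (y : weightedDeltas 𝕂 d j) (z : RapidSp 𝕂 d 𝕂) => y.1 z := by
  refine RapidSp.equicontinuous_iff_exists_bound.2 ⟨j, 1, zero_le_one, ?_⟩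
  rintro _ ⟨n, rfl⟩ z
  rw [one_mul]
  exact norm_weightedDelta_apply_le j n z

theorem isVonNBounded_weightedDeltas (j : ℕ) : IsVonNBounded 𝕂 (weightedDeltas 𝕂 d j) := by
  refine UniformConvergenceCLM.isVonNBounded_iff.2 fun K hK => ?_
  obtain ⟨M, hM⟩ := hK.2.bddAbove_image
    (RapidSp.continuous_seminorms j (absSeminorm 𝕂)).continuousOn
  refine (NormedSpace.isVonNBounded_iff' 𝕂).2 ⟨M, ?_⟩
  rintro _ ⟨_, ⟨n, rfl⟩, z, hz, rfl⟩
  exact (norm_weightedDelta_apply_le j n z).trans (hM ⟨z, hz, rfl⟩)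

variable [PolynormableSpace 𝕂 E]

theorem seminorm_weightedDelta (u : EpsProduct 𝕂 (RapidSp 𝕂 d 𝕂) E) (p : ContSeminorm 𝕂 E) (j : ℕ)
    (n : Fin d → ℕ) : p.1 (u ((rapidWeight d j n : 𝕂) • RapidSp.delta 𝕂 d n)) =
      p.1 (u (RapidSp.delta 𝕂 d n)) * rapidWeight d j n := by
  rw [map_smul, map_smul_eq_mul, RCLike.norm_ofReal, abs_of_pos (rapidWeight_pos j n), mul_comm]

theorem bddAbove_seminorm_delta (u : EpsProduct 𝕂 (RapidSp 𝕂 d 𝕂) E) (j : ℕ)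
    (p : ContSeminorm 𝕂 E) : BddAbove (Set.range fun n =>
      p.1 (u (RapidSp.delta 𝕂 d n)) * rapidWeight d j n) := by
  have h := (isVonNBounded_weightedDeltas (𝕂 := 𝕂) (d := d) j).image
    ((UniformConvergenceCLM.ofFun (RingHom.id 𝕂) E _).symm u)
  obtain ⟨r, -, hr⟩ := ((PolynormableSpace.withSeminorms 𝕂 E).isVonNBounded_iff_seminorm_bounded).1
    h p
  refine ⟨r, ?_⟩
  rintro _ ⟨n, rfl⟩
  dsimp only
  rw [← seminorm_weightedDelta]
  exact (hr _ ⟨_, ⟨n, rfl⟩, rfl⟩).le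

variable (𝕂 d E) in
/-- The map `u ↦ (u (δ_n))_n` as a linear map. -/
noncomputable def epsEvalₗ : EpsProduct 𝕂 (RapidSp 𝕂 d 𝕂) E →ₗ[𝕂] RapidSp 𝕂 d E where
  toFun u := ⟨fun n => u (RapidSp.delta 𝕂 d n), bddAbove_seminorm_delta u⟩
  map_add' _ _ := rfl
  map_smul' _ _ := rfl

variable (𝕂 d E) in
/-- The map `s(ℕ₀^d) ε E → s(ℕ₀^d, E)`, `u ↦ (u (δ_n))_n`. -/
noncomputable def epsEval : EpsProduct 𝕂 (RapidSp 𝕂 d 𝕂) E →L[𝕂] RapidSp 𝕂 d E where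
  toLinearMap := epsEvalₗ d 𝕂 E
  cont := by
    refine continuous_of_continuousAt_zero (epsEvalₗ d 𝕂 E) ?_
    refine ((RapidSp.withSeminorms 𝕂 d E).tendsto_nhds _ _).2 ?_
    rintro ⟨j, p⟩ ε hε
    have hU : {e : E | p.1 e < ε / 2} ∈ 𝓝 0 :=
      p.2.continuousAt.eventually_lt_const (by rw [map_zero]; exact half_pos hε)
    filter_upwards [UniformConvergenceCLM.eventually_nhds_zero_mapsTo (RingHom.id 𝕂)
      (equicontinuous_weightedDeltas (𝕂 := 𝕂) (d := d) j) hU] with u hu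
    rw [map_zero, sub_zero]
    refine (RapidSp.seminorms_le fun n => ?_).trans_lt (half_lt_self hε)
    change p.1 (u (RapidSp.delta 𝕂 d n)) * _ ≤ _
    rw [← seminorm_weightedDelta]
    exact (hu ⟨n, rfl⟩).le

theorem epsEval_apply (u : EpsProduct 𝕂 (RapidSp 𝕂 d 𝕂) E) (n : Fin d → ℕ) :
    epsEval d 𝕂 E u n = u (RapidSp.delta 𝕂 d n) := rfl

variable [Module ℝ E] [IsScalarTower ℝ 𝕂 E] [T2Space E]

theorem LocallyComplete.summable_smul_of_rapid (hE : LocallyComplete 𝕂 E) {c : (Fin d → ℕ) → 𝕂}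
    {x : (Fin d → ℕ) → E} (h : ∀ p : ContSeminorm 𝕂 E, ∃ B, ∀ n,
      ‖c n‖ * (p.1 (x n) * rapidWeight d (2 * d) n) ≤ B) : Summable fun n => c n • x n := by
  have hs := hE.summable_smul (c := fun n : Fin d → ℕ => (rapidWeight d (2 * d) n)⁻¹)
    (y := fun n => rapidWeight d (2 * d) n • c n • x n) summable_inv_rapidWeight fun p => by
      obtain ⟨B, hB⟩ := h p
      refine ⟨B, fun n => le_trans (le_of_eq ?_) (hB n)⟩
      rw [p.map_real_smul, map_smul_eq_mul, abs_of_pos (rapidWeight_pos _ n)]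
      ring
  refine hs.congr fun n => ?_
  rw [smul_smul, inv_mul_cancel₀ (rapidWeight_pos _ n).ne', one_smul]

theorem ContSeminorm.tsum_smul_le (p : ContSeminorm 𝕂 E) {c : (Fin d → ℕ) → 𝕂}
    {x : (Fin d → ℕ) → E} (hs : Summable fun n => c n • x n) {B : ℝ}
    (h : ∀ n, ‖c n‖ * (p.1 (x n) * rapidWeight d (2 * d) n) ≤ B) :
    p.1 (∑' n, c n • x n) ≤ B * ∑' n : Fin d → ℕ, (rapidWeight d (2 * d) n)⁻¹ := by
  rw [← tsum_mul_left]
  refine p.le_tsum hs.hasSum (summable_inv_rapidWeight.mul_left B) fun n => ?_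
  rw [← div_eq_mul_inv, le_div_iff₀ (rapidWeight_pos _ n), map_smul_eq_mul, mul_assoc]
  exact h n

namespace RapidSp

theorem seminorms_single_one (j : ℕ) (n : Fin d → ℕ) :
    seminorms 𝕂 d 𝕂 (j, absSeminorm 𝕂) (single 𝕂 𝕂 n 1) ≤ rapidWeight d j n := by
  refine seminorms_le fun m => ?_
  rw [single_apply, absSeminorm_apply]
  split_ifs with h
  · simp [h]
  · simpa using (rapidWeight_pos j n).le

theorem norm_dual_mul_le {y : KappaDual 𝕂 (RapidSp 𝕂 d 𝕂)} {j : ℕ} {C : ℝ} (hC : 0 ≤ C)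
    (hy : ∀ z, ‖y z‖ ≤ C * seminorms 𝕂 d 𝕂 (j, absSeminorm 𝕂) z) (x : RapidSp 𝕂 d E)
    (p : ContSeminorm 𝕂 E) (n : Fin d → ℕ) :
    ‖y (single 𝕂 𝕂 n 1)‖ * (p.1 (x n) * rapidWeight d (2 * d) n) ≤
      C * seminorms 𝕂 d E (j + 2 * d, p) x := by
  have hw := rapidWeight_pos (d := d) (2 * d) n
  have hp := apply_nonneg p.1 (x n)
  calc _ ≤ C * rapidWeight d j n * (p.1 (x n) * rapidWeight d (2 * d) n) := by
        refine mul_le_mul_of_nonneg_right ((hy _).trans ?_) (mul_nonneg hp hw.le)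
        exact mul_le_mul_of_nonneg_left (seminorms_single_one j n) hC
    _ = C * (p.1 (x n) * rapidWeight d (j + 2 * d) n) := by rw [rapidWeight_add]; ring
    _ ≤ _ := mul_le_mul_of_nonneg_left (x.weight_mul_le _ p n) hC

theorem summable_dual_smul (hE : LocallyComplete 𝕂 E) (x : RapidSp 𝕂 d E)
    (y : KappaDual 𝕂 (RapidSp 𝕂 d 𝕂)) : Summable fun n => y (single 𝕂 𝕂 n 1) • x n := by
  obtain ⟨j, C, hC, hy⟩ := exists_norm_dual_le y
  exact hE.summable_smul_of_rapid fun p => ⟨_, norm_dual_mul_le hC hy x p⟩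

/-- The linear map `y ↦ ∑ n, y(e_n) x_n` on `s(ℕ₀^d)'`. -/
noncomputable def dualPairingₗ (hE : LocallyComplete 𝕂 E) (x : RapidSp 𝕂 d E) :
    KappaDual 𝕂 (RapidSp 𝕂 d 𝕂) →ₗ[𝕂] E where
  toFun y := ∑' n, y (single 𝕂 𝕂 n 1) • x n
  map_add' y y' := by
    rw [← (x.summable_dual_smul hE y).tsum_add (x.summable_dual_smul hE y')]
    exact tsum_congr fun n => add_smul _ _ _
  map_smul' c y := by
    rw [RingHom.id_apply, ← (x.summable_dual_smul hE y).tsum_const_smul]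
    exact tsum_congr fun n => mul_smul _ _ _

theorem continuous_dualPairingₗ (hE : LocallyComplete 𝕂 E) (x : RapidSp 𝕂 d E) :
    Continuous (dualPairingₗ hE x) := by
  refine continuous_of_continuousAt_zero (dualPairingₗ hE x) ?_
  refine ((PolynormableSpace.withSeminorms 𝕂 E).tendsto_nhds _ _).2 fun p ε hε => ?_
  set r : (Fin d → ℕ) → ℝ := fun n => p.1 (x n) * rapidWeight d (2 * d) n with hr
  have hr0 : ∀ n, 0 ≤ r n := fun n => mul_nonneg (apply_nonneg _ _) (rapidWeight_pos _ _).le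
  have hK : IsCompact (rapidBox 𝕂 r) := isCompact_rapidBox fun j =>
    ⟨seminorms 𝕂 d E (2 * d + j, p) x, fun n => by
      rw [hr, mul_assoc, ← rapidWeight_add]; exact x.weight_mul_le _ p n⟩
  set W : ℝ := ∑' n : Fin d → ℕ, (rapidWeight d (2 * d) n)⁻¹
  have hW : 0 ≤ W := tsum_nonneg fun n => inv_nonneg.2 (rapidWeight_pos _ _).le
  have hε' : 0 < ε / (W + 1) := by positivity
  filter_upwards [UniformConvergenceCLM.eventually_nhds_zero_mapsTo (RingHom.id 𝕂)
    (𝔖 := {K : Set (RapidSp 𝕂 d 𝕂) | AbsConvex 𝕂 K ∧ IsCompact K})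
    ⟨absConvex_rapidBox r, hK⟩ (Metric.ball_mem_nhds (0 : 𝕂) hε')] with y hy
  rw [map_zero, sub_zero]
  have hb : ∀ n, ‖y (single 𝕂 𝕂 n 1)‖ * r n ≤ ε / (W + 1) := fun n => by
    have hz : ((r n : 𝕂) • single 𝕂 𝕂 n 1) ∈ rapidBox 𝕂 r := fun m => by
      rw [smul_apply, single_apply, norm_smul, RCLike.norm_ofReal, abs_of_nonneg (hr0 n)]
      split_ifs with h
      · simp [h]
      · simpa using hr0 m
    have := mem_ball_zero_iff.1 (hy hz)
    rw [map_smul, norm_smul, RCLike.norm_ofReal, abs_of_nonneg (hr0 n), mul_comm] at this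
    exact this.le
  calc _ ≤ ε / (W + 1) * W := ContSeminorm.tsum_smul_le p (x.summable_dual_smul hE y) hb
    _ < ε / (W + 1) * (W + 1) := by gcongr; exact lt_add_one W
    _ = ε := by field_simp

/-- The element `y ↦ ∑ n, y(e_n) x_n` of `s(ℕ₀^d) ε E`. -/
noncomputable def dualPairing (hE : LocallyComplete 𝕂 E) (x : RapidSp 𝕂 d E) :
    EpsProduct 𝕂 (RapidSp 𝕂 d 𝕂) E :=
  UniformConvergenceCLM.ofFun _ _ _ ⟨dualPairingₗ hE x, continuous_dualPairingₗ hE x⟩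

theorem dualPairing_apply (hE : LocallyComplete 𝕂 E) (x : RapidSp 𝕂 d E)
    (y : KappaDual 𝕂 (RapidSp 𝕂 d 𝕂)) :
    dualPairing hE x y = ∑' n, y (single 𝕂 𝕂 n 1) • x n := rfl

theorem hasSum_eps_delta (u : EpsProduct 𝕂 (RapidSp 𝕂 d 𝕂) E) (y : KappaDual 𝕂 (RapidSp 𝕂 d 𝕂)) :
    HasSum (fun n => y (single 𝕂 𝕂 n 1) • u (delta 𝕂 d n)) (u y) := by
  refine ((hasSum_smul_delta y).map u (map_continuous u)).congr_fun fun n => ?_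
  exact (map_smul u _ _).symm

end RapidSp

/-- The linear map `x ↦ (y ↦ ∑ n, y(e_n) x_n)`. -/
noncomputable def epsOfRapidₗ (d : ℕ) (hE : LocallyComplete 𝕂 E) :
    RapidSp 𝕂 d E →ₗ[𝕂] EpsProduct 𝕂 (RapidSp 𝕂 d 𝕂) E where
  toFun x := RapidSp.dualPairing hE x
  map_add' x x' := UniformConvergenceCLM.ext _ _ fun y => by
    rw [add_apply]
    simp only [RapidSp.dualPairing_apply]
    rw [← (x.summable_dual_smul hE y).tsum_add (x'.summable_dual_smul hE y)]
    exact tsum_congr fun n => smul_add _ _ _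
  map_smul' c x := UniformConvergenceCLM.ext _ _ fun y => by
    rw [smul_apply]
    simp only [RapidSp.dualPairing_apply]
    rw [RingHom.id_apply, ← (x.summable_dual_smul hE y).tsum_const_smul]
    exact tsum_congr fun n => smul_comm _ _ _

/-- The map `s(ℕ₀^d, E) → s(ℕ₀^d) ε E`, `x ↦ (y ↦ ∑ n, y(e_n) x_n)`. -/
noncomputable def epsOfRapid (d : ℕ) (hE : LocallyComplete 𝕂 E) :
    RapidSp 𝕂 d E →L[𝕂] EpsProduct 𝕂 (RapidSp 𝕂 d 𝕂) E where
  toLinearMap := epsOfRapidₗ d hE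
  cont := by
    refine continuous_of_continuousAt_zero (epsOfRapidₗ d hE) ?_
    rw [ContinuousAt, map_zero, UniformConvergenceCLM.nhds_zero_eq]
    simp only [tendsto_iInf, tendsto_principal]
    intro H hH U hU
    obtain ⟨p, ε, hε, hpU⟩ := exists_contSeminorm_ball_subset (𝕂 := 𝕂) hU
    obtain ⟨j, C, hC, hb⟩ := RapidSp.equicontinuous_iff_exists_bound.1 hH
    set W : ℝ := ∑' n : Fin d → ℕ, (rapidWeight d (2 * d) n)⁻¹
    have hc : Continuous fun x : RapidSp 𝕂 d E =>
        C * RapidSp.seminorms 𝕂 d E (j + 2 * d, p) x * W :=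
      (continuous_const.mul (RapidSp.continuous_seminorms _ p)).mul continuous_const
    have h0 := hc.tendsto 0
    rw [map_zero, mul_zero, zero_mul] at h0
    filter_upwards [h0.eventually_lt_const hε] with x hx y hy
    exact hpU _ ((ContSeminorm.tsum_smul_le p (x.summable_dual_smul hE y)
      (RapidSp.norm_dual_mul_le hC (hb y hy) x p)).trans_lt hx)

theorem epsOfRapid_apply (hE : LocallyComplete 𝕂 E) (x : RapidSp 𝕂 d E)
    (y : KappaDual 𝕂 (RapidSp 𝕂 d 𝕂)) :
    epsOfRapid d hE x y = ∑' n, y (RapidSp.single 𝕂 𝕂 n 1) • x n := rfl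

/-- The topological isomorphism `s(ℕ₀^d) ε E → s(ℕ₀^d, E)`. -/
noncomputable def epsRapidEquiv (d : ℕ) (hE : LocallyComplete 𝕂 E) :
    EpsProduct 𝕂 (RapidSp 𝕂 d 𝕂) E ≃L[𝕂] RapidSp 𝕂 d E :=
  ContinuousLinearEquiv.equivOfInverse (epsEval d 𝕂 E) (epsOfRapid d hE)
    (fun u => UniformConvergenceCLM.ext _ _ fun y => by
      rw [epsOfRapid_apply]
      exact (RapidSp.hasSum_eps_delta u y).tsum_eq)
    (fun x => DFunLike.ext _ _ fun n => by
      rw [epsEval_apply, epsOfRapid_apply, tsum_eq_single n]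
      · rw [RapidSp.delta_apply, RapidSp.single_apply, if_pos rfl, one_smul]
      · intro m hm
        rw [RapidSp.delta_apply, RapidSp.single_apply, if_neg hm.symm, zero_smul])

theorem epsRapidEquiv_apply (hE : LocallyComplete 𝕂 E) (u : EpsProduct 𝕂 (RapidSp 𝕂 d 𝕂) E)
    (n : Fin d → ℕ) : epsRapidEquiv d hE u n = u (RapidSp.delta 𝕂 d n) := rfl

end EpsRapid

/-! ### The `ε`-product with the Schwartz space -/

section EpsSchwartz

variable {d : ℕ} {𝕂 : Type*} [RCLike 𝕂] {E : Type*} [AddCommGroup E] [Module 𝕂 E]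
  [TopologicalSpace E] [IsTopologicalAddGroup E] [ContinuousSMul 𝕂 E]

/-- The isomorphism `F₁ ε E → F₂ ε E` induced by an isomorphism `F₁ → F₂`. -/
noncomputable def epsCongr (E : Type*) [AddCommGroup E] [Module 𝕂 E]
    [TopologicalSpace E] [IsTopologicalAddGroup E] [ContinuousSMul 𝕂 E]
    {F₁ F₂ : Type*} [AddCommGroup F₁] [Module 𝕂 F₁] [TopologicalSpace F₁]
    [AddCommGroup F₂] [Module 𝕂 F₂] [TopologicalSpace F₂] (T : F₁ ≃L[𝕂] F₂) :
    EpsProduct 𝕂 F₁ E ≃L[𝕂] EpsProduct 𝕂 F₂ E :=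
  ContinuousLinearEquiv.equivOfInverse
    (epsMap (T : F₁ →L[𝕂] F₂) (ContinuousLinearMap.id 𝕂 E))
    (epsMap (T.symm : F₂ →L[𝕂] F₁) (ContinuousLinearMap.id 𝕂 E))
    (fun u => UniformConvergenceCLM.ext _ _ fun y => by
      simp only [epsMap_apply, ContinuousLinearMap.id_apply]
      congr 1
      refine UniformConvergenceCLM.ext _ _ fun z => ?_
      simp [kappaTranspose_apply])
    (fun u => UniformConvergenceCLM.ext _ _ fun y => by
      simp only [epsMap_apply, ContinuousLinearMap.id_apply]
      congr 1
      refine UniformConvergenceCLM.ext _ _ fun z => ?_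
      simp [kappaTranspose_apply])

theorem epsCongr_apply {F₁ F₂ : Type*} [AddCommGroup F₁] [Module 𝕂 F₁] [TopologicalSpace F₁]
    [AddCommGroup F₂] [Module 𝕂 F₂] [TopologicalSpace F₂] (T : F₁ ≃L[𝕂] F₂)
    (u : EpsProduct 𝕂 F₁ E) :
    epsCongr E T u = epsMap (T : F₁ →L[𝕂] F₂) (ContinuousLinearMap.id 𝕂 E) u := rfl

variable [Module ℝ E] [IsScalarTower ℝ 𝕂 E] [T2Space E] [PolynormableSpace 𝕂 E]

/-- The topological isomorphism `S(ℝ^d) ε E → S(ℝ^d, E)`. -/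
noncomputable def epsSchwartzEquiv (hE : LocallyComplete 𝕂 E) (hd : 0 < d) :
    EpsProduct 𝕂 (SchwartzSp 𝕂 d 𝕂) E ≃L[𝕂] SchwartzSp 𝕂 d E :=
  ((epsCongr E (coeffEquiv (locallyComplete_self 𝕂) hd)).trans (epsRapidEquiv d hE)).trans
    (coeffEquiv hE hd).symm

theorem hermiteSeries_single (n : Fin d → ℕ) (e : E) (x : EuclideanSpace ℝ (Fin d)) :
    hermiteSeries (RapidSp.single 𝕂 E n e) x = hermiteFun n x • e := by
  refine (tsum_eq_single n fun m hm => ?_).trans ?_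
  · rw [RapidSp.single_apply, if_neg hm, smul_zero]
  · rw [RapidSp.single_apply, if_pos rfl]

theorem epsSchwartzEquiv_apply (hE : LocallyComplete 𝕂 E) (hd : 0 < d)
    (u : EpsProduct 𝕂 (SchwartzSp 𝕂 d 𝕂) E) (x : EuclideanSpace ℝ (Fin d)) :
    epsSchwartzEquiv hE hd u x = u (SchwartzSp.delta 𝕂 d x) := by
  set F := coeffEquiv (E := 𝕂) (locallyComplete_self 𝕂) hd
  set v := epsCongr E F u with hv
  set y := kappaTranspose (F.symm : RapidSp 𝕂 d 𝕂 →L[𝕂] SchwartzSp 𝕂 d 𝕂)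
    (SchwartzSp.delta 𝕂 d x) with hy
  have hvy : v y = u (SchwartzSp.delta 𝕂 d x) := by
    rw [hv, epsCongr_apply, epsMap_apply, ContinuousLinearMap.id_apply]
    congr 1
    refine UniformConvergenceCLM.ext _ _ fun z => ?_
    simp [hy, kappaTranspose_apply]
  have hval : ∀ n, y (RapidSp.single 𝕂 𝕂 n 1) = (hermiteFun n x : 𝕂) := fun n => by
    refine (hermiteSeries_single n (1 : 𝕂) x).trans ?_
    rw [RCLike.real_smul_eq_coe_mul, mul_one]
  have h := RapidSp.hasSum_eps_delta v y
  rw [hvy] at h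
  refine HasSum.unique ?_ h
  refine (hasSum_hermiteSeries hE (epsRapidEquiv d hE v) x).congr_fun fun n => ?_
  rw [hval, epsRapidEquiv_apply, RCLike.real_smul_eq_coe_smul (K := 𝕂)]

end EpsSchwartz

/-! ### The Schauder decompositions -/

section Schauder

variable {d : ℕ} {𝕂 : Type*} [RCLike 𝕂] {E : Type*} [AddCommGroup E] [Module 𝕂 E] [Module ℝ E]
  [IsScalarTower ℝ 𝕂 E] [TopologicalSpace E] [IsTopologicalAddGroup E] [ContinuousSMul 𝕂 E]
  [T2Space E] [PolynormableSpace 𝕂 E]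

/-- The operators `f ↦ f^(n) h_n` on `S(ℝ^d, E)`. -/
noncomputable def hermiteProj (hE : LocallyComplete 𝕂 E) (hd : 0 < d) (n : Fin d → ℕ) :
    SchwartzSp 𝕂 d E →L[𝕂] SchwartzSp 𝕂 d E :=
  ((synthesis d hE).comp (RapidSp.coordProj 𝕂 E n)).comp (analysis hE hd)

theorem hermiteProj_apply (hE : LocallyComplete 𝕂 E) (hd : 0 < d) (n : Fin d → ℕ)
    (f : SchwartzSp 𝕂 d E) (x : EuclideanSpace ℝ (Fin d)) :
    hermiteProj hE hd n f x = hermiteFun n x • hermiteCoeff 𝕂 f n :=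
  hermiteSeries_single n _ x

theorem hermiteProj_comp (hE : LocallyComplete 𝕂 E) (hd : 0 < d) (n m : Fin d → ℕ) :
    (hermiteProj hE hd n).comp (hermiteProj hE hd m) =
      if n = m then hermiteProj hE hd n else 0 := by
  ext1 f
  simp only [hermiteProj, ContinuousLinearMap.comp_apply, analysis_synthesis]
  simp only [RapidSp.coordProj_apply, RapidSp.single_apply]
  rcases eq_or_ne n m with rfl | h
  · simp [RapidSp.coordProj_apply]
  · simp [h]

theorem hasSum_hermiteProj (hE : LocallyComplete 𝕂 E) (hd : 0 < d) (f : SchwartzSp 𝕂 d E) :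
    HasSum (fun n => hermiteProj hE hd n f) f := by
  have h := (RapidSp.hasSum_single (analysis hE hd f)).mapL (synthesis d hE)
  rwa [synthesis_analysis] at h

theorem hermiteProj_single (hE : LocallyComplete 𝕂 E) (hd : 0 < d) (n m : Fin d → ℕ) (e : E) :
    hermiteProj hE hd m (synthesis d hE (RapidSp.single 𝕂 E n e)) =
      if m = n then synthesis d hE (RapidSp.single 𝕂 E n e) else 0 := by
  simp only [hermiteProj, ContinuousLinearMap.comp_apply, analysis_synthesis,
    RapidSp.coordProj_apply, RapidSp.single_apply]
  rcases eq_or_ne m n with rfl | h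
  · simp
  · simp [h]

theorem isSchauderDecomposition_sum_hermiteProj [Nontrivial E] (hE : LocallyComplete 𝕂 E)
    (hd : 0 < d) {B : ℕ → Finset (Fin d → ℕ)} (hmono : StrictMono B) (hB : ∀ n, ∃ k, n ∈ B k) :
    IsSchauderDecomposition fun k => ∑ n ∈ B k, hermiteProj hE hd n where
  comp_eq k j := by
    have h : B k ∩ B j = B (min k j) := by
      rcases le_total k j with h | h
      · rw [min_eq_left h, Finset.inter_eq_left.2 (hmono.monotone h)]
      · rw [min_eq_right h, Finset.inter_eq_right.2 (hmono.monotone h)]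
    simp only [ContinuousLinearMap.finsetSum_comp, ContinuousLinearMap.comp_finsetSum,
      hermiteProj_comp]
    rw [← h, Finset.inter_comm, ← Finset.filter_mem_eq_inter, Finset.sum_filter]
    refine Finset.sum_congr rfl fun n _ => ?_
    rw [Finset.sum_ite_eq']
  ne := by
    have key : ∀ k j, k < j →
        ∑ n ∈ B k, hermiteProj hE hd n ≠ ∑ n ∈ B j, hermiteProj hE hd n := by
      intro k j hkj heq
      obtain ⟨n, hnj, hnk⟩ := Finset.exists_of_ssubset (hmono hkj)
      obtain ⟨e, he⟩ := exists_ne (0 : E)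
      set f := synthesis d hE (RapidSp.single 𝕂 E n e) with hf
      have h : ∀ s : Finset (Fin d → ℕ), (∑ m ∈ s, hermiteProj hE hd m) f =
          if n ∈ s then f else 0 := fun s => by
        rw [_root_.sum_apply]
        simp only [hf, hermiteProj_single]
        exact Finset.sum_ite_eq' s n _
      have h' := congrArg (fun T => T f) heq
      simp only [h, hnj, hnk, if_true, if_false] at h'
      have h'' := congrArg (analysis hE hd) h'
      rw [map_zero, hf, analysis_synthesis] at h''
      have := DFunLike.congr_fun h'' n
      rw [RapidSp.single_apply, if_pos rfl] at this
      exact he this.symm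
    intro k j hkj
    rcases lt_or_gt_of_ne hkj with h | h
    · exact key k j h
    · exact (key j k h).symm
  tendsto f := by
    have h := (hasSum_hermiteProj hE hd f).comp
      (tendsto_atTop_finset_of_monotone hmono.monotone hB)
    refine h.congr fun k => ?_
    exact (_root_.sum_apply _ _ _).symm

theorem euclNorm_single (i : Fin d) (k : ℕ) : euclNorm (Pi.single i k : Fin d → ℕ) = k := by
  rw [euclNorm, Finset.sum_eq_single i]
  · rw [Pi.single_eq_same, Real.sqrt_sq (Nat.cast_nonneg k)]
  · intro j _ hj
    simp [hj]
  · simp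

theorem strictMono_euclBall (hd : 0 < d) : StrictMono (euclBall d) := by
  refine strictMono_nat_of_lt_succ fun k => (Finset.ssubset_iff_of_subset fun n hn =>
    mem_euclBall.2 ((mem_euclBall.1 hn).trans (Nat.cast_le.2 k.le_succ))).2
    ⟨Pi.single ⟨0, hd⟩ (k + 1), mem_euclBall.2 ?_, fun h => ?_⟩
  · rw [euclNorm_single]
  · have := mem_euclBall.1 h
    rw [euclNorm_single, Nat.cast_le] at this
    omega

theorem strictMono_lengthBall (hd : 0 < d) : StrictMono (lengthBall d) := by
  refine strictMono_nat_of_lt_succ fun k => (Finset.ssubset_iff_of_subset fun n hn =>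
    mem_lengthBall.2 ((mem_lengthBall.1 hn).trans k.le_succ)).2
    ⟨Pi.single ⟨0, hd⟩ (k + 1), mem_lengthBall.2 ?_, fun h => ?_⟩
  · simp
  · simpa using mem_lengthBall.1 h

end Schauder

theorem mainTheorem12 {𝕂 : Type*} [RCLike 𝕂] {E : Type*} [AddCommGroup E] [Module 𝕂 E]
    [Module ℝ E] [IsScalarTower ℝ 𝕂 E] [TopologicalSpace E] [IsTopologicalAddGroup E]
    [ContinuousSMul 𝕂 E] [LocallyConvexSpace ℝ E] [T2Space E] [Nontrivial E]
    (hE : LocallyComplete 𝕂 E) (d : ℕ) (hd : 1 ≤ d) :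
    -- the Fourier coefficients are well-defined as Pettis integrals
    (∀ (f : SchwartzSp 𝕂 d E) (n : Fin d → ℕ),
      PettisIntegrable 𝕂 (fun x => hermiteFun n x • f x) volume) ∧
    -- the Hermite expansion and the Schauder decomposition, for `|n|` Euclidean or the length
    (∃ Q : (Fin d → ℕ) → (SchwartzSp 𝕂 d E →L[𝕂] SchwartzSp 𝕂 d E),
      (∀ n f x, Q n f x = hermiteFun n x • hermiteCoeff 𝕂 f n) ∧
      IsSchauderDecomposition (fun k => ∑ n ∈ euclBall d k, Q n) ∧
      IsSchauderDecomposition (fun k => ∑ n ∈ lengthBall d k, Q n) ∧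
      ∀ f, HasSum (fun n => Q n f) f) ∧
    -- the coefficient map is an isomorphism and factors through the `ε`-products
    (∃ (FE : SchwartzSp 𝕂 d E ≃L[𝕂] RapidSp 𝕂 d E)
      (FK : SchwartzSp 𝕂 d 𝕂 ≃L[𝕂] RapidSp 𝕂 d 𝕂)
      (SS : EpsProduct 𝕂 (SchwartzSp 𝕂 d 𝕂) E ≃L[𝕂] SchwartzSp 𝕂 d E)
      (Ss : EpsProduct 𝕂 (RapidSp 𝕂 d 𝕂) E ≃L[𝕂] RapidSp 𝕂 d E),
      (∀ f n, FE f n = hermiteCoeff 𝕂 f n) ∧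
      (∀ f n, FK f n = hermiteCoeff 𝕂 f n) ∧
      (∀ u x, SS u x = u (SchwartzSp.delta 𝕂 d x)) ∧
      (∀ u n, Ss u n = u (RapidSp.delta 𝕂 d n)) ∧
      ∀ f, FE f = Ss (epsMap (FK : SchwartzSp 𝕂 d 𝕂 →L[𝕂] RapidSp 𝕂 d 𝕂)
        (ContinuousLinearMap.id 𝕂 E) (SS.symm f))) := by
  have : PolynormableSpace 𝕂 E := polynormableSpace_of_locallyConvexSpace_real
  refine ⟨fun f n => f.pettisIntegrable hE n,
    ⟨hermiteProj hE hd, fun n f x => hermiteProj_apply hE hd n f x,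
      isSchauderDecomposition_sum_hermiteProj hE hd (strictMono_euclBall hd) fun n => ?_,
      isSchauderDecomposition_sum_hermiteProj hE hd (strictMono_lengthBall hd) fun n =>
        ⟨_, mem_lengthBall.2 le_rfl⟩, hasSum_hermiteProj hE hd⟩,
    coeffEquiv hE hd, coeffEquiv (locallyComplete_self 𝕂) hd, epsSchwartzEquiv hE hd,
    epsRapidEquiv d hE, fun _ _ => rfl, fun _ _ => rfl, epsSchwartzEquiv_apply hE hd,
    fun _ _ => rfl, fun f => ?_⟩
  · obtain ⟨k, hk⟩ := exists_nat_ge (euclNorm n)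
    exact ⟨k, mem_euclBall.2 hk⟩
  · rw [← epsCongr_apply]
    exact ((coeffEquiv hE hd).eq_symm_apply.1
      ((epsSchwartzEquiv hE hd).apply_symm_apply f).symm)
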